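/- **Theorem (Alternative cut-or-match).** There are a deterministic parallel algorithm and constants $K,k$ such that the following holds. Let $G=(V,E)$ be a finite simple undirected graph with $n\ge 1$ vertices, $m$ edges, $n_0$ isolated vertices, and maximum degree at most $16$. Let $0<\phi<1$ be real, and let $S,T\subseteq V$ be sets of sources and sinks with $|S|\le |T|$. Given $n$, the adjacency lists of $G$, the indicator vectors of $S$ and $T$, and the integer $\lceil 1/\phi\rceil$, the algorithm outputs a set $C\subseteq V$ and a finite list $\mathcal P$ of simple paths of $G$. Each path leads from a vertex of $S$ to a vertex of $T$ (a path of length $0$ at a vertex of $S\cap T$ is allowed). No two paths have the same first vertex and no two have the same last vertex, so the paths embed a (possibly non-perfect) matching between $S$ and $T$. Moreover: * every edge of $G$ lies on at most $K\log^k(n+2)\cdot\frac1\phi$ paths of $\mathcal P$; * $C$ contains every vertex of $S$ that is not the first vertex of a path in $\mathcal P$; * $C$ contains no vertex of $T$ that is not the last vertex of a path in $\mathcal P$; * either $C=\emptyset$, or $|E(C,V\setminus C)|\le \phi\cdot\deg_G(C)+2\phi m$, where $E(C,V\setminus C)$ is the set of edges with exactly one endpoint in $C$, and $\deg_G(C)=\sum_{v\in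 C}\deg_G(v)$. The algorithm performs work at most $K\log^k(n+2)\cdot\frac{m+n_0}{\phi^2}$ and has span at most $K\log^k(n+2)\cdot\frac1{\phi^4}$. In particular, the work is $\tilde O(m/\phi^2)$ if $G$ has no isolated vertices. Here the algorithm is one fixed program, independent of the instance, on a shared-memory nested-parallel (fork-join) machine with words of $O(\log(n+1/\phi))$ bits. Memory cells may be read concurrently, but a cell written by one thread of a parallel loop is neither read nor written by another thread of that loop. Work is the total number of elementary operations and span is the length of a longest chain of sequentially dependent ones. -/

import Mathlib

/-! ### A nested-parallel word RAM with work and span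

Shared memory consists of arrays of words (an array name and an index determine a cell); every
thread has its own registers. A word has `w` bits. Threads are created and joined by a parallel
loop; concurrent reads are allowed, but a cell that is written by one thread of a parallel loop
may be neither read nor written by another thread of that loop (an execution with such a race
does not exist). -/

namespace ParRAM

/-- Register contents of a thread. -/
abbrev Regs := ℕ → ℕ

/-- Contents of the shared memory: `m a i` is entry `i` of array `a`. -/
abbrev Mem := ℕ → ℕ → ℕ

/-- A cell of the shared memory: array name and index. -/
abbrev Cell := ℕ × ℕ

/-- Expressions: constants, registers, memory reads, and the arithmetic of a word RAM. -/
inductive Expr : Type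
  | const (c : ℕ)
  | reg (x : ℕ)
  | read (a : ℕ) (i : Expr)
  | add (e f : Expr)
  | sub (e f : Expr)
  | mul (e f : Expr)
  | div (e f : Expr)
  | mod (e f : Expr)
  | lt (e f : Expr)
  | eq (e f : Expr)

namespace Expr

/-- Value of an expression on a machine with `w`-bit words. Addition and multiplication are modulo
`2 ^ w`, subtraction is truncated at `0`, comparisons return `0` or `1`. -/
def eval (w : ℕ) (r : Regs) (m : Mem) : Expr → ℕ
  | const c => c % 2 ^ w
  | reg x => r x
  | read a i => m a (i.eval w r m)
  | add e f => (e.eval w r m + f.eval w r m) % 2 ^ w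
  | sub e f => e.eval w r m - f.eval w r m
  | mul e f => (e.eval w r m * f.eval w r m) % 2 ^ w
  | div e f => e.eval w r m / f.eval w r m
  | mod e f => e.eval w r m % f.eval w r m
  | lt e f => if e.eval w r m < f.eval w r m then 1 else 0
  | eq e f => if e.eval w r m = f.eval w r m then 1 else 0

/-- The memory cells that the evaluation of an expression reads. -/
def cells (w : ℕ) (r : Regs) (m : Mem) : Expr → Set Cell
  | const _ => ∅
  | reg _ => ∅
  | read a i => insert (a, i.eval w r m) (i.cells w r m)
  | add e f => e.cells w r m ∪ f.cells w r m
  | sub e f => e.cells w r m ∪ f.cells w r m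
  | mul e f => e.cells w r m ∪ f.cells w r m
  | div e f => e.cells w r m ∪ f.cells w r m
  | mod e f => e.cells w r m ∪ f.cells w r m
  | lt e f => e.cells w r m ∪ f.cells w r m
  | eq e f => e.cells w r m ∪ f.cells w r m

/-- Number of elementary operations in the evaluation of an expression. -/
def cost : Expr → ℕ
  | const _ => 1
  | reg _ => 1
  | read _ i => i.cost + 1
  | add e f => e.cost + f.cost + 1
  | sub e f => e.cost + f.cost + 1
  | mul e f => e.cost + f.cost + 1
  | div e f => e.cost + f.cost + 1
  | mod e f => e.cost + f.cost + 1
  | lt e f => e.cost + f.cost + 1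
  | eq e f => e.cost + f.cost + 1

end Expr

/-- Programs. `par x e c` runs `c` once for each `i < e`, in parallel, with `i` in register `x`. -/
inductive Prog : Type
  | skip
  | assign (x : ℕ) (e : Expr)
  | write (a : ℕ) (i e : Expr)
  | seq (c d : Prog)
  | ite (b : Expr) (c d : Prog)
  | loop (b : Expr) (c : Prog)
  | par (x : ℕ) (e : Expr) (c : Prog)

/-- What an execution leaves behind: final registers and memory, the cells it has read and
written, its work (number of elementary operations, over all threads) and its span (length of a
longest chain of sequentially dependent elementary operations). -/
structure Outcome where
  regs : Regs
  mem : Mem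
  reads : Set Cell
  writes : Set Cell
  work : ℕ
  span : ℕ

/-- `Exec w c r m o`: on `w`-bit words, program `c` started with registers `r` and memory `m`
halts without a race, with outcome `o`. -/
inductive Exec (w : ℕ) : Prog → Regs → Mem → Outcome → Prop
  | skip (r : Regs) (m : Mem) : Exec w .skip r m ⟨r, m, ∅, ∅, 1, 1⟩
  | assign (x : ℕ) (e : Expr) (r : Regs) (m : Mem) :
      Exec w (.assign x e) r m
        ⟨Function.update r x (e.eval w r m), m, e.cells w r m, ∅, e.cost + 1, e.cost + 1⟩
  | write (a : ℕ) (i e : Expr) (r : Regs) (m : Mem) :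
      Exec w (.write a i e) r m
        ⟨r, Function.update m a (Function.update (m a) (i.eval w r m) (e.eval w r m)),
          i.cells w r m ∪ e.cells w r m, {(a, i.eval w r m)},
          i.cost + e.cost + 1, i.cost + e.cost + 1⟩
  | seq (c d : Prog) (r : Regs) (m : Mem) (o₁ o₂ : Outcome) :
      Exec w c r m o₁ → Exec w d o₁.regs o₁.mem o₂ →
      Exec w (.seq c d) r m
        ⟨o₂.regs, o₂.mem, o₁.reads ∪ o₂.reads, o₁.writes ∪ o₂.writes,
          o₁.work + o₂.work, o₁.span + o₂.span⟩
  | iteTrue (b : Expr) (c d : Prog) (r : Regs) (m : Mem) (o : Outcome) :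
      b.eval w r m ≠ 0 → Exec w c r m o →
      Exec w (.ite b c d) r m
        ⟨o.regs, o.mem, b.cells w r m ∪ o.reads, o.writes,
          b.cost + 1 + o.work, b.cost + 1 + o.span⟩
  | iteFalse (b : Expr) (c d : Prog) (r : Regs) (m : Mem) (o : Outcome) :
      b.eval w r m = 0 → Exec w d r m o →
      Exec w (.ite b c d) r m
        ⟨o.regs, o.mem, b.cells w r m ∪ o.reads, o.writes,
          b.cost + 1 + o.work, b.cost + 1 + o.span⟩
  | loopDone (b : Expr) (c : Prog) (r : Regs) (m : Mem) :
      b.eval w r m = 0 →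
      Exec w (.loop b c) r m ⟨r, m, b.cells w r m, ∅, b.cost + 1, b.cost + 1⟩
  | loopStep (b : Expr) (c : Prog) (r : Regs) (m : Mem) (o₁ o₂ : Outcome) :
      b.eval w r m ≠ 0 → Exec w c r m o₁ → Exec w (.loop b c) o₁.regs o₁.mem o₂ →
      Exec w (.loop b c) r m
        ⟨o₂.regs, o₂.mem, b.cells w r m ∪ (o₁.reads ∪ o₂.reads), o₁.writes ∪ o₂.writes,
          b.cost + 1 + (o₁.work + o₂.work), b.cost + 1 + (o₁.span + o₂.span)⟩
  | par (x : ℕ) (e : Expr) (c : Prog) (r : Regs) (m : Mem) (o : ℕ → Outcome) (m' : Mem) :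
      (∀ i < e.eval w r m, Exec w c (Function.update r x i) m (o i)) →
      -- no races
      (∀ i < e.eval w r m, ∀ j < e.eval w r m, i ≠ j →
        Disjoint (o i).writes ((o j).reads ∪ (o j).writes)) →
      -- `m'` is `m` with the writes of all threads
      (∀ i < e.eval w r m, ∀ a k, (a, k) ∈ (o i).writes → m' a k = (o i).mem a k) →
      (∀ a k, (∀ i < e.eval w r m, (a, k) ∉ (o i).writes) → m' a k = m a k) →
      Exec w (.par x e c) r m
        ⟨r, m', e.cells w r m ∪ {z | ∃ i < e.eval w r m, z ∈ (o i).reads},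
          {z | ∃ i < e.eval w r m, z ∈ (o i).writes},
          e.cost + 1 + ∑ i ∈ Finset.range (e.eval w r m), ((o i).work + 1),
          e.cost + 1 + (Finset.range (e.eval w r m)).sup fun i => (o i).span + 1⟩

end ParRAM

/-! ### Graphs, paths, cuts -/

namespace CutMatch

/-- A pair of vertices of `G` together with a (simple) path of `G` from the first to the second. -/
structure RoutedPair {n : ℕ} (G : SimpleGraph (Fin n)) where
  src : Fin n
  dst : Fin n
  path : G.Walk src dst
  isPath : path.IsPath

/-- The pairs joined by the paths in `P` form a matching between `S` and `T`: every path leads from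
`S` to `T`, different paths have different first vertices and different last vertices. -/
def EmbedsMatching {n : ℕ} {G : SimpleGraph (Fin n)} (S T : Finset (Fin n))
    (P : List (RoutedPair G)) : Prop :=
  (∀ p ∈ P, p.src ∈ S ∧ p.dst ∈ T) ∧ (P.map RoutedPair.src).Nodup ∧ (P.map RoutedPair.dst).Nodup

/-- Number of paths in `P` on which the edge `e` appears. -/
def congestion {n : ℕ} {G : SimpleGraph (Fin n)} (P : List (RoutedPair G))
    (e : Sym2 (Fin n)) : ℕ :=
  P.countP fun p => decide (e ∈ p.path.edges)

/-- The number of edges, `m`. -/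
def numEdges {n : ℕ} (G : SimpleGraph (Fin n)) [DecidableRel G.Adj] : ℕ :=
  G.edgeFinset.card

/-- The number of isolated vertices. -/
def numIsolated {n : ℕ} (G : SimpleGraph (Fin n)) [DecidableRel G.Adj] : ℕ :=
  (Finset.univ.filter fun v => G.degree v = 0).card

/-- The volume `deg_G(C)`, the sum of the degrees of the vertices in `C`. -/
def vol {n : ℕ} (G : SimpleGraph (Fin n)) [DecidableRel G.Adj] (C : Finset (Fin n)) : ℕ :=
  ∑ v ∈ C, G.degree v

/-- The number `|E(C, V ∖ C)|` of edges with exactly one endpoint in `C`. -/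
def cutSize {n : ℕ} (G : SimpleGraph (Fin n)) [DecidableRel G.Adj] (C : Finset (Fin n)) : ℕ :=
  (G.interedges C Cᶜ).card

/-- The memory `m` holds the instance `(G, S, T, q)`: array `0` holds the number `n` of vertices and
the parameter `q`; the neighbours of vertex `v` are listed, in some order and without repetition, in
array `2` from index `m 1 v` on (adjacency lists with offsets in array `1`); arrays `3` and `4` hold
the indicator vectors of `S` and `T`. All other cells are `0`. -/
structure IsInput {n : ℕ} (G : SimpleGraph (Fin n)) [DecidableRel G.Adj] (S T : Finset (Fin n))
    (q : ℕ) (m : ParRAM.Mem) : Prop where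
  size : m 0 0 = n
  param : m 0 1 = q
  offset_zero : m 1 0 = 0
  offset_succ : ∀ v : Fin n, m 1 (v + 1) = m 1 v + G.degree v
  list_adj : ∀ v : Fin n, ∀ i < G.degree v, ∃ u : Fin n, G.Adj v u ∧ m 2 (m 1 v + i) = u
  list_all : ∀ v u : Fin n, G.Adj v u → ∃ i < G.degree v, m 2 (m 1 v + i) = u
  sources : ∀ v : Fin n, m 3 v = if v ∈ S then 1 else 0
  sinks : ∀ v : Fin n, m 4 v = if v ∈ T then 1 else 0
  rest_zero : ∀ i, 2 ≤ i → m 0 i = 0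
  rest_one : ∀ i, n < i → m 1 i = 0
  rest_two : ∀ i, m 1 n ≤ i → m 2 i = 0
  rest_three : ∀ i, n ≤ i → m 3 i = 0
  rest_four : ∀ i, n ≤ i → m 4 i = 0
  rest : ∀ a i, 5 ≤ a → m a i = 0

/-- The memory `m` holds the cut `C` and the list `P` of paths: array `5` holds the indicator vector
of `C`, entry `0` of array `6` the number of paths; path number `j` has `m 8 j` edges, and its
vertices are listed, in their order on the path, in array `9` from index `m 7 j` on. -/
structure IsOutput {n : ℕ} {G : SimpleGraph (Fin n)} (C : Finset (Fin n))
    (P : List (RoutedPair G)) (m : ParRAM.Mem) : Prop where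
  cut : ∀ v : Fin n, m 5 v = if v ∈ C then 1 else 0
  count : m 6 0 = P.length
  length : ∀ (j : ℕ) (h : j < P.length), m 8 j = P[j].path.length
  vertex : ∀ (j : ℕ) (h : j < P.length), ∀ i ≤ P[j].path.length,
    m 9 (m 7 j + i) = P[j].path.getVert i

end CutMatch

/-! The algorithm is a push-relabel scheme of bounded height in which heavily used edges become
longer. Put `q = ⌈1/φ⌉`. A vertex of `S ∩ T` is matched to itself. Every other source of positive
degree holds one unit that has to reach a vertex of `T \ S`. Vertices have heights, initially `0`.
Edges have lengths, initially `1`, and capacity `c = 4q`, which is renewed at each doubling of the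
length. Throughout, `h u ≤ h v + ell` for a dart from `u` to `v`, and a dart is admissible if
equality holds. There are `D = 2q` phases, and in phase `i` all active sources have height `i`.

A phase computes an almost blocking flow on the admissible darts in synchronous rounds. A waiting
unit is absorbed by a free sink. Otherwise it is forwarded along an admissible dart with capacity
left to a vertex that is not dead. If that is impossible, its vertex is dead and the unit goes back
along a dart on which units came, or, if there is none, it fails at its source. A potential of at
most `(2c + 1) * 2m` pays for all moves (`Net.Pot_round`). As only vertices with waiting units are
handled, it bounds the work of the phase up to a logarithm. The phase stops once at most `θ = 2m /
(64 q²)` units wait, so there are `O(q³)` rounds. The waiting units are given up. Then dead vertices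
rise by one, saturated edges double their length, and the failed units are the sources of the next
phase. Blocking is what preserves the height inequality (`Net.Next.wf`). With `2q` phases this gives
work of order `m q²` and span of order `q⁴`.

Paths: at each vertex incoming and outgoing units are numbered and matched number by number. All
units are traced in parallel. Heights drop strictly along a trace, so it is a simple path of length
at most `2q`. The tracing step is injective, so by counting every absorbed unit is the end of a
trace (`Net.exists_ends`).

Congestion: an edge of length `2 ^ j` has carried at most `c * (j + 1)` units (`Net.Next.load`).
Only edges no longer than the current maximal height are doubled (`Net.Next.ell_le`), so `j = O(log
q)`. If `q > n`, the trivial bound by the number of paths is used instead.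

Cut: the weight `∑ (2c - z) * ell`, with `z` the remaining capacity, grows in a phase by exactly
twice the total length of the net flow (`Net.Next.weight`). Since flow runs along admissible darts,
that length telescopes to at most the maximal height per unit sent (`Net.Inv.sum_nf_ell`). As `2D =
c`, the total length at the end is at most twice its initial value. The height inequality turns
total length into a bound on the sum of all level cuts (`sum_levelCut_le`), so some level `b` in `1,
..., 2q` has a cut of at most `2m / (2q)` darts. The output `C` consists of the vertices of height
at least `b` and the unmatched sources. An unmatched source below `b` is isolated or was given up.
There are at most `2q θ` of the latter kind, with at most `16` edges each, and the choice of `θ`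
yields `|E(C, V \ C)| * q ≤ 2m` (`Final.cut_le`). A free sink never rises, so unmatched sinks have
height `0 < b`.

The execution is verified with Hoare triples `Tr` and `Tc` carrying work and span. All bounds are
relative to the size of the program, so constants need no bookkeeping. The basic statement is a
race-free parallel sweep (`Tr.vec`). Prefix sums serve to compact the lists of vertices with waiting
units. -/

namespace ParRAM

/-! ### Expressions without overflow, and the cells they read -/

namespace Expr

/-- Value of an expression in the absence of overflow. -/
def val (r : Regs) (m : Mem) : Expr → ℕ
  | const c => c
  | reg x => r x
  | read a i => m a (i.val r m)
  | add e f => e.val r m + f.val r m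
  | sub e f => e.val r m - f.val r m
  | mul e f => e.val r m * f.val r m
  | div e f => e.val r m / f.val r m
  | mod e f => e.val r m % f.val r m
  | lt e f => if e.val r m < f.val r m then 1 else 0
  | eq e f => if e.val r m = f.val r m then 1 else 0

/-- A size measure that bounds both the cost and the magnitude of the value. -/
def size : Expr → ℕ
  | const c => c + 1
  | reg _ => 1
  | read _ i => i.size + 1
  | add e f => e.size + f.size + 1
  | sub e f => e.size + f.size + 1
  | mul e f => e.size + f.size + 1
  | div e f => e.size + f.size + 1
  | mod e f => e.size + f.size + 1
  | lt e f => e.size + f.size + 1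
  | eq e f => e.size + f.size + 1

/-- The expression reads array `a` only at the index given by the expression `I`. -/
def Safe (a : ℕ) (I : Expr) : Expr → Prop
  | const _ => True
  | reg _ => True
  | read b i => (b = a → i = I) ∧ Safe a I i
  | add e f => Safe a I e ∧ Safe a I f
  | sub e f => Safe a I e ∧ Safe a I f
  | mul e f => Safe a I e ∧ Safe a I f
  | div e f => Safe a I e ∧ Safe a I f
  | mod e f => Safe a I e ∧ Safe a I f
  | lt e f => Safe a I e ∧ Safe a I f
  | eq e f => Safe a I e ∧ Safe a I f

/-- The expression does not read array `a`. -/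
def NoRead (a : ℕ) : Expr → Prop
  | const _ => True
  | reg _ => True
  | read b i => b ≠ a ∧ NoRead a i
  | add e f => NoRead a e ∧ NoRead a f
  | sub e f => NoRead a e ∧ NoRead a f
  | mul e f => NoRead a e ∧ NoRead a f
  | div e f => NoRead a e ∧ NoRead a f
  | mod e f => NoRead a e ∧ NoRead a f
  | lt e f => NoRead a e ∧ NoRead a f
  | eq e f => NoRead a e ∧ NoRead a f

theorem cost_le_size (e : Expr) : e.cost ≤ e.size := by
  induction e <;> simp only [cost, size] <;> omega

theorem cells_of_noRead {w r m a} (e : Expr) (h : e.NoRead a) (k : ℕ) : (a, k) ∉ e.cells w r m := by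
  induction e <;> simp_all [NoRead, cells]
  all_goals (try tauto)

theorem cells_of_safe {w r m a I} (e : Expr) (h : Safe a I e) (k : ℕ)
    (hk : (a, k) ∈ e.cells w r m) : k = I.eval w r m := by
  induction e <;> simp_all [Safe, cells]
  case read => rcases hk with ⟨rfl, rfl⟩ | hk <;> simp_all
  all_goals (rcases hk with hk | hk <;> simp_all)

/-- For `B ≥ 2` one has `B ^ a + B ^ b ≤ B ^ (a + b + 1)`, which explains the extra `1` per
operation in `size`. A constant satisfies `c ≤ 2 ^ c ≤ B ^ c`, which is why `size` counts constants
by their value. -/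
theorem val_le {r m B} (hB : 2 ≤ B) (hr : ∀ x, r x ≤ B) (hm : ∀ a i, m a i ≤ B) (e : Expr) :
    e.val r m ≤ B ^ e.size := by
  have h1 : 1 ≤ B := by omega
  have key : ∀ a b x y : ℕ, x ≤ B ^ a → y ≤ B ^ b → x + y ≤ B ^ (a + b + 1) := by
    intro a b x y hx hy
    have h3 : B ^ a ≤ B ^ (a + b) := Nat.pow_le_pow_right h1 (by omega)
    have h4 : B ^ b ≤ B ^ (a + b) := Nat.pow_le_pow_right h1 (by omega)
    rw [pow_succ]; nlinarith [Nat.zero_le (B ^ (a + b))]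
  have mono : ∀ {a b x : ℕ}, x ≤ B ^ a → a ≤ b → x ≤ B ^ b := fun hx hab =>
    hx.trans (Nat.pow_le_pow_right h1 hab)
  have one : ∀ a, 1 ≤ B ^ a := fun a => Nat.one_le_pow _ _ h1
  induction e with
  | const c =>
    simp only [val, size]
    calc c ≤ 2 ^ c := Nat.lt_two_pow_self.le
      _ ≤ B ^ c := Nat.pow_le_pow_left hB c
      _ ≤ _ := Nat.pow_le_pow_right h1 (by omega)
  | reg x => simpa [val, size] using hr x
  | read a i ih =>
    simp only [val, size]
    exact (hm _ _).trans (by simpa using Nat.pow_le_pow_right h1 (show 1 ≤ i.size + 1 by omega))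
  | add e f he hf => exact key _ _ _ _ he hf
  | sub e f he hf => exact mono ((Nat.sub_le _ _).trans he) (by simp only [size]; omega)
  | mul e f he hf =>
    refine mono (a := e.size + f.size) ?_ (by simp only [size]; omega)
    rw [pow_add]; exact Nat.mul_le_mul he hf
  | div e f he hf => exact mono ((Nat.div_le_self _ _).trans he) (by simp only [size]; omega)
  | mod e f he hf => exact mono ((Nat.mod_le _ _).trans he) (by simp only [size]; omega)
  | lt e f he hf => simp only [val]; split_ifs; exacts [one _, Nat.zero_le _]
  | eq e f he hf => simp only [val]; split_ifs; exacts [one _, Nat.zero_le _]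

/-- The bound `B ^ size` is monotone in the expression, so if it fits into a word then no
subexpression wraps around either. -/
theorem eval_eq_val {w r m B} (hB : 2 ≤ B) (hr : ∀ x, r x ≤ B) (hm : ∀ a i, m a i ≤ B)
    (e : Expr) (hw : B ^ e.size < 2 ^ w) : e.eval w r m = e.val r m := by
  have h1 : 1 ≤ B := by omega
  have mono : ∀ {a b : ℕ}, B ^ b < 2 ^ w → a ≤ b → B ^ a < 2 ^ w := fun hx hab =>
    (Nat.pow_le_pow_right h1 hab).trans_lt hx
  have hv := val_le hB hr hm e
  induction e with
  | const c => exact Nat.mod_eq_of_lt (hv.trans_lt hw)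
  | reg x => rfl
  | read a i ih =>
    simp only [eval, val]
    rw [ih (mono hw (by simp only [size]; omega)) (val_le hB hr hm i)]
  | add e f he hf =>
    simp only [eval]
    rw [he (mono hw (by simp only [size]; omega)) (val_le hB hr hm _),
      hf (mono hw (by simp only [size]; omega)) (val_le hB hr hm _)]
    exact Nat.mod_eq_of_lt (hv.trans_lt hw)
  | mul e f he hf =>
    simp only [eval]
    rw [he (mono hw (by simp only [size]; omega)) (val_le hB hr hm _),
      hf (mono hw (by simp only [size]; omega)) (val_le hB hr hm _)]
    exact Nat.mod_eq_of_lt (hv.trans_lt hw)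
  | sub e f he hf | div e f he hf | mod e f he hf | lt e f he hf | eq e f he hf =>
    simp only [eval, val]
    rw [he (mono hw (by simp only [size]; omega)) (val_le hB hr hm _),
      hf (mono hw (by simp only [size]; omega)) (val_le hB hr hm _)]

/-- `f 0 + ... + f (k - 1)` as an expression. -/
def sum (f : ℕ → Expr) : ℕ → Expr
  | 0 => const 0
  | k + 1 => add (sum f k) (f k)

/-- `min e f` as an expression. -/
def min (e f : Expr) : Expr := sub e (sub e f)

@[simp] theorem val_sum (r : Regs) (m : Mem) (f : ℕ → Expr) (k : ℕ) :
    (sum f k).val r m = ∑ i ∈ Finset.range k, (f i).val r m := by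
  induction k with
  | zero => rfl
  | succ k ih => rw [Finset.sum_range_succ, ← ih]; rfl

@[simp] theorem val_min (r : Regs) (m : Mem) (e f : Expr) :
    (min e f).val r m = Min.min (e.val r m) (f.val r m) := by
  simp only [min, val]; omega

@[simp] theorem safe_sum {a I} {f : ℕ → Expr} (k : ℕ) :
    Safe a I (sum f k) ↔ ∀ i < k, Safe a I (f i) := by
  induction k with
  | zero => simp [sum, Safe]
  | succ k ih => simp only [sum, Safe, ih, Nat.forall_lt_succ_right]

theorem safe_of_noRead {a I} {e : Expr} (h : e.NoRead a) : Safe a I e := by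
  induction e <;> simp_all [NoRead, Safe]

@[simp] theorem safe_min {a I} {e f : Expr} : Safe a I (min e f) ↔ Safe a I e ∧ Safe a I f := by
  simp only [min, Safe]; tauto

attribute [simp] val Safe NoRead

end Expr

/-! ### Size of programs and the frame property -/

namespace Prog

/-- A size measure that bounds the cost of a single execution of every expression. -/
def size : Prog → ℕ
  | skip => 1
  | assign _ e => e.size + 1
  | write _ i e => i.size + e.size + 1
  | seq c d => c.size + d.size
  | ite b c d => b.size + c.size + d.size + 1
  | loop b c => b.size + c.size + 1
  | par _ e c => e.size + c.size + 2

/-- The arrays that a program may write. -/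
def arrays : Prog → List ℕ
  | skip => []
  | assign _ _ => []
  | write a _ _ => [a]
  | seq c d => c.arrays ++ d.arrays
  | ite _ c d => c.arrays ++ d.arrays
  | loop _ c => c.arrays
  | par _ _ c => c.arrays

/-- The registers that a program may change. -/
def registers : Prog → List ℕ
  | skip => []
  | assign x _ => [x]
  | write _ _ _ => []
  | seq c d => c.registers ++ d.registers
  | ite _ c d => c.registers ++ d.registers
  | loop _ c => c.registers
  | par _ _ _ => []

end Prog

/-- The threads of a parallel loop have private registers and the loop returns those of its parent.
It therefore changes no register, whatever its body assigns. -/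
theorem Exec.frame {w c r m o} (h : Exec w c r m o) :
    (∀ a ∉ c.arrays, o.mem a = m a ∧ ∀ k, (a, k) ∉ o.writes) ∧ ∀ x ∉ c.registers, o.regs x = r x := by
  induction h with
  | skip => simp
  | assign x e r m =>
    refine ⟨by simp, fun y hy => ?_⟩
    simp only [Prog.registers, List.mem_singleton] at hy
    simp [hy]
  | write a i e r m =>
    refine ⟨fun b hb => ?_, by simp⟩
    simp only [Prog.arrays, List.mem_singleton] at hb
    simp [hb]
  | seq c d r m o₁ o₂ _ _ h1 h2 =>
    simp only [Prog.arrays, Prog.registers, List.mem_append, not_or]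
    refine ⟨fun a ha => ⟨((h2.1 a ha.2).1).trans (h1.1 a ha.1).1, fun k => ?_⟩,
      fun x hx => (h2.2 x hx.2).trans (h1.2 x hx.1)⟩
    simp [(h2.1 a ha.2).2 k, (h1.1 a ha.1).2 k]
  | iteTrue b c d r m o _ _ h1 =>
    simp only [Prog.arrays, Prog.registers, List.mem_append, not_or]
    exact ⟨fun a ha => h1.1 a ha.1, fun x hx => h1.2 x hx.1⟩
  | iteFalse b c d r m o _ _ h1 =>
    simp only [Prog.arrays, Prog.registers, List.mem_append, not_or]
    exact ⟨fun a ha => h1.1 a ha.2, fun x hx => h1.2 x hx.2⟩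
  | loopDone => simp
  | loopStep b c r m o₁ o₂ _ _ _ h1 h2 =>
    simp only [Prog.arrays, Prog.registers] at h2 ⊢
    refine ⟨fun a ha => ⟨((h2.1 a ha).1).trans (h1.1 a ha).1, fun k => ?_⟩,
      fun x hx => (h2.2 x hx).trans (h1.2 x hx)⟩
    simp [(h2.1 a ha).2 k, (h1.1 a ha).2 k]
  | par x e c r m o m' _ _ h3 h4 ih =>
    refine ⟨fun a ha => ⟨funext fun k => h4 a k fun i hi => ((ih i hi).1 a ha).2 k, fun k => ?_⟩,
      by simp⟩
    rintro ⟨i, hi, hk⟩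
    exact ((ih i hi).1 a ha).2 k hk

/-! ### Hoare triples with work and span -/

/-- From registers `r` and memory `m` the program `c` halts with work at most `W` and span at most
`S` in registers and memory satisfying `Q`. -/
def Tr (w : ℕ) (c : Prog) (r : Regs) (m : Mem) (W S : ℕ) (Q : Regs → Mem → Prop) : Prop :=
  ∃ o, Exec w c r m o ∧ o.work ≤ W ∧ o.span ≤ S ∧ Q o.regs o.mem

theorem Tr.frame {w c r m W S Q} (h : Tr w c r m W S Q) :
    Tr w c r m W S fun r' m' => Q r' m' ∧ (∀ a ∉ c.arrays, m' a = m a) ∧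
      ∀ x ∉ c.registers, r' x = r x := by
  obtain ⟨o, ho, h1, h2, h3⟩ := h
  exact ⟨o, ho, h1, h2, h3, fun a ha => (ho.frame.1 a ha).1, ho.frame.2⟩

theorem Tr.mono {w c r m W S Q W' S'} {Q' : Regs → Mem → Prop} (h : Tr w c r m W S Q)
    (hW : W ≤ W') (hS : S ≤ S') (hQ : ∀ r' m', Q r' m' → Q' r' m') : Tr w c r m W' S' Q' := by
  obtain ⟨o, ho, h1, h2, h3⟩ := h
  exact ⟨o, ho, h1.trans hW, h2.trans hS, hQ _ _ h3⟩

theorem Tr.seq {w c d r m W₁ S₁ W₂ S₂ Q₁ Q} (h₁ : Tr w c r m W₁ S₁ Q₁)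
    (h₂ : ∀ r' m', Q₁ r' m' → Tr w d r' m' W₂ S₂ Q) :
    Tr w (.seq c d) r m (W₁ + W₂) (S₁ + S₂) Q := by
  obtain ⟨o₁, e₁, hw₁, hs₁, q₁⟩ := h₁
  obtain ⟨o₂, e₂, hw₂, hs₂, q₂⟩ := h₂ _ _ q₁
  exact ⟨_, .seq _ _ _ _ _ _ e₁ e₂, by simp only; omega, by simp only; omega, q₂⟩

/-- All registers and memory cells are at most `B`. -/
def Bdd (B : ℕ) (r : Regs) (m : Mem) : Prop := (∀ x, r x ≤ B) ∧ ∀ a i, m a i ≤ B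

/-- Words of `w` bits suffice for the program `c` on data bounded by `B`. -/
def Fits (w B : ℕ) (c : Prog) : Prop := 2 ≤ B ∧ B ^ c.size < 2 ^ w

theorem Fits.of_le {w B c d} (h : Fits w B c) (hd : d.size ≤ c.size) : Fits w B d :=
  ⟨h.1, (Nat.pow_le_pow_right (by have := h.1; omega) hd).trans_lt h.2⟩

theorem Fits.left {w B c d} (h : Fits w B (.seq c d)) : Fits w B c :=
  h.of_le (by simp only [Prog.size]; omega)

theorem Fits.right {w B c d} (h : Fits w B (.seq c d)) : Fits w B d :=
  h.of_le (by simp only [Prog.size]; omega)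

theorem Fits.body {w B b c} (h : Fits w B (.loop b c)) : Fits w B c :=
  h.of_le (by simp only [Prog.size]; omega)

theorem Fits.eval {w B c r m} (h : Fits w B c) (hb : Bdd B r m) {e : Expr}
    (he : e.size ≤ c.size) : e.eval w r m = e.val r m :=
  Expr.eval_eq_val h.1 hb.1 hb.2 e
    ((Nat.pow_le_pow_right (by have := h.1; omega) he).trans_lt h.2)

theorem Bdd.update_reg {B r m x v} (h : Bdd B r m) (hv : v ≤ B) :
    Bdd B (Function.update r x v) m :=
  ⟨fun y => by by_cases hy : y = x <;> simp [hy, hv, h.1], h.2⟩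

theorem Bdd.update_mem {B r m a f} (h : Bdd B r m) (hv : ∀ i, f i ≤ B) :
    Bdd B r (Function.update m a f) :=
  ⟨h.1, fun b i => by by_cases hy : b = a <;> simp [hy, hv, h.2]⟩

theorem Tr.assign {w B r m x} {e : Expr} (hf : Fits w B (.assign x e)) (hb : Bdd B r m)
    (v : ℕ) (hv : e.val r m = v) (hB : v ≤ B) :
    Tr w (.assign x e) r m (Prog.assign x e).size (Prog.assign x e).size fun r' m' =>
      r' = Function.update r x v ∧ m' = m ∧ Bdd B r' m' := by
  have he := hf.eval hb (e := e) (by simp only [Prog.size]; omega)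
  refine ⟨_, .assign x e r m, ?_, ?_, ?_⟩
  · have := e.cost_le_size; simp only [Prog.size]; omega
  · have := e.cost_le_size; simp only [Prog.size]; omega
  · simp only [he, hv, true_and]
    exact hb.update_reg hB

/-- Loops by potential functions for work and span. -/
theorem Tr.loop {w B} {b : Expr} {c : Prog} (hf : Fits w B (.loop b c))
    (Inv : Regs → Mem → ℕ → ℕ → Prop)
    (hbd : ∀ r m W S, Inv r m W S → Bdd B r m)
    (hdone : ∀ r m W S, Inv r m W S → b.val r m = 0 → b.size + 1 ≤ W ∧ b.size + 1 ≤ S)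
    (hstep : ∀ r m W S, Inv r m W S → b.val r m ≠ 0 → ∃ W₁ S₁ W₂ S₂,
      b.size + 1 + W₁ + W₂ ≤ W ∧ b.size + 1 + S₁ + S₂ ≤ S ∧
      Tr w c r m W₁ S₁ fun r' m' => Inv r' m' W₂ S₂)
    (r : Regs) (m : Mem) (W S : ℕ) (h : Inv r m W S) :
    Tr w (.loop b c) r m W S fun r' m' => (∃ W' S', Inv r' m' W' S') ∧ b.val r' m' = 0 := by
  -- The work potential also proves termination: each iteration pays at least `b.size + 1` for the
  -- test, so `W₂ < W`.
  induction W using Nat.strong_induction_on generalizing r m S with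
  | _ W ih =>
    have he := hf.eval (hbd _ _ _ _ h) (e := b) (by simp only [Prog.size]; omega)
    have hc := b.cost_le_size
    by_cases h0 : b.val r m = 0
    · obtain ⟨h1, h2⟩ := hdone _ _ _ _ h h0
      exact ⟨_, .loopDone b c r m (by rw [he, h0]), by simp only; omega, by simp only; omega,
        ⟨W, S, h⟩, h0⟩
    · obtain ⟨W₁, S₁, W₂, S₂, h1, h2, o, ho, hw, hs, hq⟩ := hstep _ _ _ _ h h0
      obtain ⟨o', ho', hw', hs', hq'⟩ := ih W₂ (by omega) _ _ _ hq
      exact ⟨_, .loopStep b c r m o o' (by rwa [he]) ho ho', by simp only; omega,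
        by simp only; omega, hq'⟩

/-- `for x < N do c`. -/
def Prog.forTo (x : ℕ) (N : Expr) (c : Prog) : Prog :=
  .seq (.assign x (.const 0))
    (.loop (.lt (.reg x) N) (.seq c (.assign x (.add (.reg x) (.const 1)))))

theorem Prog.size_forTo (x : ℕ) (N : Expr) (c : Prog) :
    (Prog.forTo x N c).size = N.size + c.size + 10 := by
  simp only [Prog.forTo, Prog.size, Expr.size]; omega

theorem Tr.forTo {w B x} {N : Expr} {c : Prog} (hf : Fits w B (.forTo x N c)) (n : ℕ)
    (hn : n ≤ B) (Inv : ℕ → Regs → Mem → Prop) (W S : ℕ)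
    (hbd : ∀ i r m, Inv i r m → Bdd B r m)
    (hreg : ∀ i r m, Inv i r m → r x = i)
    (hN : ∀ i r m, Inv i r m → N.val r m = n)
    (hstep : ∀ i r m, i < n → Inv i r m → Tr w c r m W S fun r' m' =>
      r' x = i ∧ Bdd B r' m' ∧ Inv (i + 1) (Function.update r' x (i + 1)) m')
    (r : Regs) (m : Mem) (hb : Bdd B r m) (h0 : Inv 0 (Function.update r x 0) m) :
    Tr w (.forTo x N c) r m ((n + 1) * (W + (Prog.forTo x N c).size))
      ((n + 1) * (S + (Prog.forTo x N c).size)) fun r' m' => Inv n r' m' := by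
  have hsz := Prog.size_forTo x N c
  set s := (Prog.forTo x N c).size with hs
  -- The budget left after `i` iterations is `(n - i) * (V + s)` plus `N.size + 4`. In each
  -- iteration `s` pays for the test and the increment, and the last summand pays for the final
  -- failing test.
  have arith : ∀ i V, i < n → N.size + 3 + 1 + (V + 4) + ((n - (i + 1)) * (V + s) + (N.size + 4))
      ≤ (n - i) * (V + s) + (N.size + 4) := by
    intro i V hi
    obtain ⟨k, rfl⟩ : ∃ k, n = i + 1 + k := ⟨n - (i + 1), by omega⟩
    have e1 : i + 1 + k - i = k + 1 := by omega
    have e2 : i + 1 + k - (i + 1) = k := by omega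
    rw [e1, e2, add_mul]; omega
  have hl : Tr w (.loop (.lt (.reg x) N) (.seq c (.assign x (.add (.reg x) (.const 1)))))
      (Function.update r x 0) m (n * (W + s) + (N.size + 4)) (n * (S + s) + (N.size + 4))
      fun r' m' => (∃ W' S', ∃ i ≤ n, Inv i r' m' ∧ W' = (n - i) * (W + s) + (N.size + 4) ∧
        S' = (n - i) * (S + s) + (N.size + 4)) ∧ (Expr.lt (.reg x) N).val r' m' = 0 := by
    refine Tr.loop (hf.right) (fun r' m' W' S' => ∃ i ≤ n, Inv i r' m' ∧
      W' = (n - i) * (W + s) + (N.size + 4) ∧ S' = (n - i) * (S + s) + (N.size + 4))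
      ?_ ?_ ?_ _ _ _ _ ⟨0, by omega, h0, by simp, by simp⟩
    · rintro r' m' _ _ ⟨i, _, hi, _⟩; exact hbd _ _ _ hi
    · rintro r' m' _ _ ⟨i, _, hi, rfl, rfl⟩ _
      simp only [Expr.size]; omega
    · rintro r' m' _ _ ⟨i, hin, hi, rfl, rfl⟩ h
      have hlt : i < n := by
        simp only [Expr.val, hN _ _ _ hi, hreg _ _ _ hi] at h
        by_contra hc; simp [hc] at h
      refine ⟨W + 4, S + 4, (n - (i + 1)) * (W + s) + (N.size + 4),
        (n - (i + 1)) * (S + s) + (N.size + 4), ?_, ?_, ?_⟩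
      · have := arith i W hlt; simp only [Expr.size]; omega
      · have := arith i S hlt; simp only [Expr.size]; omega
      · refine Tr.seq (hstep i r' m' hlt hi) (fun r₁ m₁ ⟨h1, h2, h3⟩ => ?_)
        have he := hf.right.body.right.eval h2
          (e := .add (.reg x) (.const 1)) (by simp only [Prog.size]; omega)
        refine ⟨_, .assign _ _ _ _, by simp [Expr.cost], by simp [Expr.cost], i + 1, hlt, ?_,
          rfl, rfl⟩
        simp only [he, Expr.val, h1]
        exact h3
  refine (Tr.seq (Tr.assign hf.left hb 0 rfl (Nat.zero_le _)) (W₂ := n * (W + s) + (N.size + 4))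
    (S₂ := n * (S + s) + (N.size + 4)) (Q := fun r' m' => Inv n r' m') ?_).mono ?_ ?_
    (fun _ _ h => h)
  · rintro _ _ ⟨rfl, rfl, hb'⟩
    refine hl.mono le_rfl le_rfl ?_
    rintro r' m' ⟨⟨_, _, i, hin, hi, _⟩, h⟩
    simp only [Expr.val, hN _ _ _ hi, hreg _ _ _ hi] at h
    have : i = n := by
      by_contra hc; simp [show i < n by omega] at h
    exact this ▸ hi
  · rw [add_mul, one_mul]; simp only [Prog.size, Expr.size]; omega
  · rw [add_mul, one_mul]; simp only [Prog.size, Expr.size]; omega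

/-! ### Race-free parallel sweeps -/

/-- For `i < N` in parallel, with `i` in register `0`: if `b` then write `e` to entry `I` of
array `a`. -/
def Prog.vec (N b : Expr) (a : ℕ) (I e : Expr) : Prog :=
  .par 0 N (.ite b (.write a I e) .skip)

-- There are no races: different active threads write different cells by `hinj`, guard and index do
-- not read `a`, and the value reads `a` at most at the thread's own cell. Hence entries may be
-- updated in place. The span does not depend on `n`. `tgt` and `v` describe the written cells and
-- their new values from the point of view of the array.
open Classical in
theorem Tr.vec {w B r m} {N b I e : Expr} {a : ℕ} (hf : Fits w B (.vec N b a I e))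
    (hb : Bdd B r m) (n : ℕ) (hN : N.val r m = n) (hn : n ≤ B)
    (hsb : b.NoRead a) (hsI : I.NoRead a) (hse : Expr.Safe a I e)
    (tgt : ℕ → Prop) (v : ℕ → ℕ)
    (h1 : ∀ i < n, b.val (Function.update r 0 i) m ≠ 0 →
      tgt (I.val (Function.update r 0 i) m) ∧
      e.val (Function.update r 0 i) m = v (I.val (Function.update r 0 i) m))
    (h2 : ∀ k, tgt k → ∃ i < n, b.val (Function.update r 0 i) m ≠ 0 ∧
      I.val (Function.update r 0 i) m = k)
    (hinj : ∀ i < n, ∀ j < n, b.val (Function.update r 0 i) m ≠ 0 →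
      b.val (Function.update r 0 j) m ≠ 0 →
      I.val (Function.update r 0 i) m = I.val (Function.update r 0 j) m → i = j)
    (hv : ∀ k, tgt k → v k ≤ B) :
    Tr w (.vec N b a I e) r m ((Prog.vec N b a I e).size * (n + 1)) (Prog.vec N b a I e).size
      fun r' m' => r' = r ∧ Bdd B r' m' ∧
        m' = Function.update m a fun k => if tgt k then v k else m a k := by
  have hsz : (Prog.vec N b a I e).size = N.size + b.size + I.size + e.size + 5 := by
    simp only [Prog.vec, Prog.size]; omega
  have hbi : ∀ i < n, Bdd B (Function.update r 0 i) m := fun i hi => hb.update_reg (by omega)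
  have hNe : N.eval w r m = n := by rw [hf.eval hb (by omega), hN]
  have eb : ∀ i < n, b.eval w (Function.update r 0 i) m = b.val (Function.update r 0 i) m :=
    fun i hi => hf.eval (hbi i hi) (by omega)
  have eI : ∀ i < n, I.eval w (Function.update r 0 i) m = I.val (Function.update r 0 i) m :=
    fun i hi => hf.eval (hbi i hi) (by omega)
  have ee : ∀ i < n, e.eval w (Function.update r 0 i) m = e.val (Function.update r 0 i) m :=
    fun i hi => hf.eval (hbi i hi) (by omega)
  let R : ℕ → Regs := fun i => Function.update r 0 i
  let o : ℕ → Outcome := fun i =>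
    if b.eval w (R i) m = 0 then
      ⟨R i, m, b.cells w (R i) m ∪ ∅, ∅, b.cost + 1 + 1, b.cost + 1 + 1⟩
    else ⟨R i, Function.update m a (Function.update (m a) (I.eval w (R i) m) (e.eval w (R i) m)),
      b.cells w (R i) m ∪ (I.cells w (R i) m ∪ e.cells w (R i) m), {(a, I.eval w (R i) m)},
      b.cost + 1 + (I.cost + e.cost + 1), b.cost + 1 + (I.cost + e.cost + 1)⟩
  have cN := N.cost_le_size
  have cb := b.cost_le_size
  have cI := I.cost_le_size
  have ce := e.cost_le_size
  have ow : ∀ i, (o i).work ≤ b.size + I.size + e.size + 2 := by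
    intro i; simp only [o]; split_ifs <;> simp only <;> omega
  have os : ∀ i, (o i).span ≤ b.size + I.size + e.size + 2 := by
    intro i; simp only [o]; split_ifs <;> simp only <;> omega
  have hwr : ∀ i < n, ∀ a' k, (a', k) ∈ (o i).writes ↔
      a' = a ∧ b.val (R i) m ≠ 0 ∧ k = I.val (R i) m := by
    intro i hi a' k
    simp only [o, R, eb i hi, eI i hi]
    split_ifs with h
    · simp [h]
    · simp [h]
  refine ⟨_, .par 0 N _ r m o (Function.update m a fun k => if tgt k then v k else m a k)
    ?_ ?_ ?_ ?_, ?_, ?_, rfl, ?_, rfl⟩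
  · intro i hi
    simp only [o]
    split_ifs with h
    · exact .iteFalse _ _ _ _ _ _ h (.skip _ _)
    · exact .iteTrue _ _ _ _ _ _ h (.write _ _ _ _ _)
  · intro i hi j hj hij
    rw [hNe] at hi hj
    rw [Set.disjoint_left]
    rintro ⟨a', k⟩ h hk
    obtain ⟨rfl, hbi', rfl⟩ := (hwr i hi _ _).1 h
    rcases hk with hk | hk
    · simp only [o] at hk
      split_ifs at hk with hbj
      · rcases hk with hk | hk
        · exact Expr.cells_of_noRead b hsb _ hk
        · exact hk
      · rcases hk with hk | hk | hk
        · exact Expr.cells_of_noRead b hsb _ hk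
        · exact Expr.cells_of_noRead I hsI _ hk
        · have := Expr.cells_of_safe e hse _ hk
          rw [eI j hj] at this
          rw [eb j hj] at hbj
          exact hij (hinj i hi j hj hbi' hbj this)
    · obtain ⟨_, hbj, hk⟩ := (hwr j hj _ _).1 hk
      exact hij (hinj i hi j hj hbi' hbj hk)
  · intro i hi a' k hk
    rw [hNe] at hi
    obtain ⟨rfl, hbi', rfl⟩ := (hwr i hi _ _).1 hk
    obtain ⟨ht, hval⟩ := h1 i hi hbi'
    have hbe : ¬ b.eval w (R i) m = 0 := by rw [eb i hi]; exact hbi'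
    simp only [o, if_neg hbe, Function.update_self]
    simp only [R, eI i hi, ee i hi, if_pos ht, Function.update_self, hval]
  · intro a' k hk
    rw [hNe] at hk
    by_cases ha : a' = a
    · subst ha
      have : ¬ tgt k := by
        intro ht
        obtain ⟨i, hi, hbi', rfl⟩ := h2 k ht
        exact hk i hi ((hwr i hi _ _).2 ⟨rfl, hbi', rfl⟩)
      simp [this]
    · simp [ha]
  · simp only [hNe]
    calc _ ≤ N.cost + 1 + ∑ i ∈ Finset.range n, (b.size + I.size + e.size + 2 + 1) :=
          Nat.add_le_add_left (Finset.sum_le_sum fun i _ => Nat.add_le_add_right (ow i) 1) _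
      _ ≤ _ := by
          rw [Finset.sum_const, Finset.card_range, smul_eq_mul, hsz]
          nlinarith
  · simp only [hNe]
    have : ((Finset.range n).sup fun i => (o i).span + 1) ≤ b.size + I.size + e.size + 3 :=
      Finset.sup_le fun i _ => by have := os i; omega
    omega
  · refine hb.update_mem fun k => ?_
    split_ifs with h
    exacts [hv k h, hb.2 _ _]

end ParRAM

/-! ### Bounds up to program size, and special sweeps -/

namespace ParRAM

open Finset

/-- `Tr` with work bound `A` and span bound `L` up to the size of the program. -/
def Tc (w : ℕ) (c : Prog) (r : Regs) (m : Mem) (A L : ℕ) (Q : Regs → Mem → Prop) : Prop :=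
  Tr w c r m (c.size * A) (c.size * L) Q

theorem Tc.seq {w c d r m A L Q₁ Q} (h₁ : Tc w c r m A L Q₁)
    (h₂ : ∀ r' m', Q₁ r' m' → Tc w d r' m' A L Q) : Tc w (.seq c d) r m A L Q := by
  refine (Tr.seq h₁ h₂).mono ?_ ?_ fun _ _ h => h <;> simp only [Prog.size, add_mul] <;> omega

theorem Tc.post {w c r m A L Q} {Q' : Regs → Mem → Prop} (h : Tc w c r m A L Q)
    (hQ : ∀ r' m', Q r' m' → Q' r' m') : Tc w c r m A L Q' :=
  h.mono le_rfl le_rfl hQ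

theorem Tc.frame {w c r m A L Q} (h : Tc w c r m A L Q) :
    Tc w c r m A L fun r' m' => Q r' m' ∧ (∀ a ∉ c.arrays, m' a = m a) ∧
      ∀ x ∉ c.registers, r' x = r x :=
  Tr.frame h

theorem Tr.toTc {w c r m n Q} (h : Tr w c r m (c.size * n) c.size Q) {A L : ℕ}
    (hA : n ≤ A) (hL : 1 ≤ L) : Tc w c r m A L Q :=
  h.mono (Nat.mul_le_mul_left _ hA) (Nat.le_mul_of_pos_right _ hL) fun _ _ h => h

theorem Tr.toTc₁ {w c r m Q} (h : Tr w c r m c.size c.size Q) {A L : ℕ}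
    (hA : 1 ≤ A) (hL : 1 ≤ L) : Tc w c r m A L Q :=
  h.mono (Nat.le_mul_of_pos_right _ hA) (Nat.le_mul_of_pos_right _ hL) fun _ _ h => h

/-- `for i < N` in parallel: `a[i] := e`. -/
def Prog.map (N : Expr) (a : ℕ) (e : Expr) : Prog := .vec N (.const 1) a (.reg 0) e

/-- What a sweep over the entries of array `a` in the set `t` leaves behind. -/
def Swept (B : ℕ) (a : ℕ) (t : ℕ → Prop) (v : ℕ → ℕ) (r : Regs) (m : Mem) (r' : Regs) (m' : Mem) :
    Prop :=
  r' = r ∧ Bdd B r' m' ∧ (∀ k, t k → m' a k = v k) ∧ (∀ k, ¬ t k → m' a k = m a k) ∧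
    ∀ a' ≠ a, m' a' = m a'

theorem Tr.sweep {w B r m} {N b I e : Expr} {a : ℕ} (hf : Fits w B (.vec N b a I e))
    (hb : Bdd B r m) (n : ℕ) (hN : N.val r m = n) (hn : n ≤ B)
    (hsb : b.NoRead a) (hsI : I.NoRead a) (hse : Expr.Safe a I e)
    (tgt : ℕ → Prop) (v : ℕ → ℕ)
    (h1 : ∀ i < n, b.val (Function.update r 0 i) m ≠ 0 →
      tgt (I.val (Function.update r 0 i) m) ∧
      e.val (Function.update r 0 i) m = v (I.val (Function.update r 0 i) m))
    (h2 : ∀ k, tgt k → ∃ i < n, b.val (Function.update r 0 i) m ≠ 0 ∧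
      I.val (Function.update r 0 i) m = k)
    (hinj : ∀ i < n, ∀ j < n, b.val (Function.update r 0 i) m ≠ 0 →
      b.val (Function.update r 0 j) m ≠ 0 →
      I.val (Function.update r 0 i) m = I.val (Function.update r 0 j) m → i = j)
    (hv : ∀ k, tgt k → v k ≤ B) :
    Tr w (.vec N b a I e) r m ((Prog.vec N b a I e).size * (n + 1)) (Prog.vec N b a I e).size
      (Swept B a tgt v r m) := by
  refine (Tr.vec hf hb n hN hn hsb hsI hse tgt v h1 h2 hinj hv).mono le_rfl le_rfl ?_
  rintro r' m' ⟨h, hb', rfl⟩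
  exact ⟨h, hb', fun k hk => by simp [hk], fun k hk => by simp [hk], fun a' ha => by simp [ha]⟩

theorem Tr.map {w B r m} {N e : Expr} {a : ℕ} (hf : Fits w B (.map N a e))
    (hb : Bdd B r m) (n : ℕ) (hN : N.val r m = n) (hn : n ≤ B)
    (hse : Expr.Safe a (.reg 0) e) (v : ℕ → ℕ)
    (h1 : ∀ i < n, e.val (Function.update r 0 i) m = v i)
    (hv : ∀ k < n, v k ≤ B) :
    Tr w (.map N a e) r m ((Prog.map N a e).size * (n + 1)) (Prog.map N a e).size
      (Swept B a (· < n) v r m) := by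
  refine Tr.sweep hf hb n hN hn trivial trivial hse _ v ?_ ?_ ?_ hv
  · intro i hi _; simpa using ⟨hi, h1 i hi⟩
  · intro k hk; exact ⟨k, hk, by simp⟩
  · intro i _ j _ _ _ h; simpa using h

/-- Sweep over the entries `I i`, `i < N`. -/
theorem Tr.gather {w B r m} {N I e : Expr} {a : ℕ} (hf : Fits w B (.vec N (.const 1) a I e))
    (hb : Bdd B r m) (n : ℕ) (hN : N.val r m = n) (hn : n ≤ B)
    (hsI : I.NoRead a) (hse : Expr.Safe a I e)
    (tgt : ℕ → Prop) (v : ℕ → ℕ) (f : ℕ → ℕ)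
    (hI : ∀ i < n, I.val (Function.update r 0 i) m = f i)
    (h0 : ∀ i < n, tgt (f i))
    (h1 : ∀ i < n, e.val (Function.update r 0 i) m = v (f i))
    (h2 : ∀ k, tgt k → ∃ i < n, f i = k)
    (hinj : ∀ i < n, ∀ j < n, f i = f j → i = j)
    (hv : ∀ k, tgt k → v k ≤ B) :
    Tr w (.vec N (.const 1) a I e) r m ((Prog.vec N (.const 1) a I e).size * (n + 1))
      (Prog.vec N (.const 1) a I e).size (Swept B a tgt v r m) := by
  refine Tr.sweep hf hb n hN hn trivial hsI hse tgt v ?_ ?_ ?_ hv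
  · intro i hi _; rw [hI i hi]; exact ⟨h0 i hi, h1 i hi⟩
  · intro k hk
    obtain ⟨i, hi, h⟩ := h2 k hk
    exact ⟨i, hi, by simp, by rw [hI i hi, h]⟩
  · intro i hi j hj _ _ h
    rw [hI i hi, hI j hj] at h
    exact hinj i hi j hj h

/-- Sweep over the entries `i < N` that satisfy a condition. -/
theorem Tr.mapIf {w B r m} {N b e : Expr} {a : ℕ} (hf : Fits w B (.vec N b a (.reg 0) e))
    (hb : Bdd B r m) (n : ℕ) (hN : N.val r m = n) (hn : n ≤ B)
    (hsb : b.NoRead a) (hse : Expr.Safe a (.reg 0) e)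
    (c : ℕ → Prop) (v : ℕ → ℕ)
    (hc : ∀ i < n, (b.val (Function.update r 0 i) m ≠ 0 ↔ c i))
    (h1 : ∀ i < n, c i → e.val (Function.update r 0 i) m = v i)
    (hv : ∀ k < n, c k → v k ≤ B) :
    Tr w (.vec N b a (.reg 0) e) r m ((Prog.vec N b a (.reg 0) e).size * (n + 1))
      (Prog.vec N b a (.reg 0) e).size (Swept B a (fun k => k < n ∧ c k) v r m) := by
  refine Tr.sweep hf hb n hN hn hsb trivial hse _ v ?_ ?_ ?_ fun k hk => hv k hk.1 hk.2
  · intro i hi h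
    have := (hc i hi).1 h
    simpa using ⟨⟨hi, this⟩, h1 i hi this⟩
  · rintro k ⟨hk, hck⟩; exact ⟨k, hk, (hc k hk).2 hck, by simp⟩
  · intro i _ j _ _ _ h; simpa using h

/-! ### Prefix sums -/

/-- One round of prefix summation with the stride in register `6`. -/
def Prog.scanStep : Prog :=
  .seq (.seq
    (.map (.reg 5) 28 (.add (.read 27 (.reg 0)) (.mul (.sub (.const 1) (.lt (.reg 0) (.reg 6)))
      (.read 27 (.sub (.reg 0) (.reg 6))))))
    (.map (.reg 5) 27 (.read 28 (.reg 0))))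
    (.assign 6 (.add (.reg 6) (.reg 6)))

/-- Prefix sums of the first `N` entries of array `27`, where `N` is in register `5`. The total
goes to register `7`; array `28` and register `6` are scratch space. -/
def Prog.scan : Prog :=
  .seq (.seq (.assign 6 (.const 1)) (.loop (.lt (.reg 6) (.reg 5)) .scanStep))
    (.assign 7 (.mul (.lt (.const 0) (.reg 5)) (.read 27 (.sub (.reg 5) (.const 1)))))

/-- Recursive doubling: after `t` rounds entry `i` is the sum of the at most `2 ^ t` values ending
at `i`. A round reads entries of other threads, so it writes to array `28` and copies back to avoid
races. -/
theorem Tr.scan {w B r m} (hf : Fits w B .scan) (hb : Bdd B r m) (N : ℕ) (hN : r 5 = N)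
    (hNB : 2 * N + 1 ≤ B) (g : ℕ → ℕ) (hg : ∀ i < N, m 27 i = g i)
    (hgB : ∑ i ∈ range N, g i ≤ B) :
    Tc w .scan r m ((N + 1) * (Nat.clog 2 N + 2)) (Nat.clog 2 N + 2) fun r' m' => Bdd B r' m' ∧
        (∀ i < N, m' 27 i = ∑ j ∈ range (i + 1), g j) ∧ r' 7 = ∑ i ∈ range N, g i := by
  set L := Nat.clog 2 N with hL
  have hpow : ∀ t, 2 ^ t < N → t < L := by
    intro t ht
    by_contra hc
    have := Nat.le_pow_clog (b := 2) (by norm_num) N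
    have h2 : 2 ^ L ≤ 2 ^ t := Nat.pow_le_pow_right (by norm_num) (by omega)
    rw [← hL] at this
    omega
  have hle : ∀ s ⊆ range N, ∑ i ∈ s, g i ≤ B := fun s hs =>
    (sum_le_sum_of_subset hs).trans hgB
  obtain ⟨Z, hZ⟩ : ∃ Z, Z = Prog.scan.size := ⟨_, rfl⟩
  unfold Tc
  rw [← hZ]
  have hZe := hZ
  simp only [Prog.scan, Prog.scanStep, Prog.map, Prog.vec, Prog.size, Expr.size] at hZe
  have h1 := Tr.assign hf.left.left hb 1 rfl (by have := hf.1; omega)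
  have hl : ∀ r' m', r' = Function.update r 6 1 ∧ m' = m ∧ Bdd B r' m' →
      Tr w (.loop (.lt (.reg 6) (.reg 5)) .scanStep) r' m' ((N + 1) * (L * (Z - 8) + 5)) (L * (Z - 8) + 5) fun r' m' =>
        Bdd B r' m' ∧ r' 5 = N ∧ ∀ i < N, m' 27 i = ∑ j ∈ range (i + 1), g j := by
    rintro r' m' ⟨rfl, rfl, hb'⟩
    refine (Tr.loop hf.left.right (fun r' m' W S => ∃ t, r' 5 = N ∧ r' 6 = 2 ^ t ∧ t ≤ L ∧
      Bdd B r' m' ∧ (∀ i < N, m' 27 i = ∑ j ∈ Ico (i + 1 - 2 ^ t) (i + 1), g j) ∧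
      W = (N + 1) * ((L - t) * (Z - 8) + 5) ∧ S = (L - t) * (Z - 8) + 5) ?_ ?_ ?_ _ _ _ _
      ⟨0, by simpa using hN, by simp, by omega, hb', ?_, rfl, rfl⟩).mono le_rfl le_rfl ?_
    · rintro r' m' _ _ ⟨t, _, _, _, h, _⟩; exact h
    · rintro r' m' _ _ ⟨t, _, _, _, h, _, rfl, rfl⟩ _
      simp only [Expr.size]
      have : 1 * 5 ≤ (N + 1) * ((L - t) * (Z - 8) + 5) := Nat.mul_le_mul (by omega) (by omega)
      omega
    · rintro r' m' _ _ ⟨t, h5, h6, ht, hb', hA, rfl, rfl⟩ hne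
      have hlt : 2 ^ t < N := by
        simp only [Expr.val, h5, h6] at hne
        by_contra hc; simp [hc] at hne
      have htL := hpow t hlt
      have hfl := hf.left.right.body
      have a1 := Tr.map hfl.left.left hb' N h5 (by omega) (by simp)
        (fun i => ∑ j ∈ Ico (i + 1 - 2 ^ (t + 1)) (i + 1), g j) (fun i hi => by
          simp only [Expr.val, Function.update_self, ne_eq, OfNat.ofNat_ne_zero, not_false_eq_true,
            Function.update_of_ne, h6, hA i hi]
          -- For `i < 2 ^ t` the window already starts at `0`, and the factor `1 - (i < 2 ^ t)` of
          -- the program suppresses the second summand.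
          by_cases hit : i < 2 ^ t
          · have e1 : i + 1 - 2 ^ t = 0 := by omega
            have e2 : i + 1 - 2 ^ (t + 1) = 0 := by rw [pow_succ]; omega
            simp [hit, e1, e2]
          · have e1 : i - 2 ^ t + 1 = i + 1 - 2 ^ t := by omega
            have e2 : i + 1 - 2 ^ t - 2 ^ t = i + 1 - 2 ^ (t + 1) := by rw [pow_succ]; omega
            simp only [hit, if_false, Nat.sub_zero, one_mul]
            rw [hA _ (by omega), e1, e2, add_comm, sum_Ico_consecutive] <;> omega)
        (fun i hi => hle _ (fun j hj => by
          simp only [mem_Ico, mem_range] at hj ⊢; omega))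
      obtain ⟨Y, hY⟩ : ∃ Y, Y = Prog.scanStep.size := ⟨_, rfl⟩
      -- Hence the allowance `Z - 8 = Y + 9` per round covers the body, of size `Y`, together with
      -- the loop test.
      have hYZ : Z = Y + 17 := by
        simp only [Prog.scanStep, Prog.map, Prog.vec, Prog.size, Expr.size] at hY; omega
      have hstep : Tc w Prog.scanStep r' m' (N + 1) 1 fun r₂ m₂ => Bdd B r₂ m₂ ∧ r₂ 5 = N ∧
          r₂ 6 = 2 ^ (t + 1) ∧
          ∀ i < N, m₂ 27 i = ∑ j ∈ Ico (i + 1 - 2 ^ (t + 1)) (i + 1), g j := by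
        refine Tc.seq (Tc.seq (a1.toTc le_rfl le_rfl) (Q := fun r₁ m₁ => r₁ = r' ∧ Bdd B r₁ m₁ ∧
          ∀ i < N, m₁ 27 i = ∑ j ∈ Ico (i + 1 - 2 ^ (t + 1)) (i + 1), g j) ?_) ?_
        · rintro _ m₁ ⟨rfl, hb₁, hv, -, -⟩
          refine ((Tr.map hfl.left.right hb₁ N h5 (by omega) (by simp) _ (fun i hi => by
            simp only [Expr.val, Function.update_self]; exact hv i hi) (fun i hi => ?_)).toTc
            le_rfl le_rfl).post ?_
          · have := hb₁.2 28 i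
            rwa [hv i hi] at this
          · rintro _ m₂ ⟨rfl, hb₂, hv₂, -, -⟩
            exact ⟨rfl, hb₂, hv₂⟩
        · rintro _ m₁ ⟨rfl, hb₁, hv⟩
          refine ((Tr.assign hfl.right hb₁ (2 ^ (t + 1)) (by simp [h6, pow_succ, mul_two])
            (by rw [pow_succ]; omega)).toTc₁ (by omega) le_rfl).post ?_
          rintro _ _ ⟨rfl, rfl, hb₂⟩
          exact ⟨hb₂, by simpa using h5, by simp, hv⟩
      refine ⟨Y * (N + 1), Y * 1, (N + 1) * ((L - (t + 1)) * (Z - 8) + 5),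
        (L - (t + 1)) * (Z - 8) + 5, ?_, ?_, ?_⟩
      · obtain ⟨k, hk⟩ : ∃ k, L = t + 1 + k := ⟨L - (t + 1), by omega⟩
        have e1 : L - t = k + 1 := by omega
        have e2 : L - (t + 1) = k := by omega
        rw [e1, e2, hYZ, show Y + 17 - 8 = Y + 9 by omega]; simp only [Expr.size]; nlinarith
      · obtain ⟨k, hk⟩ : ∃ k, L = t + 1 + k := ⟨L - (t + 1), by omega⟩
        have e1 : L - t = k + 1 := by omega
        have e2 : L - (t + 1) = k := by omega
        rw [e1, e2, hYZ, show Y + 17 - 8 = Y + 9 by omega]; simp only [Expr.size]; nlinarith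
      · rw [hY]
        refine hstep.mono le_rfl le_rfl ?_
        rintro r₂ m₂ ⟨hb₂, h5', h6', hv⟩
        exact ⟨t + 1, h5', h6', htL, hb₂, hv, rfl, rfl⟩
    · intro i hi; simp [hg i hi]
    · rintro r' m' ⟨⟨W, S, t, h5, h6, ht, hb', hA, -, -⟩, h0⟩
      refine ⟨hb', h5, fun i hi => ?_⟩
      have : N ≤ 2 ^ t := by
        simp only [Expr.val, h5, h6] at h0
        by_contra hc; simp [show 2 ^ t < N by omega] at h0
      rw [hA i hi, show i + 1 - 2 ^ t = 0 by omega, range_eq_Ico]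
  refine (Tr.seq (Tr.seq h1 hl) (W₂ := 11) (S₂ := 11) ?_).mono ?_ ?_ (fun _ _ h => h)
  · rintro r₁ m₁ ⟨hb₁, h5, hv⟩
    refine (Tr.assign hf.right hb₁ (∑ i ∈ range N, g i) ?_ hgB).mono ?_ ?_ ?_
    · rcases Nat.eq_zero_or_pos N with h0 | hp
      · simp [h5, h0]
      · simp [h5, hp, hv (N - 1) (by omega), show N - 1 + 1 = N by omega]
    · simp [Prog.size, Expr.size]
    · simp [Prog.size, Expr.size]
    · rintro _ _ ⟨rfl, rfl, hb₂⟩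
      exact ⟨hb₂, hv, by simp⟩
  · simp only [Prog.size, Expr.size, hZe]; nlinarith
  · simp only [Prog.size, Expr.size, hZe]; nlinarith

/-! ### Compaction -/

/-- Inclusive prefix sums. -/
def pre (g : ℕ → ℕ) (j : ℕ) : ℕ := ∑ i ∈ range (j + 1), g i

theorem pre_mono (g : ℕ → ℕ) {i j : ℕ} (h : i ≤ j) : pre g i ≤ pre g j :=
  sum_le_sum_of_subset (range_mono (by omega))

theorem pre_lt {g : ℕ → ℕ} {i j : ℕ} (h : i < j) (hj : g j ≠ 0) : pre g i < pre g j := by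
  obtain ⟨k, rfl⟩ : ∃ k, j = k + 1 := ⟨j - 1, by omega⟩
  have : pre g (k + 1) = pre g k + g (k + 1) := sum_range_succ _ _
  have := pre_mono g (show i ≤ k by omega)
  omega

theorem pre_pos {g : ℕ → ℕ} {j : ℕ} (hj : g j ≠ 0) : 0 < pre g j := by
  have : pre g j = _ + g j := sum_range_succ _ _
  omega

theorem pre_inj {g : ℕ → ℕ} {i j : ℕ} (hi : g i ≠ 0) (hj : g j ≠ 0)
    (h : pre g i - 1 = pre g j - 1) : i = j := by
  have := pre_pos hi
  have := pre_pos hj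
  rcases lt_trichotomy i j with h' | h' | h'
  · have := pre_lt h' hj; omega
  · exact h'
  · have := pre_lt h' hi; omega

theorem pre_le_total (g : ℕ → ℕ) {j N : ℕ} (h : j < N) : pre g j ≤ ∑ i ∈ range N, g i :=
  sum_le_sum_of_subset (range_mono (by omega))

/-- Discrete intermediate values: prefix sums of a `0`-`1` sequence grow by at most one, and only at
flagged indices. So every rank below the total is the rank of a flagged index. -/
theorem exists_pre_eq {g : ℕ → ℕ} (N : ℕ) (hg : ∀ i < N, g i ≤ 1) {k : ℕ}
    (hk : k < ∑ i ∈ range N, g i) : ∃ j < N, g j ≠ 0 ∧ pre g j - 1 = k := by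
  induction N with
  | zero => simp at hk
  | succ N ih =>
    by_cases h : k < ∑ i ∈ range N, g i
    · obtain ⟨j, hj, h⟩ := ih (fun i hi => hg i (by omega)) h
      exact ⟨j, by omega, h⟩
    · have h1 := hg N (by omega)
      rw [sum_range_succ] at hk
      refine ⟨N, by omega, by omega, ?_⟩
      simp only [pre, sum_range_succ]; omega

/-- Compaction: the values `e` at the flagged indices `i < N` are moved to the front of array `a`,
where array `27` holds the prefix sums of the flags. -/
theorem Tr.compact {w B r m} {N b e : Expr} {a : ℕ}
    (hf : Fits w B (.vec N b a (.sub (.read 27 (.reg 0)) (.const 1)) e))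
    (hb : Bdd B r m) (n : ℕ) (hN : N.val r m = n) (hn : n ≤ B)
    (ha : 27 ≠ a) (hsb : b.NoRead a) (hse : e.NoRead a) (g u : ℕ → ℕ)
    (hg : ∀ i < n, g i ≤ 1)
    (hbv : ∀ i < n, b.val (Function.update r 0 i) m = g i)
    (hp : ∀ i < n, m 27 i = pre g i)
    (he : ∀ i < n, g i ≠ 0 → e.val (Function.update r 0 i) m = u i)
    (hv : ∀ k < n, u k ≤ B) :
    Tr w (.vec N b a (.sub (.read 27 (.reg 0)) (.const 1)) e) r m
      ((Prog.vec N b a (.sub (.read 27 (.reg 0)) (.const 1)) e).size * (n + 1))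
      (Prog.vec N b a (.sub (.read 27 (.reg 0)) (.const 1)) e).size
      fun r' m' => r' = r ∧ Bdd B r' m' ∧ (∀ a' ≠ a, m' a' = m a') ∧
        (∀ j < n, g j ≠ 0 → m' a (pre g j - 1) = u j) ∧
        ∀ k, ∑ i ∈ range n, g i ≤ k → m' a k = m a k := by
  have hbv' := hbv
  -- `idx` inverts the rank function and describes the compacted array cell by cell.
  choose! idx hidx using fun k (hk : k < ∑ i ∈ range n, g i) => exists_pre_eq n hg hk
  have hkey : ∀ i < n, g i ≠ 0 → idx (pre g i - 1) = i := by
    intro i hi hgi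
    have h1 := pre_le_total g hi
    have h2 := pre_pos hgi
    obtain ⟨h3, h4, h5⟩ := hidx (pre g i - 1) (by omega)
    exact pre_inj h4 hgi h5
  refine (Tr.sweep hf hb n hN hn hsb (by simp [ha]) (Expr.safe_of_noRead hse)
    (fun k => k < ∑ i ∈ range n, g i) (fun k => u (idx k)) ?_ ?_ ?_ ?_).mono le_rfl le_rfl ?_
  · intro i hi hne
    rw [hbv i hi] at hne
    have h1 := pre_le_total g hi
    have h2 := pre_pos hne
    simp only [Expr.val, Function.update_self, hp i hi, hkey i hi hne, he i hi hne, and_true]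
    omega
  · intro k hk
    obtain ⟨h3, h4, h5⟩ := hidx k hk
    exact ⟨idx k, h3, by rwa [hbv _ h3], by simp [hp _ h3, h5]⟩
  · intro i hi j hj h1 h2 h
    rw [hbv _ hi] at h1
    rw [hbv _ hj] at h2
    simp only [Expr.val, Function.update_self, hp i hi, hp j hj] at h
    exact pre_inj h1 h2 h
  · intro k hk; exact hv _ (hidx k hk).1
  · rintro r' m' ⟨h1, h2, h3, h4, h5⟩
    refine ⟨h1, h2, h5, fun j hj hne => ?_, fun k hk => h4 k (by omega)⟩
    have h6 := pre_le_total g hj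
    have h7 := pre_pos hne
    have h8 := h3 (pre g j - 1) (show _ < _ by omega)
    rw [h8]
    simp only [hkey j hj hne]

end ParRAM

namespace CutMatch

open Finset

/-! ### Dart networks

A graph of maximum degree at most `16` is a fixed set of `16 n` darts with an involution: the darts
of vertex `v` are `16 v, ..., 16 v + 15`, and dart `p` leads from `p / 16` to `rv p / 16`. Unused
darts are fixed by the involution. -/

theorem sum_darts (n : ℕ) (f : ℕ → ℕ) :
    ∑ p ∈ range (16 * n), f p = ∑ v ∈ range n, ∑ k ∈ range 16, f (16 * v + k) := by
  induction n with
  | zero => simp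
  | succ n ih => rw [sum_range_succ, ← ih, mul_add, mul_one, sum_range_add]

theorem dart_div (v : ℕ) {k : ℕ} (hk : k < 16) : (16 * v + k) / 16 = v := by omega

theorem dart_mod (v : ℕ) {k : ℕ} (hk : k < 16) : (16 * v + k) % 16 = k := by omega

/-- Filling outlets of capacities `c` in order. -/
theorem sum_fill (c : ℕ → ℕ) (U K : ℕ) :
    ∑ k ∈ range K, min (c k) (U - ∑ j ∈ range k, c j) = min U (∑ k ∈ range K, c k) := by
  induction K with
  | zero => simp
  | succ K ih => rw [sum_range_succ, ih, sum_range_succ]; omega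

/-- A network at the beginning of a phase: heights `h`, dart lengths `ell`, remaining capacities
`z`, active sources `src` and free sinks `fr`. -/
structure Net where
  n : ℕ
  rv : ℕ → ℕ
  h : ℕ → ℕ
  ell : ℕ → ℕ
  z : ℕ → ℕ
  src : ℕ → ℕ
  fr : ℕ → ℕ

/-- The state of a phase: units forwarded and returned along each dart by its owner, dead vertices,
and units waiting at, absorbed by and failed at each vertex. -/
structure Flow where
  F : ℕ → ℕ
  R : ℕ → ℕ
  dd : ℕ → ℕ
  b : ℕ → ℕ
  ab : ℕ → ℕ
  fl : ℕ → ℕ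

namespace Net

/-- The field `valid` is the Lipschitz condition behind the level cuts, and `h_fr` is what keeps
unmatched sinks out of the final cut. The condition `ell_pos` makes heights drop strictly along
admissible darts. -/
structure WF (P : Net) : Prop where
  rv_lt : ∀ p < 16 * P.n, P.rv p < 16 * P.n
  rv_rv : ∀ p < 16 * P.n, P.rv (P.rv p) = p
  ell_pos : ∀ p < 16 * P.n, 0 < P.ell p
  ell_rv : ∀ p < 16 * P.n, P.ell (P.rv p) = P.ell p
  z_pos : ∀ p < 16 * P.n, 0 < P.z p
  z_rv : ∀ p < 16 * P.n, P.z (P.rv p) = P.z p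
  src_le : ∀ v < P.n, P.src v ≤ 1
  fr_le : ∀ v < P.n, P.fr v ≤ 1
  h_fr : ∀ v < P.n, P.fr v ≠ 0 → P.h v = 0
  valid : ∀ p < 16 * P.n, P.h (p / 16) ≤ P.h (P.rv p / 16) + P.ell p

variable (P : Net) (s : Flow)

/-- Indicator of the admissible darts. -/
def adm (p : ℕ) : ℕ := if P.h (p / 16) = P.h (P.rv p / 16) + P.ell p then 1 else 0

/-- Forward capacity of a dart. -/
def fc (p : ℕ) : ℕ := P.adm p * (1 - s.dd (P.rv p / 16)) * (P.z p - s.F p)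

/-- Units left at a vertex after absorption. -/
def a0 (v : ℕ) : ℕ := s.b v - (P.fr v - s.ab v)

/-- Units forwarded. -/
def aF (p : ℕ) : ℕ :=
  min (P.fc s p) (P.a0 s (p / 16) - ∑ j ∈ range (p % 16), P.fc s (16 * (p / 16) + j))

/-- Units left at a vertex after forwarding. -/
def rem (v : ℕ) : ℕ := P.a0 s v - ∑ j ∈ range 16, P.fc s (16 * v + j)

/-- Return capacity of a dart. -/
def rc (p : ℕ) : ℕ := s.F (P.rv p) - s.R p

/-- Units returned. -/
def aR (p : ℕ) : ℕ :=
  min (P.rc s p) (P.rem s (p / 16) - ∑ j ∈ range (p % 16), P.rc s (16 * (p / 16) + j))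

/-- Units moved along a dart. -/
def amt (p : ℕ) : ℕ := P.aF s p + P.aR s p

/-- One synchronous round. -/
structure Round (s s' : Flow) : Prop where
  F : ∀ p < 16 * P.n, s'.F p = s.F p + P.aF s p
  R : ∀ p < 16 * P.n, s'.R p = s.R p + P.aR s p
  dd : ∀ v < P.n, s'.dd v = if 0 < P.rem s v then 1 else s.dd v
  ab : ∀ v < P.n, s'.ab v = s.ab v + min (s.b v) (P.fr v - s.ab v)
  fl : ∀ v < P.n, s'.fl v = s.fl v + (P.rem s v - ∑ j ∈ range 16, P.rc s (16 * v + j))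
  b : ∀ v < P.n, s'.b v = ∑ k ∈ range 16, P.amt s (P.rv (16 * v + k))

/-- The invariant of a phase. -/
structure Inv : Prop where
  F_le : ∀ p < 16 * P.n, s.F p ≤ P.z p
  F_adm : ∀ p < 16 * P.n, s.F p ≠ 0 → P.adm p = 1
  R_le : ∀ p < 16 * P.n, s.R p ≤ s.F (P.rv p)
  cons : ∀ v < P.n, ∑ k ∈ range 16, s.F (P.rv (16 * v + k)) +
    ∑ k ∈ range 16, s.R (P.rv (16 * v + k)) + P.src v =
      ∑ k ∈ range 16, s.F (16 * v + k) + ∑ k ∈ range 16, s.R (16 * v + k) +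
        s.ab v + s.fl v + s.b v
  dd_le : ∀ v < P.n, s.dd v ≤ 1
  ab_le : ∀ v < P.n, s.ab v ≤ P.fr v
  fl_le : ∀ v < P.n, s.fl v ≤ P.src v
  R_dd : ∀ p < 16 * P.n, s.R p ≠ 0 → s.dd (p / 16) = 1
  fl_dd : ∀ v < P.n, s.fl v ≠ 0 → s.dd v = 1
  blocked : ∀ p < 16 * P.n, s.dd (p / 16) = 1 → P.adm p = 1 →
    s.dd (P.rv p / 16) = 1 ∨ s.F p = P.z p
  sink : ∀ v < P.n, s.dd v = 1 → s.ab v = P.fr v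

variable {P s}

theorem adm_le (p : ℕ) : P.adm p ≤ 1 := by unfold adm; split_ifs <;> omega

theorem adm_ne_zero {p : ℕ} (h : P.adm p ≠ 0) : P.h (p / 16) = P.h (P.rv p / 16) + P.ell p := by
  unfold adm at h; split_ifs at h with h'; exacts [h', absurd rfl h]

/-- Both directions of an edge being admissible would give a strict descent in height that returns
to its start. -/
theorem adm_rv (hP : P.WF) {p : ℕ} (hp : p < 16 * P.n) (h : P.adm p ≠ 0) : P.adm (P.rv p) = 0 := by
  have h1 := adm_ne_zero h
  by_contra h2
  have h3 := adm_ne_zero h2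
  rw [hP.rv_rv p hp, hP.ell_rv p hp] at h3
  have := hP.ell_pos p hp
  omega

theorem fc_le (p : ℕ) : P.fc s p ≤ P.z p - s.F p := by
  have h1 := P.adm_le p
  have h2 : P.adm p * (1 - s.dd (P.rv p / 16)) ≤ 1 * 1 := Nat.mul_le_mul h1 (by omega)
  calc P.fc s p ≤ 1 * 1 * (P.z p - s.F p) := Nat.mul_le_mul_right _ h2
    _ = _ := by ring

theorem aF_le (p : ℕ) : P.aF s p ≤ P.z p - s.F p := (min_le_left _ _).trans (fc_le p)

theorem aR_le (p : ℕ) : P.aR s p ≤ P.rc s p := min_le_left _ _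

theorem adm_of_aF {p : ℕ} (h : P.aF s p ≠ 0) : P.adm p = 1 := by
  have h1 := P.adm_le p
  by_contra h2
  have h3 : P.adm p = 0 := by omega
  simp [aF, fc, h3] at h

theorem aF_of_dead {p : ℕ} (h : s.dd (P.rv p / 16) = 1) : P.aF s p = 0 := by
  simp [aF, fc, h]

theorem aR_of_rem {p : ℕ} (h : P.rem s (p / 16) = 0) : P.aR s p = 0 := by
  simp [aR, h]

theorem sum_aF (v : ℕ) : ∑ k ∈ range 16, P.aF s (16 * v + k) =
    min (P.a0 s v) (∑ k ∈ range 16, P.fc s (16 * v + k)) := by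
  rw [← sum_fill]
  refine sum_congr rfl fun k hk => ?_
  rw [mem_range] at hk
  simp only [aF, dart_div v hk, dart_mod v hk]

theorem sum_aR (v : ℕ) : ∑ k ∈ range 16, P.aR s (16 * v + k) =
    min (P.rem s v) (∑ k ∈ range 16, P.rc s (16 * v + k)) := by
  rw [← sum_fill]
  refine sum_congr rfl fun k hk => ?_
  rw [mem_range] at hk
  simp only [aR, dart_div v hk, dart_mod v hk]

/-- All units at a vertex move in a round. -/
theorem split_b (v : ℕ) : s.b v = min (s.b v) (P.fr v - s.ab v) +
    ∑ k ∈ range 16, P.aF s (16 * v + k) + ∑ k ∈ range 16, P.aR s (16 * v + k) +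
    (P.rem s v - ∑ k ∈ range 16, P.rc s (16 * v + k)) := by
  rw [sum_aF, sum_aR]
  simp only [rem, a0]
  omega

/-- Outlets are filled in order, so if units are left over then every outlet has been filled
completely. -/
theorem aF_of_rem {p : ℕ} (h : P.rem s (p / 16) ≠ 0) : P.aF s p = P.fc s p := by
  have h1 : P.fc s p + ∑ j ∈ range (p % 16), P.fc s (16 * (p / 16) + j) ≤
      ∑ j ∈ range 16, P.fc s (16 * (p / 16) + j) := by
    calc _ = ∑ j ∈ range (p % 16 + 1), P.fc s (16 * (p / 16) + j) := by
          rw [sum_range_succ, Nat.div_add_mod, add_comm]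
      _ ≤ _ := sum_le_sum_of_subset (range_mono (by omega))
  simp only [rem] at h
  simp only [aF]; omega

theorem dart_lt {n v k : ℕ} (hv : v < n) (hk : k < 16) : 16 * v + k < 16 * n := by omega

theorem div_lt {n p : ℕ} (hp : p < 16 * n) : p / 16 < n := by omega

/-- The field that matters is `blocked`. A vertex dies only when units remain after forwarding, and
then each of its admissible darts with live target has been filled. This persists, since flow values
and the set of dead vertices only grow. For the same reason a sink dies only after it has absorbed
its unit. -/
theorem Inv.round (hP : P.WF) (hs : P.Inv s) {s' : Flow} (hr : P.Round s s') : P.Inv s' where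
  F_le p hp := by
    have := P.aF_le (s := s) p
    have := hs.F_le p hp
    rw [hr.F p hp]; omega
  F_adm p hp h := by
    rw [hr.F p hp] at h
    by_cases h0 : s.F p = 0
    · exact adm_of_aF (s := s) (by omega)
    · exact hs.F_adm p hp h0
  R_le p hp := by
    have h1 := P.aR_le (s := s) p
    have := hs.R_le p hp
    rw [hr.R p hp, hr.F _ (hP.rv_lt p hp)]
    simp only [rc] at h1; omega
  cons v hv := by
    have e1 : ∑ k ∈ range 16, s'.F (P.rv (16 * v + k)) = ∑ k ∈ range 16, s.F (P.rv (16 * v + k)) +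
        ∑ k ∈ range 16, P.aF s (P.rv (16 * v + k)) := by
      rw [← sum_add_distrib]
      exact sum_congr rfl fun k hk => hr.F _ (hP.rv_lt _ (dart_lt hv (mem_range.1 hk)))
    have e2 : ∑ k ∈ range 16, s'.R (P.rv (16 * v + k)) = ∑ k ∈ range 16, s.R (P.rv (16 * v + k)) +
        ∑ k ∈ range 16, P.aR s (P.rv (16 * v + k)) := by
      rw [← sum_add_distrib]
      exact sum_congr rfl fun k hk => hr.R _ (hP.rv_lt _ (dart_lt hv (mem_range.1 hk)))
    have e3 : ∑ k ∈ range 16, s'.F (16 * v + k) = ∑ k ∈ range 16, s.F (16 * v + k) +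
        ∑ k ∈ range 16, P.aF s (16 * v + k) := by
      rw [← sum_add_distrib]
      exact sum_congr rfl fun k hk => hr.F _ (dart_lt hv (mem_range.1 hk))
    have e4 : ∑ k ∈ range 16, s'.R (16 * v + k) = ∑ k ∈ range 16, s.R (16 * v + k) +
        ∑ k ∈ range 16, P.aR s (16 * v + k) := by
      rw [← sum_add_distrib]
      exact sum_congr rfl fun k hk => hr.R _ (dart_lt hv (mem_range.1 hk))
    have e5 := P.split_b (s := s) v
    have e6 := hs.cons v hv
    rw [e1, e2, e3, e4, hr.ab v hv, hr.fl v hv, hr.b v hv]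
    simp only [amt, sum_add_distrib]
    omega
  dd_le v hv := by
    have := hs.dd_le v hv
    rw [hr.dd v hv]; split_ifs <;> omega
  ab_le v hv := by
    have := hs.ab_le v hv
    rw [hr.ab v hv]; omega
  -- By conservation the units waiting, absorbed and failed at `v` number at most the returnable
  -- units plus `src v`. So what cannot be returned is the unit of `v` itself.
  fl_le v hv := by
    have h1 := hs.cons v hv
    have h2 : ∑ k ∈ range 16, s.R (P.rv (16 * v + k)) ≤ ∑ k ∈ range 16, s.F (16 * v + k) :=
      sum_le_sum fun k hk => by
        have hp := dart_lt hv (mem_range.1 hk)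
        have := hs.R_le _ (hP.rv_lt _ hp)
        rwa [hP.rv_rv _ hp] at this
    have h3 : ∑ k ∈ range 16, s.F (P.rv (16 * v + k)) =
        ∑ k ∈ range 16, P.rc s (16 * v + k) + ∑ k ∈ range 16, s.R (16 * v + k) := by
      rw [← sum_add_distrib]
      refine sum_congr rfl fun k hk => ?_
      have := hs.R_le _ (dart_lt hv (mem_range.1 hk))
      simp only [rc]; omega
    have h4 := hs.fl_le v hv
    rw [hr.fl v hv]
    simp only [rem, a0]; omega
  R_dd p hp h := by
    rw [hr.R p hp] at h
    rw [hr.dd _ (div_lt hp)]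
    split_ifs with h1
    · rfl
    · refine hs.R_dd p hp fun h2 => h ?_
      rw [h2, aR_of_rem (by omega)]
  fl_dd v hv h := by
    rw [hr.fl v hv] at h
    rw [hr.dd v hv]
    split_ifs with h1
    · rfl
    · exact hs.fl_dd v hv (by omega)
  blocked p hp h ha := by
    have hq := div_lt (hP.rv_lt p hp)
    have hF := hs.F_le p hp
    have haF := P.aF_le (s := s) p
    rw [hr.dd _ (div_lt hp)] at h
    rw [hr.dd _ hq, hr.F p hp]
    have hle := hs.dd_le _ hq
    by_cases h0 : s.dd (P.rv p / 16) = 1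
    · left; split_ifs <;> simp [h0]
    · right
      split_ifs at h with h1
      · have h2 : s.dd (P.rv p / 16) = 0 := by omega
        rw [aF_of_rem (by omega)]
        simp only [fc, ha, h2]; omega
      · have := (hs.blocked p hp h ha).resolve_left h0
        omega
  sink v hv h := by
    rw [hr.dd v hv] at h
    rw [hr.ab v hv]
    have := hs.ab_le v hv
    split_ifs at h with h1
    · simp only [rem, a0] at h1; omega
    · have := hs.sink v hv h; omega

/-! ### The potential that bounds the moves of a phase -/

/-- The darts that belong to edges of the graph. -/
def edges (P : Net) : Finset ℕ := (range (16 * P.n)).filter fun p => P.rv p ≠ p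

theorem mem_edges {p : ℕ} : p ∈ P.edges ↔ p < 16 * P.n ∧ P.rv p ≠ p := by simp [edges]

theorem rv_mem_edges (hP : P.WF) {p : ℕ} (hp : p ∈ P.edges) : P.rv p ∈ P.edges := by
  rw [mem_edges] at hp ⊢
  refine ⟨hP.rv_lt p hp.1, ?_⟩
  rw [hP.rv_rv p hp.1]; exact hp.2.symm

theorem sum_rv (hP : P.WF) (f : ℕ → ℕ) : ∑ p ∈ P.edges, f (P.rv p) = ∑ p ∈ P.edges, f p := by
  refine sum_nbij' P.rv P.rv (fun p hp => rv_mem_edges hP hp) (fun p hp => rv_mem_edges hP hp)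
    (fun p hp => hP.rv_rv p (mem_edges.1 hp).1) (fun p hp => hP.rv_rv p (mem_edges.1 hp).1)
    (fun p hp => rfl)

theorem sum_edges {f : ℕ → ℕ} (hf : ∀ p < 16 * P.n, P.rv p = p → f p = 0) :
    ∑ p ∈ P.edges, f p = ∑ v ∈ range P.n, ∑ k ∈ range 16, f (16 * v + k) := by
  rw [← sum_darts, edges, sum_filter]
  refine sum_congr rfl fun p hp => ?_
  rw [mem_range] at hp
  split_ifs with h
  · rfl
  · exact (hf p hp (not_not.1 h)).symm

theorem adm_null (hP : P.WF) {p : ℕ} (hp : p < 16 * P.n) (h : P.rv p = p) : P.adm p = 0 := by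
  have := hP.ell_pos p hp
  simp only [adm, h]
  rw [if_neg]; omega

/-- Potential of a dart. -/
def pot (P : Net) (s : Flow) (p : ℕ) : ℕ :=
  if s.dd (P.rv p / 16) = 1 then s.F p - s.R (P.rv p) else 2 * P.z p - s.F p

/-- Potential of a state; it bounds the number of unit moves in the rest of the phase. -/
def Pot (P : Net) (s : Flow) : ℕ := ∑ p ∈ P.edges, P.pot s p + ∑ v ∈ range P.n, s.b v

theorem aF_null (hP : P.WF) {p : ℕ} (hp : p < 16 * P.n) (h : P.rv p = p) : P.aF s p = 0 := by
  by_contra h1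
  have := adm_of_aF h1
  rw [adm_null hP hp h] at this; omega

theorem Inv.F_null (hP : P.WF) (hs : P.Inv s) {p : ℕ} (hp : p < 16 * P.n) (h : P.rv p = p) :
    s.F p = 0 := by
  by_contra h1
  have := hs.F_adm p hp h1
  rw [adm_null hP hp h] at this; omega

theorem Inv.aR_null (hP : P.WF) (hs : P.Inv s) {p : ℕ} (hp : p < 16 * P.n) (h : P.rv p = p) :
    P.aR s p = 0 := by
  have h1 := P.aR_le (s := s) p
  have h2 := hs.F_null hP hp h
  simp only [rc, h, h2] at h1; omega

/-- Towards a live vertex `2 * z - F` pays for the forward moves still possible and for one return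
of every unit. When the target dies nothing more is forwarded to it and `F - R` returns remain. The
change of regime does not raise the potential because `F ≤ z`. -/
theorem pot_round (hP : P.WF) (hs : P.Inv s) {s' : Flow} (hr : P.Round s s') {p : ℕ}
    (hp : p < 16 * P.n) : P.pot s' p + (P.aF s p + P.aR s (P.rv p)) ≤ P.pot s p := by
  have hq := hP.rv_lt p hp
  have hqq := hP.rv_rv p hp
  have h1 := P.aR_le (s := s) (P.rv p)
  have h2 := P.aF_le (s := s) p
  have h3 := hs.F_le p hp
  have h4 := hs.R_le _ hq
  simp only [rc, hqq] at h1 h4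
  simp only [pot, hr.F p hp, hr.R _ hq, hr.dd _ (div_lt hq)]
  by_cases hd : s.dd (P.rv p / 16) = 1
  · have := aF_of_dead hd
    simp only [hd, ite_self, if_true]
    omega
  · have h5 : s.R (P.rv p) = 0 := by
      by_contra h; exact hd (hs.R_dd _ hq h)
    by_cases h6 : 0 < P.rem s (P.rv p / 16)
    · simp only [h6, if_true, hd, if_false]; omega
    · have := aR_of_rem (P := P) (s := s) (p := P.rv p) (by omega)
      simp only [h6, if_false, hd]; omega

/-- All waiting units leave their vertex in a round, and those waiting afterwards are exactly the
ones moved along darts. The dart potentials pay for these, so the previous number of waiting units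
is lost from the total. -/
theorem Pot_round (hP : P.WF) (hs : P.Inv s) {s' : Flow} (hr : P.Round s s') :
    P.Pot s' + ∑ v ∈ range P.n, s.b v ≤ P.Pot s := by
  have h1 : ∑ v ∈ range P.n, s'.b v =
      ∑ p ∈ P.edges, P.aF s p + ∑ p ∈ P.edges, P.aR s (P.rv p) := by
    calc _ = ∑ v ∈ range P.n, ∑ k ∈ range 16, P.amt s (P.rv (16 * v + k)) :=
          sum_congr rfl fun v hv => hr.b v (mem_range.1 hv)
      _ = ∑ p ∈ P.edges, P.amt s (P.rv p) := by
          rw [sum_edges (f := fun p => P.amt s (P.rv p))]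
          intro p hp h
          simp only [h, amt, aF_null hP hp h, hs.aR_null hP hp h]
      _ = ∑ p ∈ P.edges, P.aF s (P.rv p) + ∑ p ∈ P.edges, P.aR s (P.rv p) := sum_add_distrib
      _ = _ := by rw [sum_rv hP]
  have h2 : ∑ p ∈ P.edges, (P.pot s' p + (P.aF s p + P.aR s (P.rv p))) ≤
      ∑ p ∈ P.edges, P.pot s p :=
    sum_le_sum fun p hp => pot_round hP hs hr (mem_edges.1 hp).1
  rw [sum_add_distrib, sum_add_distrib] at h2
  simp only [Pot, h1]; omega

/-- The state at the beginning of a phase. -/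
structure Start (P : Net) (s : Flow) : Prop where
  F : ∀ p < 16 * P.n, s.F p = 0
  R : ∀ p < 16 * P.n, s.R p = 0
  dd : ∀ v < P.n, s.dd v = 0
  ab : ∀ v < P.n, s.ab v = 0
  fl : ∀ v < P.n, s.fl v = 0
  b : ∀ v < P.n, s.b v = P.src v

theorem Start.inv (hP : P.WF) (h : P.Start s) : P.Inv s where
  F_le p hp := by simp [h.F p hp]
  F_adm p hp := by simp [h.F p hp]
  R_le p hp := by simp [h.R p hp]
  cons v hv := by
    have e1 : ∑ k ∈ range 16, s.F (P.rv (16 * v + k)) = 0 :=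
      sum_eq_zero fun k hk => h.F _ (hP.rv_lt _ (dart_lt hv (mem_range.1 hk)))
    have e2 : ∑ k ∈ range 16, s.R (P.rv (16 * v + k)) = 0 :=
      sum_eq_zero fun k hk => h.R _ (hP.rv_lt _ (dart_lt hv (mem_range.1 hk)))
    have e3 : ∑ k ∈ range 16, s.F (16 * v + k) = 0 :=
      sum_eq_zero fun k hk => h.F _ (dart_lt hv (mem_range.1 hk))
    have e4 : ∑ k ∈ range 16, s.R (16 * v + k) = 0 :=
      sum_eq_zero fun k hk => h.R _ (dart_lt hv (mem_range.1 hk))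
    rw [e1, e2, e3, e4, h.ab v hv, h.fl v hv, h.b v hv]
  dd_le v hv := by simp [h.dd v hv]
  ab_le v hv := by simp [h.ab v hv]
  fl_le v hv := by simp [h.fl v hv]
  R_dd p hp := by simp [h.R p hp]
  fl_dd v hv := by simp [h.fl v hv]
  blocked p hp := by simp [h.dd _ (div_lt hp)]
  sink v hv := by simp [h.dd v hv]

end Net

end CutMatch

/-! ### Net flow of a phase and the network of the next phase -/

namespace CutMatch

open Finset

namespace Net

variable {P : Net} {s : Flow}

/-- Net flow along a dart. -/
def nf (P : Net) (s : Flow) (p : ℕ) : ℕ := s.F p - s.R (P.rv p)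

/-- Number of units on an edge. -/
def used (P : Net) (s : Flow) (p : ℕ) : ℕ := P.nf s p + P.nf s (P.rv p)

theorem nf_le (p : ℕ) : P.nf s p ≤ s.F p := Nat.sub_le _ _

theorem Inv.adm_of_nf (hs : P.Inv s) {p : ℕ} (hp : p < 16 * P.n) (h : P.nf s p ≠ 0) :
    P.adm p = 1 :=
  hs.F_adm p hp (by have := P.nf_le (s := s) p; omega)

theorem Inv.nf_rv (hP : P.WF) (hs : P.Inv s) {p : ℕ} (hp : p < 16 * P.n) (h : P.nf s p ≠ 0) :
    P.nf s (P.rv p) = 0 := by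
  by_contra h1
  have h2 := adm_rv hP hp (by rw [hs.adm_of_nf hp h]; omega)
  rw [hs.adm_of_nf (hP.rv_lt p hp) h1] at h2; omega

theorem used_rv (hP : P.WF) {p : ℕ} (hp : p < 16 * P.n) : P.used s (P.rv p) = P.used s p := by
  simp only [used, hP.rv_rv p hp]; omega

theorem Inv.nf_le_z (hs : P.Inv s) {p : ℕ} (hp : p < 16 * P.n) : P.nf s p ≤ P.z p :=
  (nf_le p).trans (hs.F_le p hp)

theorem Inv.used_le (hP : P.WF) (hs : P.Inv s) {p : ℕ} (hp : p < 16 * P.n) :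
    P.used s p ≤ P.z p := by
  have h1 := hs.nf_le_z hp
  have h2 := hs.nf_le_z (hP.rv_lt p hp)
  rw [hP.z_rv p hp] at h2
  by_cases h : P.nf s p = 0
  · simp only [used]; omega
  · have := hs.nf_rv hP hp h
    simp only [used]; omega

theorem Inv.nf_null (hP : P.WF) (hs : P.Inv s) {p : ℕ} (hp : p < 16 * P.n) (h : P.rv p = p) :
    P.nf s p = 0 := by
  have := P.nf_le (s := s) p
  rw [hs.F_null hP hp h] at this; omega

/-- Returned units occur in `cons` once as inflow and once as outflow. Cancelling them leaves
conservation of the net flow, in which `ab`, `fl` and `b` are the only outlets. -/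
theorem Inv.cons_nf (hP : P.WF) (hs : P.Inv s) {v : ℕ} (hv : v < P.n) :
    ∑ k ∈ range 16, P.nf s (P.rv (16 * v + k)) + P.src v =
      ∑ k ∈ range 16, P.nf s (16 * v + k) + s.ab v + s.fl v + s.b v := by
  have h1 := hs.cons v hv
  have h2 : ∑ k ∈ range 16, s.F (16 * v + k) =
      ∑ k ∈ range 16, P.nf s (16 * v + k) + ∑ k ∈ range 16, s.R (P.rv (16 * v + k)) := by
    rw [← sum_add_distrib]
    refine sum_congr rfl fun k hk => ?_
    have hp := dart_lt hv (mem_range.1 hk)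
    have := hs.R_le _ (hP.rv_lt _ hp)
    rw [hP.rv_rv _ hp] at this
    simp only [nf]; omega
  have h3 : ∑ k ∈ range 16, s.F (P.rv (16 * v + k)) =
      ∑ k ∈ range 16, P.nf s (P.rv (16 * v + k)) + ∑ k ∈ range 16, s.R (16 * v + k) := by
    rw [← sum_add_distrib]
    refine sum_congr rfl fun k hk => ?_
    have hp := dart_lt hv (mem_range.1 hk)
    have := hs.R_le _ hp
    simp only [nf, hP.rv_rv _ hp]; omega
  omega

theorem sum_nf_rv (hP : P.WF) (hs : P.Inv s) (f : ℕ → ℕ) :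
    ∑ v ∈ range P.n, ∑ k ∈ range 16, P.nf s (P.rv (16 * v + k)) * f v =
      ∑ p ∈ P.edges, P.nf s p * f (P.rv p / 16) := by
  rw [← sum_rv hP (fun p => P.nf s p * f (P.rv p / 16)),
    sum_edges (f := fun p => P.nf s (P.rv p) * f (P.rv (P.rv p) / 16))]
  · refine sum_congr rfl fun v hv => sum_congr rfl fun k hk => ?_
    rw [mem_range] at hv hk
    rw [hP.rv_rv _ (dart_lt hv hk), dart_div v hk]
  · intro p hp h
    simp only [h, hs.nf_null hP hp h, zero_mul]

theorem sum_nf (hP : P.WF) (hs : P.Inv s) (f : ℕ → ℕ) :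
    ∑ v ∈ range P.n, ∑ k ∈ range 16, P.nf s (16 * v + k) * f v =
      ∑ p ∈ P.edges, P.nf s p * f (p / 16) := by
  rw [sum_edges (f := fun p => P.nf s p * f (p / 16))]
  · refine sum_congr rfl fun v hv => sum_congr rfl fun k hk => ?_
    rw [mem_range] at hk
    rw [dart_div v hk]
  · intro p hp h
    simp only [hs.nf_null hP hp h, zero_mul]

theorem Inv.sum_src (hP : P.WF) (hs : P.Inv s) : ∑ v ∈ range P.n, P.src v =
    ∑ v ∈ range P.n, s.ab v + ∑ v ∈ range P.n, s.fl v + ∑ v ∈ range P.n, s.b v := by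
  have h1 := sum_nf hP hs fun _ => 1
  have h2 := sum_nf_rv hP hs fun _ => 1
  simp only [mul_one] at h1 h2
  have h3 := sum_congr (rfl : range P.n = range P.n) fun v hv =>
    hs.cons_nf hP (mem_range.1 hv)
  simp only [sum_add_distrib] at h3
  omega

/-- The total length of all net flow is at most the maximum height per unit sent. -/
theorem Inv.sum_nf_ell (hP : P.WF) (hs : P.Inv s) {i : ℕ} (hi : ∀ v < P.n, P.h v ≤ i) :
    ∑ p ∈ P.edges, P.nf s p * P.ell p ≤ i * ∑ v ∈ range P.n, (P.src v - s.fl v) := by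
  have h1 := sum_nf hP hs P.h
  have h2 := sum_nf_rv hP hs P.h
  -- Net flow lives on admissible darts, where the length is the difference of heights. The total
  -- length therefore telescopes to a sum over vertices of height times outflow minus inflow, and
  -- outflow exceeds inflow by at most `src - fl`.
  have h3 : ∑ p ∈ P.edges, P.nf s p * P.h (p / 16) =
      ∑ p ∈ P.edges, P.nf s p * P.ell p + ∑ p ∈ P.edges, P.nf s p * P.h (P.rv p / 16) := by
    rw [← sum_add_distrib]
    refine sum_congr rfl fun p hp => ?_
    by_cases h : P.nf s p = 0
    · simp [h]
    · rw [adm_ne_zero (by rw [hs.adm_of_nf (mem_edges.1 hp).1 h]; omega)]; ring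
  have h4 : ∑ v ∈ range P.n, ∑ k ∈ range 16, P.nf s (16 * v + k) * P.h v ≤
      ∑ v ∈ range P.n, ∑ k ∈ range 16, P.nf s (P.rv (16 * v + k)) * P.h v +
        i * ∑ v ∈ range P.n, (P.src v - s.fl v) := by
    rw [mul_sum, ← sum_add_distrib]
    refine sum_le_sum fun v hv => ?_
    rw [mem_range] at hv
    rw [← sum_mul, ← sum_mul]
    have h5 := hs.cons_nf hP hv
    have h6 := hs.fl_le v hv
    calc _ ≤ (∑ k ∈ range 16, P.nf s (P.rv (16 * v + k)) + (P.src v - s.fl v)) * P.h v :=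
          Nat.mul_le_mul_right _ (by omega)
      _ ≤ _ := by
          rw [add_mul, mul_comm i]
          exact Nat.add_le_add_left (Nat.mul_le_mul_left _ (hi v hv)) _
  omega

/-- The network of the next phase. -/
structure Next (P : Net) (s : Flow) (c : ℕ) (P' : Net) : Prop where
  n : P'.n = P.n
  rv : P'.rv = P.rv
  h : ∀ v < P.n, P'.h v = P.h v + s.dd v
  ell : ∀ p < 16 * P.n, P'.ell p = P.ell p + P.ell p * if P.used s p = P.z p then 1 else 0
  z : ∀ p < 16 * P.n, P'.z p = P.z p - P.used s p + c * if P.used s p = P.z p then 1 else 0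
  src : ∀ v < P.n, P'.src v = s.fl v
  fr : ∀ v < P.n, P'.fr v = P.fr v - s.ab v

/-- `valid` can fail only on an admissible dart whose tail rises and whose head does not. Then the
tail is dead, the head is alive, and `blocked` says that the dart is full. A live head has returned
nothing, so the edge is saturated by net flow and its length doubles, which restores the inequality.
A sink that rises has absorbed its unit and is no longer free. -/
theorem Next.wf {P' : Net} {c : ℕ} (hc : 0 < c) (hP : P.WF) (hs : P.Inv s) (hn : P.Next s c P') :
    P'.WF where
  rv_lt p hp := by rw [hn.n] at *; rw [hn.rv]; exact hP.rv_lt p hp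
  rv_rv p hp := by rw [hn.n] at *; rw [hn.rv]; exact hP.rv_rv p hp
  ell_pos p hp := by
    rw [hn.n] at hp
    have := hP.ell_pos p hp
    rw [hn.ell p hp]; omega
  ell_rv p hp := by
    rw [hn.n] at hp
    rw [hn.rv, hn.ell _ (hP.rv_lt p hp), hn.ell p hp, hP.ell_rv p hp, used_rv hP hp, hP.z_rv p hp]
  z_pos p hp := by
    rw [hn.n] at hp
    rw [hn.z p hp]
    have := hs.used_le hP hp
    split_ifs <;> omega
  z_rv p hp := by
    rw [hn.n] at hp
    rw [hn.rv, hn.z _ (hP.rv_lt p hp), hn.z p hp, used_rv hP hp, hP.z_rv p hp]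
  src_le v hv := by
    rw [hn.n] at hv
    rw [hn.src v hv]; exact (hs.fl_le v hv).trans (hP.src_le v hv)
  fr_le v hv := by
    rw [hn.n] at hv
    have := hP.fr_le v hv
    rw [hn.fr v hv]; omega
  h_fr v hv h := by
    rw [hn.n] at hv
    rw [hn.fr v hv] at h
    have h1 := hP.h_fr v hv (by omega)
    have h2 := hs.dd_le v hv
    have h3 := hs.sink v hv
    rw [hn.h v hv]; omega
  valid p hp := by
    rw [hn.n] at hp
    have hq := hP.rv_lt p hp
    rw [hn.rv, hn.h _ (div_lt hp), hn.h _ (div_lt hq), hn.ell p hp]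
    have h1 := hP.valid p hp
    have h2 := hs.dd_le _ (div_lt hp)
    have h3 := hP.ell_pos p hp
    by_cases hd : s.dd (p / 16) = 1
    · by_cases ha : P.adm p = 1
      · have h4 := adm_ne_zero (p := p) (P := P) (by omega)
        rcases hs.blocked p hp hd ha with h5 | h5
        · omega
        · by_cases h6 : s.R (P.rv p) = 0
          · have h7 : P.nf s p = P.z p := by simp only [nf]; omega
            have h8 := hP.z_pos p hp
            have h9 := hs.nf_rv hP hp (by omega)
            have : P.used s p = P.z p := by simp only [used]; omega
            simp only [this, if_true]; omega
          · have := hs.R_dd _ hq h6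
            omega
      · have h4 : P.h (p / 16) ≠ P.h (P.rv p / 16) + P.ell p := by
          intro h; exact ha (by simp [adm, h])
        omega
    · omega

/-- Exact growth of the weighted length. -/
theorem Next.weight {P' : Net} {c : ℕ} (hP : P.WF) (hs : P.Inv s) (hn : P.Next s c P')
    (hz : ∀ p < 16 * P.n, P.z p ≤ c) :
    ∑ p ∈ P.edges, (2 * c - P'.z p) * P'.ell p =
      ∑ p ∈ P.edges, (2 * c - P.z p) * P.ell p + 2 * ∑ p ∈ P.edges, P.nf s p * P.ell p := by
  have h1 : ∑ p ∈ P.edges, P.nf s (P.rv p) * P.ell p = ∑ p ∈ P.edges, P.nf s p * P.ell p := by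
    rw [← sum_rv hP fun p => P.nf s p * P.ell p]
    exact sum_congr rfl fun p hp => by rw [hP.ell_rv p (mem_edges.1 hp).1]
  have h2 : ∑ p ∈ P.edges, (2 * c - P'.z p) * P'.ell p = ∑ p ∈ P.edges,
      ((2 * c - P.z p) * P.ell p + (P.nf s p * P.ell p + P.nf s (P.rv p) * P.ell p)) := by
    refine sum_congr rfl fun p hp => ?_
    have hp := (mem_edges.1 hp).1
    rw [hn.z p hp, hn.ell p hp, ← add_mul, ← add_mul]
    have h3 := hs.used_le hP hp
    have h4 := hz p hp
    have h5 : P.nf s p + P.nf s (P.rv p) = P.used s p := rfl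
    rw [h5]
    split_ifs with h6
    -- On a saturated edge `used = z`, so `(2c - z + used) * ell = 2c * ell = (2c - c) * (2 * ell)`.
    -- The weight `2c - z` is chosen so that doubling with renewed capacity is neutral.
    · rw [h6, Nat.sub_self, show 2 * c - (0 + c * 1) = c by omega,
        show 2 * c - P.z p + P.z p = 2 * c by omega]; ring
    · rw [mul_zero, mul_zero, add_zero, add_zero]
      congr 1; omega
  rw [h2, sum_add_distrib, sum_add_distrib, h1]; omega

/-- The load `X` of an edge with length `ell` and remaining capacity `z`. -/
def Load (c ell z X : ℕ) : Prop := ∃ j, ell = 2 ^ j ∧ X + z ≤ c * j + c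

/-- The exponent `j` counts the doublings of the edge. Each length class admits at most `c` units
before the edge is saturated and doubled. -/
theorem Next.load {P' : Net} {c : ℕ} (hP : P.WF) (hs : P.Inv s) (hn : P.Next s c P') {p X X' : ℕ}
    (hp : p < 16 * P.n) (h : Load c (P.ell p) (P.z p) X) (hX : X' ≤ X + P.used s p) :
    Load c (P'.ell p) (P'.z p) X' := by
  obtain ⟨j, hj, h⟩ := h
  have := hs.used_le hP hp
  rw [hn.ell p hp, hn.z p hp]
  split_ifs with h1
  · exact ⟨j + 1, by rw [hj, pow_succ]; ring, by rw [mul_add]; omega⟩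
  · exact ⟨j, by simpa using hj, by omega⟩

/-- A doubled edge carries net flow, so one of its darts is admissible and its length is a
difference of heights, at most `i`. The `+ 1` allows for the initial length `1` at height `0`. -/
theorem Next.ell_le {P' : Net} {c i : ℕ} (hP : P.WF) (hs : P.Inv s) (hn : P.Next s c P')
    (hi : ∀ v < P.n, P.h v ≤ i) {p : ℕ} (hp : p < 16 * P.n) (h : P.ell p ≤ 2 * i + 1) :
    P'.ell p ≤ 2 * i + 1 := by
  rw [hn.ell p hp]
  split_ifs with h1
  · have hz := hP.z_pos p hp
    have hl : P.ell p ≤ i := by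
      by_cases h2 : P.nf s p = 0
      · have h3 : P.nf s (P.rv p) ≠ 0 := by simp only [used] at h1; omega
        have hq := hP.rv_lt p hp
        have h4 := adm_ne_zero (p := P.rv p) (P := P) (by rw [hs.adm_of_nf hq h3]; omega)
        have := hi _ (div_lt hq)
        rw [hP.ell_rv p hp] at h4; omega
      · have h4 := adm_ne_zero (p := p) (P := P) (by rw [hs.adm_of_nf hp h2]; omega)
        have := hi _ (div_lt hp)
        omega
    omega
  · omega

end Net

end CutMatch

namespace CutMatch

open Finset

namespace Net

/-! ### Decomposition of the net flow into paths

The units that enter a vertex are numbered, first a unit starting there, then those coming in along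
the darts in order. Outgoing units are numbered as well: first an absorbed unit, then those
leaving along the darts in order, then those still waiting. -/

variable (P : Net) (s : Flow)

/-- Units that have left their source for good. -/
def sent (v : ℕ) : ℕ := P.src v - s.fl v

/-- Number of the first unit leaving along the dart `16 x + k`. -/
def lo (x k : ℕ) : ℕ := s.ab x + ∑ j ∈ range k, P.nf s (16 * x + j)

/-- Number of the first unit arriving along the reversal of dart `16 x + k`. -/
def li (x k : ℕ) : ℕ := P.sent s x + ∑ j ∈ range k, P.nf s (P.rv (16 * x + j))

/-- One plus the dart along which unit `i` leaves vertex `x`, or `0` if there is none. -/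
def pick (x i : ℕ) : ℕ := ∑ k ∈ range 16, (if i < P.lo s x k + P.nf s (16 * x + k) then 1 else 0) *
  (1 - if i < P.lo s x k then 1 else 0) * (16 * x + k + 1)

/-- The number of unit `i` of vertex `p / 16` after leaving along dart `p`. -/
def arr (p i : ℕ) : ℕ :=
  P.li s (P.rv p / 16) (P.rv p % 16) + (i - P.lo s (p / 16) (p % 16))

/-- One step of a unit. -/
def adv (y : ℕ × ℕ) : ℕ × ℕ :=
  if P.pick s y.1 y.2 = 0 then y else
    (P.rv (P.pick s y.1 y.2 - 1) / 16, P.arr s (P.pick s y.1 y.2 - 1) y.2)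

/-- The position after `t` steps of the unit that starts at `v`. -/
def pos (v t : ℕ) : ℕ × ℕ := (P.adv s)^[t] (v, 0)

/-- Unit `i` of vertex `x` leaves along dart `p`. -/
def Hit (x i p : ℕ) : Prop :=
  p / 16 = x ∧ P.lo s x (p % 16) ≤ i ∧ i < P.lo s x (p % 16) + P.nf s p

variable {P s}

theorem lo_add_le {x k l : ℕ} (h : k < l) :
    P.lo s x k + P.nf s (16 * x + k) ≤ P.lo s x l := by
  simp only [lo, add_assoc]
  rw [← sum_range_succ]
  exact Nat.add_le_add_left (sum_le_sum_of_subset (range_mono (by omega))) _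

theorem li_add_le {x k l : ℕ} (h : k < l) :
    P.li s x k + P.nf s (P.rv (16 * x + k)) ≤ P.li s x l := by
  simp only [li, add_assoc]
  rw [← sum_range_succ (fun j => P.nf s (P.rv (16 * x + j)))]
  exact Nat.add_le_add_left (sum_le_sum_of_subset (range_mono (by omega))) _

/-- The numbers leaving along different darts of a vertex form disjoint intervals. -/
theorem Hit.unique {x i p p' : ℕ} (h : P.Hit s x i p) (h' : P.Hit s x i p') : p = p' := by
  obtain ⟨h1, h2, h3⟩ := h
  obtain ⟨h1', h2', h3'⟩ := h'
  have e : p = 16 * x + p % 16 := by omega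
  have e' : p' = 16 * x + p' % 16 := by omega
  rw [e] at h3; rw [e'] at h3'
  rw [dart_mod _ (by omega)] at h3 h3'
  rcases lt_trichotomy (p % 16) (p' % 16) with h | h | h
  · have := P.lo_add_le (s := s) (x := x) h; omega
  · omega
  · have := P.lo_add_le (s := s) (x := x) h; omega

theorem pick_of_hit {x i p : ℕ} (h : P.Hit s x i p) : P.pick s x i = p + 1 := by
  have e : p = 16 * x + p % 16 := by have := h.1; omega
  have h' := h
  obtain ⟨h1, h2, h3⟩ := h
  rw [pick, sum_eq_single (p % 16)]
  · rw [← e]; simp [h3, show ¬ i < P.lo s x (p % 16) by omega]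
  · intro k hk hne
    rw [mem_range] at hk
    by_contra h0
    refine hne ?_
    have : P.Hit s x i (16 * x + k) := by
      refine ⟨dart_div x hk, ?_⟩
      rw [dart_mod x hk]
      by_contra h4
      apply h0
      by_cases h5 : i < P.lo s x k
      · simp [h5]
      · simp [show ¬ i < P.lo s x k + P.nf s (16 * x + k) by omega]
    have := this.unique h'
    omega
  · intro h4; exact absurd (mem_range.2 (Nat.mod_lt _ (by norm_num))) h4

theorem pick_eq_zero {x i : ℕ} (h : ∀ p, ¬ P.Hit s x i p) : P.pick s x i = 0 := by
  refine sum_eq_zero fun k hk => ?_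
  rw [mem_range] at hk
  have h1 := h (16 * x + k)
  simp only [Hit, dart_div x hk, dart_mod x hk, true_and, not_and] at h1
  by_cases h5 : i < P.lo s x k
  · simp [h5]
  · simp [show ¬ i < P.lo s x k + P.nf s (16 * x + k) from h1 (by omega)]

theorem hit_of_pick {x i : ℕ} (h : P.pick s x i ≠ 0) : P.Hit s x i (P.pick s x i - 1) := by
  by_cases h1 : ∃ p, P.Hit s x i p
  · obtain ⟨p, hp⟩ := h1
    rw [pick_of_hit hp]; simpa using hp
  · push Not at h1
    exact absurd (pick_eq_zero h1) h

theorem exists_hit {x i : ℕ} (K : ℕ) (hK : K ≤ 16) (h1 : s.ab x ≤ i) (h2 : i < P.lo s x K) :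
    ∃ p, P.Hit s x i p := by
  induction K with
  | zero => simp only [lo, range_zero, sum_empty] at h2; omega
  | succ K ih =>
    by_cases h : i < P.lo s x K
    · exact ih (by omega) h
    · refine ⟨16 * x + K, dart_div x (by omega), ?_⟩
      rw [dart_mod x (by omega)]
      simp only [lo, sum_range_succ] at h2 h ⊢
      omega

/-- The numbers of units present at a vertex. -/
def tot (P : Net) (s : Flow) (x : ℕ) : ℕ := P.li s x 16

/-- Conservation of net flow: numbering by arrival and numbering by departure use the same set of
numbers, the last `b x` of which are waiting. -/
theorem tot_eq (hP : P.WF) (hs : P.Inv s) {x : ℕ} (hx : x < P.n) :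
    P.tot s x = P.lo s x 16 + s.b x := by
  have h1 := hs.cons_nf hP hx
  have h2 := hs.fl_le x hx
  simp only [tot, li, lo, sent]; omega

theorem Hit.lt_n {x i p : ℕ} (h : P.Hit s x i p) (hx : x < P.n) : p < 16 * P.n := by
  have := h.1; omega

theorem Hit.adm (hs : P.Inv s) {x i p : ℕ} (h : P.Hit s x i p) (hx : x < P.n) : P.adm p = 1 :=
  hs.adm_of_nf (h.lt_n hx) (by have := h.2; omega)

theorem Hit.arr {x i p : ℕ} (h : P.Hit s x i p) :
    P.li s (P.rv p / 16) (P.rv p % 16) ≤ P.arr s p i ∧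
      P.arr s p i < P.li s (P.rv p / 16) (P.rv p % 16) + P.nf s p := by
  obtain ⟨h1, h2, h3⟩ := h
  subst h1
  simp only [Net.arr]; omega

theorem Hit.arr_lt (hP : P.WF) {x i p : ℕ} (h : P.Hit s x i p) (hx : x < P.n) :
    P.arr s p i < P.tot s (P.rv p / 16) := by
  have h1 := h.arr
  have h2 := P.li_add_le (s := s) (x := P.rv p / 16) (k := P.rv p % 16) (l := 16) (by omega)
  rw [show 16 * (P.rv p / 16) + P.rv p % 16 = P.rv p by omega, hP.rv_rv _ (h.lt_n hx)] at h2
  simp only [tot]; omega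

theorem Hit.le_arr {x i p : ℕ} (h : P.Hit s x i p) :
    P.sent s (P.rv p / 16) ≤ P.arr s p i := by
  have h1 := h.arr
  simp only [li] at h1; omega

/-- Arrival numbers along different darts form disjoint intervals, and along one dart the order is
kept. So vertex and number determine where the unit came from. -/
theorem Hit.inj (hP : P.WF) {x i p x' i' p' : ℕ} (h : P.Hit s x i p) (hx : x < P.n)
    (h' : P.Hit s x' i' p') (hx' : x' < P.n) (e1 : P.rv p / 16 = P.rv p' / 16)
    (e2 : P.arr s p i = P.arr s p' i') : x = x' ∧ i = i' := by
  have h1 := h.arr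
  have h1' := h'.arr
  have hp := h.lt_n hx
  have hp' := h'.lt_n hx'
  have h2 : P.rv p % 16 = P.rv p' % 16 := by
    rcases lt_trichotomy (P.rv p % 16) (P.rv p' % 16) with h | h | h
    · have h2 := P.li_add_le (s := s) (x := P.rv p / 16) h
      rw [show 16 * (P.rv p / 16) + P.rv p % 16 = P.rv p by omega, hP.rv_rv _ hp] at h2
      rw [← e1] at h1'; omega
    · exact h
    · have h2 := P.li_add_le (s := s) (x := P.rv p' / 16) h
      rw [show 16 * (P.rv p' / 16) + P.rv p' % 16 = P.rv p' by omega, hP.rv_rv _ hp'] at h2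
      rw [e1] at h1; omega
  have h3 : P.rv p = P.rv p' := by omega
  have h4 : p = p' := by rw [← hP.rv_rv p hp, h3, hP.rv_rv p' hp']
  subst h4
  obtain ⟨a1, a2, a3⟩ := h
  obtain ⟨b1, b2, b3⟩ := h'
  subst a1; subst b1
  simp only [Net.arr] at e2; exact ⟨rfl, by omega⟩

theorem pos_succ (v t : ℕ) : P.pos s v (t + 1) = P.adv s (P.pos s v t) :=
  Function.iterate_succ_apply' _ _ _

/-- The unit starting at `v` leaves its position after `t` steps. -/
def Moves (P : Net) (s : Flow) (v t : ℕ) : Prop := P.pick s (P.pos s v t).1 (P.pos s v t).2 ≠ 0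

theorem Moves.hit {v t : ℕ} (h : P.Moves s v t) : ∃ p, P.Hit s (P.pos s v t).1 (P.pos s v t).2 p ∧
    P.pos s v (t + 1) = (P.rv p / 16, P.arr s p (P.pos s v t).2) := by
  refine ⟨_, hit_of_pick h, ?_⟩
  rw [pos_succ, adv, if_neg h]

theorem pos_succ_of_not {v t : ℕ} (h : ¬ P.Moves s v t) : P.pos s v (t + 1) = P.pos s v t := by
  rw [pos_succ, adv, if_pos (not_not.1 h)]

theorem pos_lt (hP : P.WF) {v : ℕ} (hv : v < P.n) (hs : 0 < P.sent s v) (t : ℕ) :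
    (P.pos s v t).1 < P.n ∧ (P.pos s v t).2 < P.tot s (P.pos s v t).1 := by
  induction t with
  | zero => refine ⟨hv, ?_⟩; simp only [pos, Function.iterate_zero, id, tot, li]; omega
  | succ t ih =>
    by_cases h : P.Moves s v t
    · obtain ⟨p, hp, e⟩ := h.hit
      rw [e]
      exact ⟨div_lt (hP.rv_lt p (hp.lt_n ih.1)), hp.arr_lt hP ih.1⟩
    · rw [pos_succ_of_not h]; exact ih

theorem Moves.height (hP : P.WF) (hi : P.Inv s) {v t : ℕ} (hv : v < P.n) (hs : 0 < P.sent s v)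
    (h : P.Moves s v t) : P.h (P.pos s v (t + 1)).1 < P.h (P.pos s v t).1 := by
  have hx := (pos_lt hP hv hs t).1
  obtain ⟨p, hp, e⟩ := h.hit
  have h1 := adm_ne_zero (p := p) (P := P) (by rw [hp.adm hi hx]; omega)
  have h2 := hP.ell_pos p (hp.lt_n hx)
  rw [e, ← hp.1]; simp only; omega

/-- The unit starting at `v` makes exactly `T` steps. -/
def Len (P : Net) (s : Flow) (v T : ℕ) : Prop := (∀ t < T, P.Moves s v t) ∧ ¬ P.Moves s v T

theorem Len.unique {v T T' : ℕ} (h : P.Len s v T) (h' : P.Len s v T') : T = T' := by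
  rcases lt_trichotomy T T' with h1 | h1 | h1
  · exact absurd (h'.1 T h1) h.2
  · exact h1
  · exact absurd (h.1 T' h1) h'.2

/-- The strict descent is used twice: it bounds the number of steps, and it excludes a repeated
vertex on a path. -/
theorem height_add_le (hP : P.WF) (hi : P.Inv s) {v T : ℕ} (hv : v < P.n) (hs : 0 < P.sent s v)
    (h : ∀ t < T, P.Moves s v t) {t u : ℕ} (htu : t ≤ u) (hu : u ≤ T) :
    P.h (P.pos s v u).1 + (u - t) ≤ P.h (P.pos s v t).1 := by
  obtain ⟨k, rfl⟩ := Nat.exists_eq_add_of_le htu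
  clear htu
  induction k with
  | zero => simp
  | succ k ih =>
    have h1 := (h (t + k) (by omega)).height hP hi hv hs
    have h2 := ih (by omega)
    rw [← add_assoc]; omega

theorem exists_len (hP : P.WF) (hi : P.Inv s) {v : ℕ} (hv : v < P.n) (hs : 0 < P.sent s v) :
    ∃ T ≤ P.h v, P.Len s v T := by
  classical
  have hex : ∃ t, ¬ P.Moves s v t := by
    by_contra h
    push Not at h
    have h1 := height_add_le hP hi hv hs (T := P.h v + 1) (fun t _ => h t)
      (Nat.zero_le (P.h v + 1)) le_rfl
    have h2 : (P.pos s v 0).1 = v := rfl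
    rw [h2] at h1; omega
  refine ⟨Nat.find hex, ?_, fun t ht => not_not.1 (Nat.find_min hex ht), Nat.find_spec hex⟩
  have h1 := height_add_le hP hi hv hs (T := Nat.find hex)
    (fun t ht => not_not.1 (Nat.find_min hex ht)) (Nat.zero_le _) le_rfl
  have h2 : (P.pos s v 0).1 = v := rfl
  rw [h2] at h1; omega

theorem Len.stays {v T t : ℕ} (h : P.Len s v T) (ht : T ≤ t) : P.pos s v t = P.pos s v T := by
  induction t, ht using Nat.le_induction with
  | base => rfl
  | succ t _ ih => rw [← ih]; exact pos_succ_of_not (by rw [Moves, ih]; exact h.2)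

/-- Steps can be undone by `Hit.inj`, so two trajectories that meet can be followed back until one
is at its start. Its number there is `0`, reserved for the vertex's own unit: arriving units get
numbers from `sent` on. Hence the other one is at its start too. -/
theorem pos_inj_of_le (hP : P.WF) {v v' t t' : ℕ} (hv : v < P.n)
    (hs : 0 < P.sent s v) (hv' : v' < P.n) (hs' : 0 < P.sent s v')
    (h : ∀ u < t, P.Moves s v u) (h' : ∀ u < t', P.Moves s v' u)
    (e : P.pos s v t = P.pos s v' t') : v = v' ∧ t = t' := by
  induction t generalizing t' with
  | zero =>
    cases t' with
    | zero => exact ⟨congrArg Prod.fst e, rfl⟩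
    | succ t' =>
      obtain ⟨p, hp, e'⟩ := (h' t' (by omega)).hit
      have h1 := hp.le_arr
      rw [e'] at e
      have e1 : v = P.rv p / 16 := congrArg Prod.fst e
      have e2 : 0 = P.arr s p (P.pos s v' t').2 := congrArg Prod.snd e
      rw [← e1, ← e2] at h1; omega
  | succ t ih =>
    obtain ⟨p, hp, e'⟩ := (h t (by omega)).hit
    have hx := (pos_lt hP hv hs t).1
    cases t' with
    | zero =>
      have h1 := hp.le_arr
      rw [e'] at e
      have e1 : P.rv p / 16 = v' := congrArg Prod.fst e
      have e2 : P.arr s p (P.pos s v t).2 = 0 := congrArg Prod.snd e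
      rw [e1, e2] at h1; omega
    | succ t' =>
      obtain ⟨p', hp', e''⟩ := (h' t' (by omega)).hit
      have hx' := (pos_lt hP hv' hs' t').1
      rw [e', e''] at e
      have e1 : P.rv p / 16 = P.rv p' / 16 := congrArg Prod.fst e
      have e2 : P.arr s p (P.pos s v t).2 = P.arr s p' (P.pos s v' t').2 := congrArg Prod.snd e
      obtain ⟨h1, h2⟩ := hp.inj hP hx hp' hx' e1 e2
      obtain ⟨h3, h4⟩ := ih (t' := t') (fun u hu => h u (by omega)) (fun u hu => h' u (by omega))
        (Prod.ext h1 h2)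
      exact ⟨h3, by omega⟩

/-- The unit starting at `v` is absorbed at `x` after `T` steps. -/
def Ends (P : Net) (s : Flow) (v T x : ℕ) : Prop :=
  v < P.n ∧ 0 < P.sent s v ∧ P.Len s v T ∧ (P.pos s v T).1 = x ∧ (P.pos s v T).2 < s.ab x

theorem Ends.inj (hP : P.WF) (hi : P.Inv s) {v v' T T' x : ℕ} (h : P.Ends s v T x)
    (h' : P.Ends s v' T' x) : v = v' := by
  obtain ⟨h1, h2, h3, h4, h5⟩ := h
  obtain ⟨h1', h2', h3', h4', h5'⟩ := h'
  have hx : x < P.n := h4 ▸ (pos_lt hP h1 h2 T).1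
  have h6 := hi.ab_le x hx
  have h7 := hP.fr_le x hx
  exact (pos_inj_of_le hP h1 h2 h1' h2' h3.1 h3'.1
    (Prod.ext (h4.trans h4'.symm) (by omega))).1

/-- Pigeonhole. Final positions of the units sent are distinct and lie in the set `Z` of positions
without a next step. These are the absorbed and the waiting numbers, and by conservation there are
no more of them than units sent. So every position in `Z` is attained, in particular number `0` at
`x`. -/
theorem exists_ends (hP : P.WF) (hi : P.Inv s) {x : ℕ} (hx : x < P.n) (hab : 0 < s.ab x) :
    ∃ v T, P.Ends s v T x := by
  classical
  choose! T hTle hT using fun v (h : v < P.n ∧ 0 < P.sent s v) => exists_len hP hi h.1 h.2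
  set S := (range P.n).filter fun v => 0 < P.sent s v with hS
  set Z := (range P.n).sigma fun x => (range (P.tot s x)).filter fun i => P.pick s x i = 0 with hZ
  have hmem : ∀ v ∈ S, v < P.n ∧ 0 < P.sent s v := fun v hv => by
    simpa [hS] using hv
  have hcard : Z.card ≤ S.card := by
    have h1 : S.card = ∑ v ∈ range P.n, P.sent s v := by
      rw [hS, card_filter]
      refine sum_congr rfl fun v hv => ?_
      have := hP.src_le v (mem_range.1 hv)
      simp only [sent]; by_cases h : 0 < P.src v - s.fl v <;> simp only [h, if_true, if_false] <;> omega
    have h2 : Z.card ≤ ∑ x ∈ range P.n, (s.ab x + s.b x) := by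
      rw [hZ, card_sigma]
      refine sum_le_sum fun x hx => ?_
      have hx := mem_range.1 hx
      have h3 := tot_eq hP hi hx
      calc _ ≤ (range (s.ab x) ∪ Ico (P.lo s x 16) (P.tot s x)).card := by
            refine card_le_card fun i hi' => ?_
            simp only [mem_filter, mem_range, mem_union, mem_Ico] at hi' ⊢
            by_contra h4
            obtain ⟨p, hp⟩ := P.exists_hit (s := s) (x := x) (i := i) 16 le_rfl (by omega) (by omega)
            have := pick_of_hit hp
            omega
        _ ≤ _ := by
            refine (card_union_le _ _).trans ?_
            rw [card_range, Nat.card_Ico]; omega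
    have h3 := hi.sum_src hP
    have h4 : ∑ v ∈ range P.n, P.sent s v + ∑ v ∈ range P.n, s.fl v = ∑ v ∈ range P.n, P.src v := by
      rw [← sum_add_distrib]
      refine sum_congr rfl fun v hv => ?_
      have := hi.fl_le v (mem_range.1 hv)
      simp only [sent]; omega
    rw [sum_add_distrib] at h2
    omega
  have hmaps : ∀ v ∈ S, (⟨(P.pos s v (T v)).1, (P.pos s v (T v)).2⟩ : Sigma fun _ : ℕ => ℕ) ∈ Z := by
    intro v hv
    have h1 := hmem v hv
    have h2 := pos_lt hP h1.1 h1.2 (T v)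
    simp only [hZ, mem_sigma, mem_range, mem_filter]
    exact ⟨h2.1, h2.2, not_not.1 (hT v h1).2⟩
  have hz : (⟨x, 0⟩ : Sigma fun _ : ℕ => ℕ) ∈ Z := by
    simp only [hZ, mem_sigma, mem_range, mem_filter]
    refine ⟨hx, ?_, pick_eq_zero fun p hp => ?_⟩
    · rw [tot_eq hP hi hx]; simp only [lo]; omega
    · have := hp.2.1; simp only [lo] at this; omega
  obtain ⟨v, hv, e⟩ := surj_on_of_inj_on_of_card_le
    (fun v _ => (⟨(P.pos s v (T v)).1, (P.pos s v (T v)).2⟩ : Sigma fun _ : ℕ => ℕ)) hmaps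
    (fun v v' hv hv' e => by
      have h1 := hmem v hv
      have h2 := hmem v' hv'
      have e1 : (P.pos s v (T v)).1 = (P.pos s v' (T v')).1 := congrArg Sigma.fst e
      have e2 : (P.pos s v (T v)).2 = (P.pos s v' (T v')).2 := by
        simpa using (Sigma.mk.inj_iff.1 e).2
      exact (pos_inj_of_le hP h1.1 h1.2 h2.1 h2.2 (hT v h1).1 (hT v' h2).1 (Prod.ext e1 e2)).1)
    hcard ⟨x, 0⟩ hz
  have h1 := hmem v hv
  have e1 : x = (P.pos s v (T v)).1 := congrArg Sigma.fst e
  have e2 : 0 = (P.pos s v (T v)).2 := by simpa using (Sigma.mk.inj_iff.1 e).2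
  exact ⟨v, T v, h1.1, h1.2, hT v h1, e1.symm, by omega⟩

open Classical in
/-- Few units that left their source are not absorbed. -/
theorem card_lost (hP : P.WF) (hi : P.Inv s) :
    ((range P.n).filter fun v => 0 < P.sent s v ∧ ¬ ∃ T x, P.Ends s v T x).card ≤
      ∑ v ∈ range P.n, s.b v := by
  choose! f hf using fun x (h : x < P.n ∧ 0 < s.ab x) => exists_ends hP hi h.1 h.2
  have h1 : ∑ v ∈ range P.n, s.ab v ≤
      ((range P.n).filter fun v => 0 < P.sent s v ∧ ∃ T x, P.Ends s v T x).card := by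
    calc _ = ((range P.n).filter fun x => 0 < s.ab x).card := by
          rw [card_filter]
          refine sum_congr rfl fun v hv => ?_
          have := hP.fr_le v (mem_range.1 hv)
          have := hi.ab_le v (mem_range.1 hv)
          split_ifs <;> omega
      _ ≤ _ := by
          refine card_le_card_of_injOn f ?_ ?_
          · intro x hx
            simp only [coe_filter, mem_range, Set.mem_ofPred_eq] at hx ⊢
            obtain ⟨T, h⟩ := hf x hx
            exact ⟨h.1, h.2.1, T, x, h⟩
          · intro x hx x' hx' e
            simp only [coe_filter, mem_range, Set.mem_ofPred_eq] at hx hx'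
            obtain ⟨T, h⟩ := hf x hx
            obtain ⟨T', h'⟩ := hf x' hx'
            rw [e] at h
            obtain ⟨_, _, h3, h4, _⟩ := h
            obtain ⟨_, _, h3', h4', _⟩ := h'
            exact h4.symm.trans (h3.unique h3' ▸ h4')
  have h2 : ((range P.n).filter fun v => 0 < P.sent s v).card +
      ∑ v ∈ range P.n, s.fl v = ∑ v ∈ range P.n, P.src v := by
    rw [card_filter, ← sum_add_distrib]
    refine sum_congr rfl fun v hv => ?_
    have := hi.fl_le v (mem_range.1 hv)
    have := hP.src_le v (mem_range.1 hv)
    simp only [sent]; by_cases h : 0 < P.src v - s.fl v <;> simp only [h, if_true, if_false] <;> omega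
  have h3 := hi.sum_src hP
  have h4 := card_filter_add_card_filter_not (s := (range P.n).filter fun v => 0 < P.sent s v)
    (fun v => ∃ T x, P.Ends s v T x)
  rw [filter_filter, filter_filter] at h4
  omega

open Classical in
/-- At most `nf p` units use dart `p`. -/
theorem card_use (hP : P.WF) (p : ℕ) :
    ((range P.n).filter fun v => 0 < P.sent s v ∧ ∃ t, (∀ u ≤ t, P.Moves s v u) ∧
      P.Hit s (P.pos s v t).1 (P.pos s v t).2 p).card ≤ P.nf s p := by
  choose! t ht using fun v (h : ∃ t, (∀ u ≤ t, P.Moves s v u) ∧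
      P.Hit s (P.pos s v t).1 (P.pos s v t).2 p) => h
  rw [← card_range (P.nf s p)]
  -- A unit is sent to its rank among the units that leave along `p`. Equal ranks mean equal
  -- positions, hence equal units.
  refine card_le_card_of_injOn
    (fun v => (P.pos s v (t v)).2 - P.lo s (p / 16) (p % 16)) ?_ ?_
  · intro v hv
    simp only [coe_filter, mem_range, Set.mem_ofPred_eq] at hv
    obtain ⟨h1, h2, h3⟩ := (ht v hv.2.2).2
    rw [← h1] at h2 h3
    simp only [coe_range, Set.mem_Iio]; omega
  · intro v hv v' hv' e
    simp only [coe_filter, mem_range, Set.mem_ofPred_eq] at hv hv'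
    obtain ⟨h1, h2, h3⟩ := (ht v hv.2.2).2
    obtain ⟨h1', h2', h3'⟩ := (ht v' hv'.2.2).2
    have e1 := h1.symm.trans h1'
    rw [← h1] at h2
    rw [← h1'] at h2'
    simp only at e
    exact (pos_inj_of_le hP hv.1 hv.2.1 hv'.1 hv'.2.1
      (fun u hu => (ht v hv.2.2).1 u (by omega)) (fun u hu => (ht v' hv'.2.2).1 u (by omega))
      (Prod.ext e1 (by omega))).1

end Net

end CutMatch

namespace CutMatch

open Finset ParRAM

/-! ### Programs

Memory layout: array `10` the involution, `11` heights, `12` dart lengths, `13` remaining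
capacities, `14` active sources, `15` free sinks, `16` matched sources, `17`-`22` the state of a
phase, `23` and `24` vertex lists, `25` and `26` moves of a round, `27`-`30` scratch space. -/

/-- The network stored in memory. -/
def mnet (n : ℕ) (m : Mem) : Net := ⟨n, m 10, m 11, m 12, m 13, m 14, m 15⟩

/-- The state of a phase stored in memory. -/
def mflow (m : Mem) : Flow := ⟨m 17, m 18, m 19, m 20, m 21, m 22⟩

namespace Code

open Expr

/-- The owner of a dart. -/
def own (p : Expr) : Expr := div p (const 16)

/-- The target of a dart. -/
def tgt (p : Expr) : Expr := own (read 10 p)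

/-- A dart of a vertex. -/
def slot (v k : Expr) : Expr := add (mul (const 16) v) k

/-- Sum over the darts of a vertex. -/
def dsum (f : Expr → Expr) (v : Expr) : Expr := sum (fun k => f (slot v (const k))) 16

/-- Sum over the first `k` darts of a vertex. -/
def psum (f : Expr → Expr) (v k : Expr) : Expr :=
  sum (fun j => mul (lt (const j) k) (f (slot v (const j)))) 16

def adm (p : Expr) : Expr := eq (read 11 (own p)) (add (read 11 (tgt p)) (read 12 p))

def fc (p : Expr) : Expr :=
  mul (mul (adm p) (sub (const 1) (read 19 (tgt p)))) (sub (read 13 p) (read 17 p))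

def a0 (v : Expr) : Expr := sub (read 20 v) (sub (read 15 v) (read 21 v))

def aF (p : Expr) : Expr :=
  Expr.min (fc p) (sub (a0 (own p)) (psum fc (own p) (mod p (const 16))))

def rem (v : Expr) : Expr := sub (a0 v) (dsum fc v)

def rc (p : Expr) : Expr := sub (read 17 (read 10 p)) (read 18 p)

def aR (p : Expr) : Expr :=
  Expr.min (rc p) (sub (read 29 (own p)) (psum rc (own p) (mod p (const 16))))

def amt (p : Expr) : Expr := add (read 25 p) (read 26 p)

/-- The vertex handled by a thread. -/
def vI : Expr := read 23 (reg 0)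

/-- The dart handled by a thread. -/
def dI : Expr := slot (read 23 (div (reg 0) (const 16))) (mod (reg 0) (const 16))

/-- Expressions have a fixed shape, so a partial sum of variable length is written as `16` masked
terms. -/
theorem psum_val (f : ℕ → ℕ) {k : ℕ} (hk : k ≤ 16) :
    ∑ j ∈ range 16, (if j < k then 1 else 0) * f j = ∑ j ∈ range k, f j := by
  simp only [ite_mul, one_mul, zero_mul]
  rw [← sum_filter]
  congr 1
  ext j; simp only [mem_filter, mem_range]; omega

variable {r : Regs} {m : Mem}

@[simp] theorem val_own (p : Expr) : (own p).val r m = p.val r m / 16 := rfl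

@[simp] theorem val_tgt (p : Expr) : (tgt p).val r m = m 10 (p.val r m) / 16 := rfl

@[simp] theorem val_slot (v k : Expr) : (slot v k).val r m = 16 * v.val r m + k.val r m := rfl

theorem val_dsum {f : Expr → Expr} {g : ℕ → ℕ} (v : Expr)
    (h : ∀ p, (f p).val r m = g (p.val r m)) :
    (dsum f v).val r m = ∑ k ∈ range 16, g (16 * v.val r m + k) := by
  simp [dsum, h]

theorem val_psum {f : Expr → Expr} {g : ℕ → ℕ} (v k : Expr) (hk : k.val r m ≤ 16)
    (h : ∀ p, (f p).val r m = g (p.val r m)) :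
    (psum f v k).val r m = ∑ j ∈ range (k.val r m), g (16 * v.val r m + j) := by
  rw [← psum_val _ hk]; simp only [psum, val_sum, Expr.val, h, val_slot]; rfl

theorem val_fc (n : ℕ) (p : Expr) :
    (fc p).val r m = (mnet n m).fc (mflow m) (p.val r m) := rfl

theorem val_a0 (n : ℕ) (v : Expr) :
    (a0 v).val r m = (mnet n m).a0 (mflow m) (v.val r m) := rfl

theorem val_rc (n : ℕ) (p : Expr) :
    (rc p).val r m = (mnet n m).rc (mflow m) (p.val r m) := rfl

theorem val_aF (n : ℕ) (p : Expr) :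
    (aF p).val r m = (mnet n m).aF (mflow m) (p.val r m) := by
  simp only [aF, val_min, Expr.val, val_fc n, val_a0 n, val_own, Net.aF]
  rw [val_psum _ _ (by simp only [Expr.val]; omega) (val_fc n)]
  rfl

theorem val_rem (n : ℕ) (v : Expr) :
    (rem v).val r m = (mnet n m).rem (mflow m) (v.val r m) := by
  simp only [rem, Expr.val, val_a0 n, Net.rem, val_dsum v (val_fc n)]

/-- Array `29` caches the remainders, as the program also needs them after parts of the state have
been overwritten. -/
theorem val_aR (n : ℕ) (p : Expr)
    (h : m 29 (p.val r m / 16) = (mnet n m).rem (mflow m) (p.val r m / 16)) :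
    (aR p).val r m = (mnet n m).aR (mflow m) (p.val r m) := by
  simp only [aR, val_min, Expr.val, val_rc n, val_own, Net.aR, h]
  rw [val_psum _ _ (by simp only [Expr.val]; omega) (val_rc n)]
  rfl

/-- The first half of a round: the moves are determined and the state is updated. -/
def push : Prog :=
  .seq (.vec (mul (const 16) (reg 3)) (const 1) 25 dI (aF dI)) <|
  .seq (.vec (reg 3) (const 1) 29 vI (rem vI)) <|
  .seq (.vec (mul (const 16) (reg 3)) (const 1) 26 dI (aR dI)) <|
  .seq (.vec (reg 3) (const 1) 22 vI
    (add (read 22 vI) (sub (read 29 vI) (dsum rc vI)))) <|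
  .seq (.vec (reg 3) (const 1) 19 vI
    (add (read 19 vI) (mul (lt (const 0) (read 29 vI)) (sub (const 1) (read 19 vI))))) <|
  .seq (.vec (reg 3) (const 1) 21 vI
    (add (read 21 vI) (Expr.min (read 20 vI) (sub (read 15 vI) (read 21 vI))))) <|
  .seq (.vec (mul (const 16) (reg 3)) (const 1) 17 dI (add (read 17 dI) (read 25 dI)))
    (.vec (mul (const 16) (reg 3)) (const 1) 18 dI (add (read 18 dI) (read 26 dI)))

end Code

/-! ### Lists of active vertices, and the first half of a round -/

/-- The first `A` entries of `L` are the vertices with waiting units. -/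
structure Lists (n A : ℕ) (L b : ℕ → ℕ) : Prop where
  mem : ∀ i < A, L i < n ∧ 0 < b (L i)
  inj : ∀ i < A, ∀ j < A, L i = L j → i = j
  surj : ∀ v < n, 0 < b v → ∃ i < A, L i = v

theorem Lists.card_le {n A : ℕ} {L b : ℕ → ℕ} (h : Lists n A L b) : A ≤ n := by
  rw [← card_range A, ← card_range n]
  refine card_le_card_of_injOn L (fun i hi => ?_) fun i hi j hj e => ?_
  · simpa using (h.mem i (by simpa using hi)).1
  · exact h.inj i (by simpa using hi) j (by simpa using hj) e

theorem Lists.sum_eq {n A : ℕ} {L b : ℕ → ℕ} (h : Lists n A L b) :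
    ∑ i ∈ range A, b (L i) = ∑ v ∈ range n, b v := by
  rw [← sum_filter_ne_zero (s := range n)]
  refine sum_nbij L ?_ ?_ ?_ fun _ _ => rfl
  · intro i hi
    have := h.mem i (mem_range.1 hi)
    simp only [mem_filter, mem_range]; omega
  · intro i hi j hj e
    exact h.inj i (by simpa using hi) j (by simpa using hj) e
  · intro v hv
    simp only [coe_filter, mem_range, Set.mem_ofPred_eq] at hv
    obtain ⟨i, hi, e⟩ := h.surj v hv.1 (by omega)
    exact ⟨i, by simpa using hi, e⟩

/-- This ties the cost of a round, proportional to the number of listed vertices, to the number of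
waiting units, which the potential controls. -/
theorem Lists.le_sum {n A : ℕ} {L b : ℕ → ℕ} (h : Lists n A L b) : A ≤ ∑ v ∈ range n, b v := by
  rw [← h.sum_eq]
  calc A = ∑ i ∈ range A, 1 := by simp
    _ ≤ _ := sum_le_sum fun i hi => (h.mem i (mem_range.1 hi)).2

theorem Lists.congr {n A : ℕ} {L b L' b' : ℕ → ℕ} (h : Lists n A L b) (hL : ∀ i < A, L' i = L i)
    (hb : ∀ v < n, b' v = b v) : Lists n A L' b' where
  mem i hi := by
    have := h.mem i hi
    rw [hL i hi, hb _ this.1]; exact this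
  inj i hi j hj e := h.inj i hi j hj (by rw [← hL i hi, ← hL j hj, e])
  surj v hv h0 := by
    rw [hb v hv] at h0
    obtain ⟨i, hi, e⟩ := h.surj v hv h0
    exact ⟨i, hi, by rw [hL i hi, e]⟩

/-- The `i`-th dart of the listed vertices. -/
def ldart (L : ℕ → ℕ) (i : ℕ) : ℕ := 16 * L (i / 16) + i % 16

theorem Lists.ldart_mem {n A : ℕ} {L b : ℕ → ℕ} (h : Lists n A L b) {i : ℕ} (hi : i < 16 * A) :
    ldart L i < 16 * n ∧ 0 < b (ldart L i / 16) := by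
  have h1 := h.mem (i / 16) (by omega)
  have h2 : ldart L i / 16 = L (i / 16) := by simp only [ldart]; omega
  rw [h2]
  refine ⟨?_, h1.2⟩
  simp only [ldart]; omega

theorem Lists.ldart_inj {n A : ℕ} {L b : ℕ → ℕ} (h : Lists n A L b) {i j : ℕ} (hi : i < 16 * A)
    (hj : j < 16 * A) (e : ldart L i = ldart L j) : i = j := by
  simp only [ldart] at e
  have := h.inj (i / 16) (by omega) (j / 16) (by omega) (by omega)
  omega

theorem Lists.ldart_surj {n A : ℕ} {L b : ℕ → ℕ} (h : Lists n A L b) {p : ℕ} (hp : p < 16 * n)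
    (hb : 0 < b (p / 16)) : ∃ i < 16 * A, ldart L i = p := by
  obtain ⟨i, hi, e⟩ := h.surj (p / 16) (by omega) hb
  refine ⟨16 * i + p % 16, by omega, ?_⟩
  simp only [ldart]
  rw [show (16 * i + p % 16) / 16 = i by omega, e]; omega

open Code in
/-- Sweep over the listed vertices. -/
theorem Tc.vertices {w B r m} {e : Expr} {a n A A' L : ℕ} {b : ℕ → ℕ}
    (hf : Fits w B (.vec (.reg 3) (.const 1) a vI e)) (hb : Bdd B r m) (hA : r 3 = A)
    (hAB : 16 * A ≤ B) (hA' : 16 * A + 1 ≤ A') (hL : 1 ≤ L) (hl : Lists n A (m 23) b) (ha : 23 ≠ a)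
    (hse : Expr.Safe a vI e) (v : ℕ → ℕ)
    (h1 : ∀ r', (∀ x ≠ 0, r' x = r x) → ∀ u, u < n → 0 < b u → vI.val r' m = u → e.val r' m = v u)
    (hv : ∀ u < n, 0 < b u → v u ≤ B) :
    Tc w (.vec (.reg 3) (.const 1) a vI e) r m A' L
      (Swept B a (fun u => u < n ∧ 0 < b u) v r m) := by
  refine (Tr.gather hf hb A hA (by omega) (by simp [vI, ha]) hse _ v (m 23) ?_ hl.mem ?_ ?_ hl.inj
    fun k hk => hv k hk.1 hk.2).toTc (by omega) hL
  · intro i hi; simp [vI]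
  · intro i hi
    have := hl.mem i hi
    exact h1 _ (fun x hx => by simp [hx]) _ this.1 this.2 (by simp [vI])
  · exact fun k hk => hl.surj k hk.1 hk.2

open Code in
/-- Sweep over the darts of the listed vertices. -/
theorem Tc.darts {w B r m} {e : Expr} {a n A A' L : ℕ} {b : ℕ → ℕ}
    (hf : Fits w B (.vec (.mul (.const 16) (.reg 3)) (.const 1) a dI e)) (hb : Bdd B r m)
    (hA : r 3 = A)
    (hAB : 16 * A ≤ B) (hA' : 16 * A + 1 ≤ A') (hL : 1 ≤ L) (hl : Lists n A (m 23) b) (ha : 23 ≠ a)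
    (hse : Expr.Safe a dI e) (v : ℕ → ℕ)
    (h1 : ∀ r', (∀ x ≠ 0, r' x = r x) → ∀ p, p < 16 * n → 0 < b (p / 16) → dI.val r' m = p →
      e.val r' m = v p)
    (hv : ∀ p < 16 * n, 0 < b (p / 16) → v p ≤ B) :
    Tc w (.vec (.mul (.const 16) (.reg 3)) (.const 1) a dI e) r m A' L
      (Swept B a (fun p => p < 16 * n ∧ 0 < b (p / 16)) v r m) := by
  refine (Tr.gather hf hb (16 * A) (by simp [hA]) hAB (by simp [dI, slot, ha]) hse _ v
    (ldart (m 23)) ?_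
    (fun i hi => hl.ldart_mem hi) ?_ (fun k hk => hl.ldart_surj hk.1 hk.2)
    (fun i hi j hj e => hl.ldart_inj hi hj e)
    fun k hk => hv k hk.1 hk.2).toTc hA' hL
  · intro i hi; simp [dI, ldart]
  · intro i hi
    have := hl.ldart_mem hi
    exact h1 _ (fun x hx => by simp [hx]) _ this.1 this.2 (by simp [dI, ldart])

namespace Net

variable {P : Net} {s : Flow}

/-- Vertices without waiting units move nothing, so sweeping over the listed vertices performs the
whole synchronous round. -/
theorem aF_idle {p : ℕ} (h : s.b (p / 16) = 0) : P.aF s p = 0 := by simp [aF, a0, h]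

theorem rem_idle {v : ℕ} (h : s.b v = 0) : P.rem s v = 0 := by simp [rem, a0, h]

theorem aR_idle {p : ℕ} (h : s.b (p / 16) = 0) : P.aR s p = 0 := aR_of_rem (rem_idle h)

/-- The state after a round. -/
def next (P : Net) (s : Flow) : Flow where
  F p := s.F p + P.aF s p
  R p := s.R p + P.aR s p
  dd v := if 0 < P.rem s v then 1 else s.dd v
  ab v := s.ab v + min (s.b v) (P.fr v - s.ab v)
  fl v := s.fl v + (P.rem s v - ∑ j ∈ range 16, P.rc s (16 * v + j))
  b v := ∑ k ∈ range 16, P.amt s (P.rv (16 * v + k))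

theorem next_F (p : ℕ) : (P.next s).F p = s.F p + P.aF s p := by simp only [next]

theorem next_R (p : ℕ) : (P.next s).R p = s.R p + P.aR s p := by simp only [next]

theorem next_dd (v : ℕ) : (P.next s).dd v = if 0 < P.rem s v then 1 else s.dd v := by
  simp only [next]

theorem next_ab (v : ℕ) : (P.next s).ab v = s.ab v + min (s.b v) (P.fr v - s.ab v) := by
  simp only [next]

theorem next_fl (v : ℕ) : (P.next s).fl v =
    s.fl v + (P.rem s v - ∑ j ∈ range 16, P.rc s (16 * v + j)) := by
  simp only [next]

theorem next_b (v : ℕ) : (P.next s).b v = ∑ k ∈ range 16, P.amt s (P.rv (16 * v + k)) := by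
  simp only [next]

theorem round_next : P.Round s (P.next s) :=
  ⟨fun p _ => next_F p, fun p _ => next_R p, fun v _ => next_dd v, fun v _ => next_ab v,
    fun v _ => next_fl v, fun v _ => next_b v⟩

theorem Inv.b_le (hP : P.WF) (hs : P.Inv s) : ∑ v ∈ range P.n, s.b v ≤ P.n := by
  have h1 := hs.sum_src hP
  have h2 : ∑ v ∈ range P.n, P.src v ≤ ∑ v ∈ range P.n, 1 :=
    sum_le_sum fun v hv => hP.src_le v (mem_range.1 hv)
  simp only [sum_const, card_range, smul_eq_mul, mul_one] at h2
  omega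

end Net

/-- Hypotheses for executing a round. -/
structure Ready (B n A : ℕ) (r : Regs) (m : Mem) : Prop where
  bdd : Bdd B r m
  big : 32 * n + 2 ≤ B
  reg : r 3 = A
  lists : Lists n A (m 23) (m 20)
  aF : ∀ p < 16 * n, m 25 p = 0
  aR : ∀ p < 16 * n, m 26 p = 0
  wf : (mnet n m).WF
  inv : (mnet n m).Inv (mflow m)

-- All moves and remainders are computed from the old state before `F`, `R` and the vertex data are
-- overwritten. Failures are updated while `F` and `R` are still old, and the updates of dead and
-- absorbing vertices need only the cached remainders and the old waiting units.
set_option maxHeartbeats 2000000 in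
open Code Expr in
theorem Tc.push {w B n A A' L r m} (hf : Fits w B push) (h : Ready B n A r m)
    (hA' : 16 * A + 1 ≤ A') (hL : 1 ≤ L) :
    Tc w push r m A' L fun r' m' => r' = r ∧ Bdd B r' m' ∧
      (∀ p < 16 * n, m' 17 p = ((mnet n m).next (mflow m)).F p) ∧
      (∀ p < 16 * n, m' 18 p = ((mnet n m).next (mflow m)).R p) ∧
      (∀ v < n, m' 19 v = ((mnet n m).next (mflow m)).dd v) ∧
      (∀ v < n, m' 21 v = ((mnet n m).next (mflow m)).ab v) ∧
      (∀ v < n, m' 22 v = ((mnet n m).next (mflow m)).fl v) ∧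
      (∀ p < 16 * n, m' 25 p + m' 26 p = (mnet n m).amt (mflow m) p) := by
  set P := mnet n m with hP
  set s := mflow m with hs
  have hwf := h.wf
  have hinv := h.inv
  have hinv' := hinv.round hwf (Net.round_next (P := P) (s := s))
  have hn : A ≤ n := h.lists.card_le
  have hB := h.big
  have hAB : 16 * A ≤ B := by omega
  have m10 : m 10 = P.rv := rfl
  unfold Code.push
  have hm : ∀ a i, m a i ≤ B := h.bdd.2
  refine Tc.seq (Tc.darts hf.left h.bdd h.reg hAB hA' hL h.lists (by decide) ?_ (P.aF s) ?_ ?_) ?_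
  · simp [aF, dI, slot, fc, Code.adm, own, tgt, a0, psum]
  · intro r' hr' p hp hb hpv; rw [val_aF n, hpv]
  · intro p hp hb
    exact (P.aF_le p).trans ((Nat.sub_le _ _).trans (hm 13 p))
  rintro _ m₁ ⟨rfl, hb₁, a25, b25, f₁⟩
  -- Cells of vertices not listed are untouched. They hold `0` by `Ready`, which is the correct move
  -- of an idle vertex.
  have e25 : ∀ p < 16 * n, m₁ 25 p = P.aF s p := by
    intro p hp
    by_cases hb : 0 < m 20 (p / 16)
    · exact a25 p ⟨hp, hb⟩
    · rw [b25 p (fun hh => hb hh.2), h.aF p hp, Net.aF_idle (show s.b (p / 16) = 0 by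
        simp only [hs, mflow]; omega)]
  have hP₁ : mnet n m₁ = P := by simp [mnet, hP, f₁]
  have hs₁ : mflow m₁ = s := by simp [mflow, hs, f₁]
  have hf := hf.right
  refine Tc.seq (Tc.vertices hf.left hb₁ h.reg hAB hA' hL (b := m 20) (n := n)
    (by rw [f₁ 23 (by decide)]; exact h.lists) (by decide) ?_ (P.rem s) ?_ ?_) ?_
  · simp [rem, vI, slot, fc, Code.adm, own, tgt, a0, dsum]
  · intro r' hr' v hv hb hpv; rw [val_rem n, hpv, hP₁, hs₁]
  · intro v hv hb
    exact (Nat.sub_le _ _).trans ((Nat.sub_le _ _).trans (hm 20 v))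
  rintro _ m₂ ⟨rfl, hb₂, a29, -, f₂⟩
  have hP₂ : mnet n m₂ = P := by rw [← hP₁]; simp [mnet, f₂]
  have hs₂ : mflow m₂ = s := by rw [← hs₁]; simp [mflow, f₂]
  have hf := hf.right
  refine Tc.seq (Tc.darts hf.left hb₂ h.reg hAB hA' hL (b := m 20) (n := n)
    (by rw [f₂ 23 (by decide), f₁ 23 (by decide)]; exact h.lists) (by decide) ?_ (P.aR s) ?_ ?_) ?_
  · simp [aR, dI, slot, rc, own, psum]
  · intro r' hr' p hp hb hpv
    rw [val_aR n, hpv, hP₂, hs₂]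
    rw [hpv, hP₂, hs₂, a29 _ ⟨by omega, hb⟩]
  · intro p hp hb
    exact (P.aR_le p).trans ((Nat.sub_le _ _).trans (hm 17 _))
  rintro _ m₃ ⟨rfl, hb₃, a26, b26, f₃⟩
  have e26 : ∀ p < 16 * n, m₃ 26 p = P.aR s p := by
    intro p hp
    by_cases hb : 0 < m 20 (p / 16)
    · exact a26 p ⟨hp, hb⟩
    · rw [b26 p (fun hh => hb hh.2), f₂ 26 (by decide), f₁ 26 (by decide), h.aR p hp,
        Net.aR_idle (show s.b (p / 16) = 0 by simp only [hs, mflow]; omega)]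
  have hP₃ : mnet n m₃ = P := by rw [← hP₂]; simp [mnet, f₃]
  have hs₃ : mflow m₃ = s := by rw [← hs₂]; simp [mflow, f₃]
  have hf := hf.right
  refine Tc.seq (Tc.vertices hf.left hb₃ h.reg hAB hA' hL (b := m 20) (n := n)
    (by rw [f₃ 23 (by decide), f₂ 23 (by decide), f₁ 23 (by decide)]; exact h.lists) (by decide)
    ?_ (P.next s).fl ?_ ?_) ?_
  · simp [vI, slot, rc, dsum]
  · intro r' hr' v hv hb hpv
    simp only [Expr.val, val_dsum vI (val_rc n), hpv, hP₃, hs₃]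
    rw [f₃ 29 (by decide), a29 v ⟨hv, hb⟩]
    simp [f₃, f₂, f₁, Net.next, hs, mflow]
  · intro v hv hb
    exact (hinv'.fl_le v hv).trans ((hwf.src_le v hv).trans (by omega))
  rintro _ m₄ ⟨rfl, hb₄, a22, b22, f₄⟩
  have hf := hf.right
  refine Tc.seq (Tc.vertices hf.left hb₄ h.reg hAB hA' hL (b := m 20) (n := n)
    (by rw [f₄ 23 (by decide), f₃ 23 (by decide), f₂ 23 (by decide), f₁ 23 (by decide)]
        exact h.lists) (by decide)
    ?_ (P.next s).dd ?_ ?_) ?_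
  · simp [vI]
  · intro r' hr' v hv hb hpv
    have h1 := hinv.dd_le v hv
    simp only [Expr.val, hpv]
    rw [f₄ 29 (by decide), f₃ 29 (by decide), a29 v ⟨hv, hb⟩]
    simp only [f₄ 19 (by decide), f₃ 19 (by decide), f₂ 19 (by decide), f₁ 19 (by decide), Net.next]
    change m 19 v ≤ 1 at h1
    change _ = if 0 < P.rem s v then 1 else m 19 v
    split_ifs <;> omega
  · intro v hv hb
    exact (hinv'.dd_le v hv).trans (by omega)
  rintro _ m₅ ⟨rfl, hb₅, a19, b19, f₅⟩
  have hf := hf.right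
  refine Tc.seq (Tc.vertices hf.left hb₅ h.reg hAB hA' hL (b := m 20) (n := n)
    (by rw [f₅ 23 (by decide), f₄ 23 (by decide), f₃ 23 (by decide), f₂ 23 (by decide),
          f₁ 23 (by decide)]
        exact h.lists) (by decide)
    ?_ (P.next s).ab ?_ ?_) ?_
  · simp [vI]
  · intro r' hr' v hv hb hpv
    simp only [Expr.val, val_min, hpv]
    simp [f₅, f₄, f₃, f₂, f₁, Net.next, hs, mflow, hP, mnet]
  · intro v hv hb
    exact (hinv'.ab_le v hv).trans ((hwf.fr_le v hv).trans (by omega))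
  rintro _ m₆ ⟨rfl, hb₆, a21, b21, f₆⟩
  have hf := hf.right
  refine Tc.seq (Tc.darts hf.left hb₆ h.reg hAB hA' hL (b := m 20) (n := n)
    (by rw [f₆ 23 (by decide), f₅ 23 (by decide), f₄ 23 (by decide), f₃ 23 (by decide),
          f₂ 23 (by decide), f₁ 23 (by decide)]
        exact h.lists) (by decide)
    ?_ (P.next s).F ?_ ?_) ?_
  · simp [dI, slot]
  · intro r' hr' p hp hb hpv
    simp only [Expr.val, hpv]
    simp [f₆, f₅, f₄, f₃, f₂, f₁, e25 p hp, Net.next, hs, mflow]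
  · intro p hp hb
    exact (hinv'.F_le p hp).trans (hm 13 p)
  rintro _ m₇ ⟨rfl, hb₇, a17, b17, f₇⟩
  refine (Tc.darts hf.right hb₇ h.reg hAB hA' hL (b := m 20) (n := n)
    (by rw [f₇ 23 (by decide), f₆ 23 (by decide), f₅ 23 (by decide), f₄ 23 (by decide),
          f₃ 23 (by decide), f₂ 23 (by decide), f₁ 23 (by decide)]
        exact h.lists) (by decide)
    ?_ (P.next s).R ?_ ?_).post ?_
  · simp [dI, slot]
  · intro r' hr' p hp hb hpv
    simp only [Expr.val, hpv]
    simp [f₇, f₆, f₅, f₄, e26 p hp, f₃, f₂, f₁, Net.next, hs, mflow]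
  · intro p hp hb
    exact (hinv'.R_le p hp).trans ((hinv'.F_le _ (hwf.rv_lt p hp)).trans (hm 13 _))
  rintro _ m₈ ⟨rfl, hb₈, a18, b18, f₈⟩
  have idle : ∀ v, ¬ 0 < m 20 v → s.b v = 0 := fun v hv => by simp only [hs, mflow]; omega
  have sF : s.F = m 17 := rfl
  have sR : s.R = m 18 := rfl
  have sdd : s.dd = m 19 := rfl
  have sab : s.ab = m 21 := rfl
  have sfl : s.fl = m 22 := rfl
  have i17 : ∀ p, ¬ 0 < m 20 (p / 16) → (P.next s).F p = m 17 p := fun p hp => by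
    rw [Net.next_F, Net.aF_idle (idle _ hp), sF, add_zero]
  have i18 : ∀ p, ¬ 0 < m 20 (p / 16) → (P.next s).R p = m 18 p := fun p hp => by
    rw [Net.next_R, Net.aR_idle (idle _ hp), sR, add_zero]
  have i19 : ∀ v, ¬ 0 < m 20 v → (P.next s).dd v = m 19 v := fun v hv => by
    rw [Net.next_dd, Net.rem_idle (idle _ hv), sdd, if_neg (lt_irrefl 0)]
  have i21 : ∀ v, ¬ 0 < m 20 v → (P.next s).ab v = m 21 v := fun v hv => by
    rw [Net.next_ab, idle _ hv, sab, Nat.zero_min, add_zero]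
  have i22 : ∀ v, ¬ 0 < m 20 v → (P.next s).fl v = m 22 v := fun v hv => by
    rw [Net.next_fl, Net.rem_idle (idle _ hv), sfl, Nat.zero_sub, add_zero]
  refine ⟨rfl, hb₈, ?_, ?_, ?_, ?_, ?_, ?_⟩
  · intro p hp
    rw [f₈ 17 (by decide)]
    by_cases hb : 0 < m 20 (p / 16)
    · exact a17 p ⟨hp, hb⟩
    · rw [b17 p fun hh => hb hh.2]
      simp [f₆, f₅, f₄, f₃, f₂, f₁, i17 p hb]
  · intro p hp
    by_cases hb : 0 < m 20 (p / 16)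
    · exact a18 p ⟨hp, hb⟩
    · rw [b18 p fun hh => hb hh.2]
      simp [f₇, f₆, f₅, f₄, f₃, f₂, f₁, i18 p hb]
  · intro v hv
    rw [f₈ 19 (by decide), f₇ 19 (by decide), f₆ 19 (by decide)]
    by_cases hb : 0 < m 20 v
    · exact a19 v ⟨hv, hb⟩
    · rw [b19 v fun hh => hb hh.2]
      simp [f₄, f₃, f₂, f₁, i19 v hb]
  · intro v hv
    rw [f₈ 21 (by decide), f₇ 21 (by decide)]
    by_cases hb : 0 < m 20 v
    · exact a21 v ⟨hv, hb⟩
    · rw [b21 v fun hh => hb hh.2]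
      simp [f₅, f₄, f₃, f₂, f₁, i21 v hb]
  · intro v hv
    rw [f₈ 22 (by decide), f₇ 22 (by decide), f₆ 22 (by decide), f₅ 22 (by decide)]
    by_cases hb : 0 < m 20 v
    · exact a22 v ⟨hv, hb⟩
    · rw [b22 v fun hh => hb hh.2]
      simp [f₃, f₂, f₁, i22 v hb]
  · intro p hp
    rw [f₈ 25 (by decide), f₇ 25 (by decide), f₆ 25 (by decide), f₅ 25 (by decide),
      f₄ 25 (by decide), f₃ 25 (by decide), f₂ 25 (by decide), e25 p hp,
      f₈ 26 (by decide), f₇ 26 (by decide), f₆ 26 (by decide), f₅ 26 (by decide),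
      f₄ 26 (by decide), e26 p hp]
    rfl

end CutMatch

/-! ### The second half of a round: listing the new active vertices -/

namespace CutMatch

open Finset ParRAM

/-- The vertices reached by the moves `α` of the listed vertices, listed without repetition. -/
theorem Lists.relist {n A : ℕ} {L b : ℕ → ℕ} (hl : Lists n A L b) {rv α : ℕ → ℕ}
    (rv_lt : ∀ p < 16 * n, rv p < 16 * n) (rv_rv : ∀ p < 16 * n, rv (rv p) = p)
    (hα : ∀ p < 16 * n, α p ≠ 0 → 0 < b (p / 16)) {g L' : ℕ → ℕ}
    (hg : ∀ j < 16 * A, g j = (if 0 < α (ldart L j) then 1 else 0) *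
      if ∑ k ∈ range (rv (ldart L j) % 16), α (rv (16 * (rv (ldart L j) / 16) + k)) = 0
        then 1 else 0)
    (hL' : ∀ j < 16 * A, g j ≠ 0 → L' (pre g j - 1) = rv (ldart L j) / 16) :
    Lists n (∑ j ∈ range (16 * A), g j) L' fun u => ∑ k ∈ range 16, α (rv (16 * u + k)) := by
  have hg1 : ∀ j < 16 * A, g j ≤ 1 := fun j hj => by rw [hg j hj]; split_ifs <;> omega
  have hgne : ∀ j < 16 * A, g j ≠ 0 → 0 < α (ldart L j) ∧
      ∑ k ∈ range (rv (ldart L j) % 16), α (rv (16 * (rv (ldart L j) / 16) + k)) = 0 := by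
    intro j hj h
    rw [hg j hj] at h
    constructor
    · by_contra hc; simp [hc] at h
    · by_contra hc; rw [if_neg hc, mul_zero] at h; exact h rfl
  refine ⟨fun i hi => ?_, fun i hi j hj e => ?_, fun v hv h0 => ?_⟩
  · obtain ⟨j, hj, hne, rfl⟩ := exists_pre_eq _ hg1 hi
    have h1 := hl.ldart_mem hj
    have h2 := rv_lt _ h1.1
    rw [hL' j hj hne]
    refine ⟨by omega, ?_⟩
    refine ((hgne j hj hne).1.trans_le ?_).trans_le (single_le_sum (f := fun k =>
      α (rv (16 * (rv (ldart L j) / 16) + k))) (fun _ _ => Nat.zero_le _)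
      (mem_range.2 (Nat.mod_lt (rv (ldart L j)) (by norm_num : 16 > 0))))
    simp only [Nat.div_add_mod, rv_rv _ h1.1, le_refl]
  · obtain ⟨i', hi', hne, rfl⟩ := exists_pre_eq _ hg1 hi
    obtain ⟨j', hj', hne', rfl⟩ := exists_pre_eq _ hg1 hj
    rw [hL' i' hi' hne, hL' j' hj' hne'] at e
    have h1 := hl.ldart_mem hi'
    have h2 := hl.ldart_mem hj'
    have h3 := hgne _ hi' hne
    have h4 := hgne _ hj' hne'
    -- A flag marks the first slot at which a target receives units. Two flagged darts with the same
    -- target therefore arrive at the same slot and are equal.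
    have key : ∀ p p', p < 16 * n → rv p / 16 = rv p' / 16 → 0 < α p →
        ∑ k ∈ range (rv p' % 16), α (rv (16 * (rv p' / 16) + k)) = 0 → rv p' % 16 ≤ rv p % 16 := by
      intro p p' hp e h h'
      by_contra hc
      have := (sum_eq_zero_iff.1 h') (rv p % 16) (mem_range.2 (by omega))
      rw [← e, Nat.div_add_mod, rv_rv p hp] at this
      omega
    have k1 := key _ _ h1.1 e h3.1 h4.2
    have k2 := key _ _ h2.1 e.symm h4.1 h3.2
    have k3 : rv (ldart L i') = rv (ldart L j') := by omega
    have k4 : ldart L i' = ldart L j' := by rw [← rv_rv _ h1.1, k3, rv_rv _ h2.1]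
    rw [hl.ldart_inj hi' hj' k4]
  -- A receiving vertex is listed by the dart arriving at its least receiving slot.
  · obtain ⟨k, hk, hmin⟩ : ∃ k, (k < 16 ∧ α (rv (16 * v + k)) ≠ 0) ∧
        ∀ l < k, ¬ (l < 16 ∧ α (rv (16 * v + l)) ≠ 0) := by
      have hex : ∃ k, k < 16 ∧ α (rv (16 * v + k)) ≠ 0 := by
        by_contra hc
        push Not at hc
        have : ∑ k ∈ range 16, α (rv (16 * v + k)) = 0 :=
          sum_eq_zero fun k hk => hc k (mem_range.1 hk)
        omega
      exact ⟨Nat.find hex, Nat.find_spec hex, fun l hl => Nat.find_min hex hl⟩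
    have hp := rv_lt (16 * v + k) (by omega)
    obtain ⟨j, hj, e⟩ := hl.ldart_surj hp (hα _ hp hk.2)
    have hgj : g j ≠ 0 := by
      rw [hg j hj, e, rv_rv _ (by omega : 16 * v + k < 16 * n), if_pos (by omega), one_mul, if_pos]
      · norm_num
      · refine sum_eq_zero fun l hl => ?_
        rw [dart_mod v hk.1, mem_range] at hl
        rw [dart_div v hk.1]
        by_contra hc
        exact hmin l hl ⟨by omega, hc⟩
    refine ⟨pre g j - 1, ?_, ?_⟩
    · have := pre_le_total g hj
      have := pre_pos hgj
      omega
    · rw [hL' j hj hgj, e, rv_rv _ (by omega : 16 * v + k < 16 * n), dart_div v hk.1]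

namespace Code

open Expr

/-- Units arriving along the reversal of a dart. -/
def inc (p : Expr) : Expr := amt (read 10 p)

/-- Whether a thread handles the first dart along which its target receives units. -/
def first : Expr :=
  mul (lt (const 0) (amt dI)) (eq (psum inc (tgt dI) (mod (read 10 dI) (const 16))) (const 0))

/-- The second half of a round: the waiting units and the list of their vertices are updated. -/
def relist : Prog :=
  .seq (.map (mul (const 16) (reg 3)) 30 first) <|
  .seq (.map (mul (const 16) (reg 3)) 27 (read 30 (reg 0))) <|
  .seq (.assign 5 (mul (const 16) (reg 3))) <|
  .seq .scan <|
  .seq (.vec (reg 3) (const 1) 20 vI (const 0)) <|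
  .seq (.vec (reg 5) (read 30 (reg 0)) 24 (sub (read 27 (reg 0)) (const 1)) (tgt dI)) <|
  .seq (.vec (reg 7) (const 1) 20 (read 24 (reg 0)) (dsum inc (read 24 (reg 0)))) <|
  .seq (.vec (mul (const 16) (reg 3)) (const 1) 25 dI (const 0)) <|
  .seq (.vec (mul (const 16) (reg 3)) (const 1) 26 dI (const 0)) <|
  .seq (.assign 3 (reg 7)) <|
  .seq (.map (reg 3) 23 (read 24 (reg 0))) <|
  .seq (.map (reg 3) 27 (read 20 (read 23 (reg 0)))) <|
  .seq (.assign 5 (reg 3)) <|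
  .seq .scan
    (.assign 4 (reg 7))

/-- A round. -/
def round : Prog := .seq push relist

end Code

theorem Tc.scan {w B r m A L} (hf : Fits w B .scan) (hb : Bdd B r m) (N : ℕ) (hN : r 5 = N)
    (hNB : 2 * N + 1 ≤ B) (g : ℕ → ℕ) (hg : ∀ i < N, m 27 i = g i)
    (hgB : ∑ i ∈ range N, g i ≤ B) (hL : Nat.clog 2 N + 2 ≤ L) (hA : (N + 1) * L ≤ A) :
    Tc w .scan r m A L fun r' m' => Bdd B r' m' ∧ (∀ i < N, m' 27 i = pre g i) ∧
      r' 7 = ∑ i ∈ range N, g i ∧ (∀ a, a ≠ 27 → a ≠ 28 → m' a = m a) ∧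
      ∀ x, x ≠ 6 → x ≠ 7 → r' x = r x := by
  refine (Tc.frame (Tr.scan hf hb N hN hNB g hg hgB)).mono (Nat.mul_le_mul_left _ ?_)
    (Nat.mul_le_mul_left _ hL) ?_
  · exact (Nat.mul_le_mul_left _ hL).trans hA
  · rintro r' m' ⟨⟨h1, h2, h3⟩, h4, h5⟩
    refine ⟨h1, h2, h3, fun a h h' => h4 a ?_, fun x h h' => h5 x ?_⟩
    · simp [Prog.scan, Prog.scanStep, Prog.map, Prog.vec, Prog.arrays, h, h']
    · simp [Prog.scan, Prog.scanStep, Prog.map, Prog.vec, Prog.registers, h, h']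

set_option maxHeartbeats 4000000 in
open Code Expr in
theorem Tc.relist {w B n A A' L r m} {b α : ℕ → ℕ} (hf : Fits w B relist) (hb : Bdd B r m)
    (hB : 32 * n + 2 ≤ B) (h3 : r 3 = A) (hl : Lists n A (m 23) b)
    (h20 : ∀ v < n, m 20 v = b v) (h25 : ∀ p < 16 * n, m 25 p + m 26 p = α p)
    (h25' : ∀ p < 16 * n, ¬ 0 < b (p / 16) → m 25 p = 0 ∧ m 26 p = 0)
    (rv_lt : ∀ p < 16 * n, m 10 p < 16 * n) (rv_rv : ∀ p < 16 * n, m 10 (m 10 p) = p)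
    (hsum : ∑ u ∈ range n, ∑ k ∈ range 16, α (m 10 (16 * u + k)) ≤ n)
    (hL : Nat.clog 2 (16 * n) + 2 ≤ L) (hA' : (16 * A + 1) * L ≤ A') :
    Tc w relist r m A' L fun r' m' => Bdd B r' m' ∧
      (∃ A₁, r' 3 = A₁ ∧ Lists n A₁ (m' 23) (m' 20)) ∧
      (∀ u < n, m' 20 u = ∑ k ∈ range 16, α (m 10 (16 * u + k))) ∧
      (∀ p < 16 * n, m' 25 p = 0) ∧ (∀ p < 16 * n, m' 26 p = 0) ∧
      r' 4 = ∑ u ∈ range n, ∑ k ∈ range 16, α (m 10 (16 * u + k)) := by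
  have hL1 : 1 ≤ L := by omega
  have hA1 : 16 * A + 1 ≤ A' := by nlinarith
  have hA1' : A' ≥ 1 := by omega
  have hAn := hl.card_le
  have hAB : 16 * A ≤ B := by omega
  obtain ⟨b', hb'⟩ : ∃ b' : ℕ → ℕ, b' = fun u => ∑ k ∈ range 16, α (m 10 (16 * u + k)) := ⟨_, rfl⟩
  have hb'u : ∀ u, ∑ k ∈ range 16, α (m 10 (16 * u + k)) = b' u := fun u => by rw [hb']
  simp only [hb'u] at hsum ⊢
  have hb'le : ∀ u < n, b' u ≤ n := fun u hu =>
    (single_le_sum (f := b') (fun _ _ => Nat.zero_le _) (mem_range.2 hu)).trans hsum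
  have hα : ∀ p < 16 * n, α p ≠ 0 → 0 < b (p / 16) := by
    intro p hp h
    by_contra hc
    have := h25' p hp hc
    have := h25 p hp
    omega
  set g : ℕ → ℕ := fun j => (if 0 < α (ldart (m 23) j) then 1 else 0) *
      if ∑ k ∈ range (m 10 (ldart (m 23) j) % 16),
        α (m 10 (16 * (m 10 (ldart (m 23) j) / 16) + k)) = 0 then 1 else 0 with hg
  have hg1 : ∀ j, g j ≤ 1 := fun j => by simp only [hg]; split_ifs <;> omega
  have hgsum : ∑ j ∈ range (16 * A), g j ≤ 16 * A := by
    calc _ ≤ ∑ j ∈ range (16 * A), 1 := sum_le_sum fun j _ => hg1 j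
      _ = _ := by simp
  unfold Code.relist
  refine Tc.seq ((Tr.map hf.left hb (16 * A) (by simp [h3]) hAB ?_ g ?_ ?_).toTc hA1 hL1) ?_
  · simp [first, Code.amt, inc, psum, tgt, own, dI, slot]
  · intro j hj
    have hd := hl.ldart_mem hj
    have hq := rv_lt _ hd.1
    have hdI : dI.val (Function.update r 0 j) m = ldart (m 23) j := by simp [dI, ldart]
    simp only [first, Expr.val, Code.amt, hdI, h25 _ hd.1, hg]
    have hps : (psum inc (tgt dI) ((read 10 dI).mod (const 16))).val (Function.update r 0 j) m =
        ∑ k ∈ range (m 10 (ldart (m 23) j) % 16),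
          α (m 10 (16 * (m 10 (ldart (m 23) j) / 16) + k)) := by
      rw [val_psum (g := fun p => m 25 (m 10 p) + m 26 (m 10 p)) _ _
        (by simp only [Expr.val]; omega) (fun p => rfl)]
      simp only [Expr.val, val_tgt, hdI]
      refine sum_congr rfl fun k hk => ?_
      rw [mem_range] at hk
      exact h25 _ (rv_lt _ (by omega))
    rw [hps]
    rfl
  · intro j hj; have := hg1 j; omega
  rintro _ m₁ ⟨rfl, hb₁, a30, -, f₁⟩
  have hf := hf.right
  refine Tc.seq ((Tr.map hf.left hb₁ (16 * A) (by simp [h3]) hAB (by simp) g ?_ ?_).toTc hA1 hL1) ?_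
  · intro j hj; simp [a30 j hj]
  · intro j hj; have := hg1 j; omega
  rintro _ m₂ ⟨rfl, hb₂, a27, -, f₂⟩
  have hf := hf.right
  refine Tc.seq ((Tr.assign hf.left hb₂ (16 * A) (by simp [h3]) hAB).toTc₁ hA1' hL1) ?_
  rintro _ _ ⟨rfl, rfl, hb₃⟩
  have hf := hf.right
  have hclog : Nat.clog 2 (16 * A) ≤ Nat.clog 2 (16 * n) := Nat.clog_mono_right 2 (by omega)
  refine Tc.seq (Tc.scan hf.left hb₃ (16 * A) (by simp) (by omega) g a27 (by omega) (A := A')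
    (L := L) (by omega) hA') ?_
  rintro r₄ m₄ ⟨hb₄, b27, t4, f₄, g₄⟩
  have hf := hf.right
  have e3 : r₄ 3 = A := by rw [g₄ 3 (by decide) (by decide)]; simp [h3]
  have e5 : r₄ 5 = 16 * A := by rw [g₄ 5 (by decide) (by decide)]; simp
  -- Clearing the old waiting units first makes the later sweep over the new targets correct
  -- everywhere: vertices outside both lists keep `0`.
  refine Tc.seq (Tc.vertices hf.left hb₄ e3 hAB hA1 hL1 (b := b) (n := n)
    (by rw [f₄ 23 (by decide) (by decide), f₂ 23 (by decide), f₁ 23 (by decide)]; exact hl)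
    (by decide) trivial (fun _ => 0) (fun _ _ _ _ _ _ => rfl) (fun _ _ _ => Nat.zero_le _)) ?_
  rintro _ m₅ ⟨rfl, hb₅, a20, b20, f₅⟩
  have z20 : ∀ v < n, m₅ 20 v = 0 := by
    intro v hv
    by_cases h : 0 < b v
    · exact a20 v ⟨hv, h⟩
    · rw [b20 v fun hh => h hh.2, f₄ 20 (by decide) (by decide), f₂ 20 (by decide),
        f₁ 20 (by decide), h20 v hv]; omega
  have hf := hf.right
  have e23 : m₅ 23 = m 23 := by
    rw [f₅ 23 (by decide), f₄ 23 (by decide) (by decide), f₂ 23 (by decide), f₁ 23 (by decide)]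
  have e10 : m₅ 10 = m 10 := by
    rw [f₅ 10 (by decide), f₄ 10 (by decide) (by decide), f₂ 10 (by decide), f₁ 10 (by decide)]
  have e30 : m₅ 30 = m₁ 30 := by
    rw [f₅ 30 (by decide), f₄ 30 (by decide) (by decide), f₂ 30 (by decide)]
  have e27 : m₅ 27 = m₄ 27 := f₅ 27 (by decide)
  have e25 : m₅ 25 = m 25 := by
    rw [f₅ 25 (by decide), f₄ 25 (by decide) (by decide), f₂ 25 (by decide), f₁ 25 (by decide)]
  have e26 : m₅ 26 = m 26 := by
    rw [f₅ 26 (by decide), f₄ 26 (by decide) (by decide), f₂ 26 (by decide), f₁ 26 (by decide)]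
  refine Tc.seq ((Tr.compact hf.left hb₅ (16 * A) (by simpa using e5) hAB (by decide)
    (by simp) (by simp [tgt, own, dI, slot]) g (fun j => m 10 (ldart (m 23) j) / 16)
    (fun j _ => hg1 j) (fun j hj => by simp [e30, a30 j hj])
    (fun j hj => by rw [e27, b27 j hj]) (fun j hj _ => by simp [dI, ldart, e10, e23])
    (fun j hj => ?_)).toTc hA1 hL1) ?_
  · have := rv_lt _ (hl.ldart_mem hj).1
    omega
  rintro _ m₆ ⟨rfl, hb₆, f₆, a24, -⟩
  set A₁ := ∑ j ∈ range (16 * A), g j with hA₁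
  have hl' : Lists n A₁ (m₆ 24) b' := by
    rw [hb']
    exact hl.relist rv_lt rv_rv hα (fun j _ => rfl) a24
  have hA₁n := hl'.card_le
  have hf := hf.right
  refine Tc.seq ((Tr.gather hf.left hb₆ A₁ t4 (by omega) (by simp) (by simp [dsum, inc, Code.amt, slot])
    (fun u => u < n ∧ 0 < b' u) b' (m₆ 24) (fun i hi => by simp) (fun i hi => hl'.mem i hi)
    (fun i hi => ?_) (fun k hk => hl'.surj k hk.1 hk.2) hl'.inj
    (fun k hk => (hb'le k hk.1).trans (by omega))).toTc (by omega) hL1) ?_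
  · rw [val_dsum (g := fun p => m₆ 25 (m₆ 10 p) + m₆ 26 (m₆ 10 p)) _ (fun p => rfl)]
    simp only [Expr.val, Function.update_self, ← hb'u]
    refine sum_congr rfl fun k hk => ?_
    have := (hl'.mem i hi).1
    rw [mem_range] at hk
    rw [f₆ 25 (by decide), f₆ 26 (by decide), f₆ 10 (by decide), e10, e25, e26]
    exact h25 _ (rv_lt _ (by omega))
  rintro _ m₇ ⟨rfl, hb₇, c20, d20, f₇⟩
  have v20 : ∀ u < n, m₇ 20 u = b' u := by
    intro u hu
    by_cases h : 0 < b' u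
    · exact c20 u ⟨hu, h⟩
    · rw [d20 u fun hh => h hh.2, f₆ 20 (by decide), z20 u hu]; omega
  have hf := hf.right
  -- Array `23` and register `3` still describe the old list, so exactly the darts that may carry
  -- moves are reset to `0`.
  refine Tc.seq (Tc.darts hf.left hb₇ e3 hAB hA1 hL1 (b := b) (n := n)
    (by rw [f₇ 23 (by decide), f₆ 23 (by decide), e23]; exact hl)
    (by decide) trivial (fun _ => 0) (fun _ _ _ _ _ _ => rfl) (fun _ _ _ => Nat.zero_le _)) ?_
  rintro _ m₈ ⟨rfl, hb₈, a25, b25, f₈⟩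
  have z25 : ∀ p < 16 * n, m₈ 25 p = 0 := by
    intro p hp
    by_cases h : 0 < b (p / 16)
    · exact a25 p ⟨hp, h⟩
    · rw [b25 p fun hh => h hh.2, f₇ 25 (by decide), f₆ 25 (by decide), e25, (h25' p hp h).1]
  have hf := hf.right
  refine Tc.seq (Tc.darts hf.left hb₈ e3 hAB hA1 hL1 (b := b) (n := n)
    (by rw [f₈ 23 (by decide), f₇ 23 (by decide), f₆ 23 (by decide), e23]; exact hl)
    (by decide) trivial (fun _ => 0) (fun _ _ _ _ _ _ => rfl) (fun _ _ _ => Nat.zero_le _)) ?_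
  rintro _ m₉ ⟨rfl, hb₉, a26, b26, f₉⟩
  have z26 : ∀ p < 16 * n, m₉ 26 p = 0 := by
    intro p hp
    by_cases h : 0 < b (p / 16)
    · exact a26 p ⟨hp, h⟩
    · rw [b26 p fun hh => h hh.2, f₈ 26 (by decide), f₇ 26 (by decide), f₆ 26 (by decide), e26,
        (h25' p hp h).2]
  have hf := hf.right
  refine Tc.seq ((Tr.assign hf.left hb₉ A₁ t4 (by omega)).toTc₁ hA1' hL1) ?_
  rintro _ _ ⟨rfl, rfl, hb₁₀⟩
  have hf := hf.right
  refine Tc.seq ((Tr.map hf.left hb₁₀ A₁ (by simp) (by omega) (by simp) (m₆ 24)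
    (fun i hi => by simp [f₉, f₈, f₇]) (fun i hi => hb₆.2 24 i)).toTc (by omega) hL1) ?_
  rintro _ m₁₁ ⟨rfl, hb₁₁, a23, -, f₁₁⟩
  have hl₁₁ : Lists n A₁ (m₁₁ 23) b' := hl'.congr a23 fun _ _ => rfl
  have w20 : m₁₁ 20 = m₇ 20 := by rw [f₁₁ 20 (by decide), f₉ 20 (by decide), f₈ 20 (by decide)]
  have hf := hf.right
  refine Tc.seq ((Tr.map hf.left hb₁₁ A₁ (by simp) (by omega) (by simp) (fun i => b' (m₁₁ 23 i))
    (fun i hi => by simp [w20, v20 _ (hl₁₁.mem i hi).1])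
    (fun i hi => (hb'le _ (hl₁₁.mem i hi).1).trans (by omega))).toTc (by omega) hL1) ?_
  rintro _ m₁₂ ⟨rfl, hb₁₂, c27, -, f₁₂⟩
  have hf := hf.right
  refine Tc.seq ((Tr.assign hf.left hb₁₂ A₁ (by simp) (by omega)).toTc₁ hA1' hL1) ?_
  rintro _ _ ⟨rfl, rfl, hb₁₃⟩
  have hf := hf.right
  have hclog : Nat.clog 2 A₁ ≤ Nat.clog 2 (16 * n) := Nat.clog_mono_right 2 (by omega)
  have hsum' := hl₁₁.sum_eq
  refine Tc.seq (Tc.scan hf.left hb₁₃ A₁ (by simp) (by omega) _ c27 (by omega) (A := A')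
    (L := L) (by omega) ((Nat.mul_le_mul_right _ (by omega)).trans hA')) ?_
  rintro r₁₄ m₁₄ ⟨hb₁₄, -, t7, f₁₄, g₁₄⟩
  refine ((Tr.assign hf.right hb₁₄ (∑ u ∈ range n, b' u) (by simp [t7, hsum'])
    (by omega)).toTc₁ hA1' hL1).post ?_
  rintro _ m₁₅ ⟨rfl, rfl, hb₁₅⟩
  have u20 : ∀ u < n, m₁₅ 20 u = b' u := fun u hu => by
    rw [f₁₄ 20 (by decide) (by decide), f₁₂ 20 (by decide), w20, v20 u hu]
  refine ⟨hb₁₅, ⟨A₁, ?_, ?_⟩, u20, ?_, ?_, by simp⟩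
  · simp [g₁₄ 3 (by decide) (by decide)]
  · refine hl₁₁.congr (fun i _ => ?_) u20
    rw [f₁₄ 23 (by decide) (by decide), f₁₂ 23 (by decide)]
  · intro p hp
    rw [f₁₄ 25 (by decide) (by decide), f₁₂ 25 (by decide), f₁₁ 25 (by decide), f₉ 25 (by decide),
      z25 p hp]
  · intro p hp
    rw [f₁₄ 26 (by decide) (by decide), f₁₂ 26 (by decide), f₁₁ 26 (by decide), z26 p hp]

theorem Net.sum_amt_rv {P : Net} {s : Flow} (hP : P.WF) (hs : P.Inv s) :
    ∑ u ∈ range P.n, ∑ k ∈ range 16, P.amt s (P.rv (16 * u + k)) ≤ P.n :=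
  (Net.Inv.b_le hP (hs.round hP Net.round_next) :)

open Code in
theorem Tc.round {w B n A A' L r m} (hf : Fits w B round) (h : Ready B n A r m)
    (hL : Nat.clog 2 (16 * n) + 2 ≤ L) (hA' : (16 * A + 1) * L ≤ A') :
    Tc w round r m A' L fun r' m' => (∃ A₁, Ready B n A₁ r' m') ∧
      (mnet n m).Round (mflow m) (mflow m') ∧ r' 4 = ∑ v ∈ range n, (mflow m').b v ∧
      (∀ a ∉ Code.round.arrays, m' a = m a) ∧ ∀ x ∉ Code.round.registers, r' x = r x := by
  have hA1 : 16 * A + 1 ≤ A' := by nlinarith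
  refine (Tc.frame (Q := fun r' m' => Bdd B r' m' ∧ (∃ A₁, r' 3 = A₁ ∧
    Lists n A₁ (m' 23) (m' 20)) ∧ (∀ p < 16 * n, m' 25 p = 0) ∧ (∀ p < 16 * n, m' 26 p = 0) ∧
    (mnet n m).Round (mflow m) (mflow m') ∧ r' 4 = ∑ v ∈ range n, (mflow m').b v) ?_).post ?_
  · refine Tc.seq (Tc.frame (Tc.push hf.left h hA1 (by omega))) ?_
    rintro _ m₁ ⟨⟨rfl, hb₁, a17, a18, a19, a21, a22, a25⟩, f₁, -⟩
    have e10 : m₁ 10 = m 10 := f₁ 10 (by decide)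
    have e20 : m₁ 20 = m 20 := f₁ 20 (by decide)
    refine (Tc.frame (Tc.relist hf.right hb₁ h.big h.reg (b := m 20)
      (by rw [f₁ 23 (by decide)]; exact h.lists) (fun v _ => by rw [e20]) a25 ?_
      (by rw [e10]; exact h.wf.rv_lt) (by rw [e10]; exact h.wf.rv_rv)
      (by rw [e10]; exact Net.sum_amt_rv h.wf h.inv) hL hA')).post ?_
    · intro p hp hb
      have h0 : (mflow m).b (p / 16) = 0 := by simp only [mflow]; omega
      have := a25 p hp
      rw [Net.amt, Net.aF_idle h0, Net.aR_idle h0] at this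
      omega
    · rintro r₂ m₂ ⟨⟨hb₂, hl, b20, b25, b26, t4⟩, f₂, -⟩
      rw [e10] at b20 t4
      refine ⟨hb₂, hl, b25, b26, ⟨?_, ?_, ?_, ?_, ?_, ?_⟩, ?_⟩
      · intro p hp
        rw [← Net.next_F, ← a17 p hp, ← f₂ 17 (by decide)]; rfl
      · intro p hp
        rw [← Net.next_R, ← a18 p hp, ← f₂ 18 (by decide)]; rfl
      · intro v hv
        rw [← Net.next_dd, ← a19 v hv, ← f₂ 19 (by decide)]; rfl
      · intro v hv
        rw [← Net.next_ab, ← a21 v hv, ← f₂ 21 (by decide)]; rfl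
      · intro v hv
        rw [← Net.next_fl, ← a22 v hv, ← f₂ 22 (by decide)]; rfl
      · exact b20
      · rw [t4]
        exact sum_congr rfl fun v hv => (b20 v (mem_range.1 hv)).symm
  · rintro r' m' ⟨⟨hb, ⟨A₁, h3, hl⟩, h25, h26, hr, h4⟩, f, g⟩
    have hP : mnet n m' = mnet n m := by
      simp only [mnet, f 10 (by decide), f 11 (by decide), f 12 (by decide), f 13 (by decide),
        f 14 (by decide), f 15 (by decide)]
    refine ⟨⟨A₁, hb, h.big, h3, hl, h25, h26, ?_, ?_⟩, hr, h4, f, g⟩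
    · rw [hP]; exact h.wf
    · rw [hP]; exact h.inv.round h.wf hr

end CutMatch

/-! ### Start of a phase and the loop of rounds -/

namespace CutMatch

open Finset ParRAM

/-- Compaction of a `0`-`1` vector gives the list of its support. -/
theorem Lists.of_pre {n : ℕ} {g L : ℕ → ℕ} (hg : ∀ i < n, g i ≤ 1)
    (hL : ∀ j < n, g j ≠ 0 → L (pre g j - 1) = j) : Lists n (∑ i ∈ range n, g i) L g := by
  refine ⟨fun i hi => ?_, fun i hi j hj e => ?_, fun v hv h0 => ?_⟩
  · obtain ⟨j, hj, hne, rfl⟩ := exists_pre_eq _ hg hi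
    rw [hL j hj hne]
    exact ⟨hj, Nat.pos_of_ne_zero hne⟩
  · obtain ⟨i', hi', hne, rfl⟩ := exists_pre_eq _ hg hi
    obtain ⟨j', hj', hne', rfl⟩ := exists_pre_eq _ hg hj
    rw [hL _ hi' hne, hL _ hj' hne'] at e
    rw [e]
  · have h1 := pre_le_total g hv
    have h2 := pre_pos h0.ne'
    exact ⟨pre g v - 1, by omega, hL v hv h0.ne'⟩

namespace Code

open Expr

/-- The state of a phase is initialized. -/
def start : Prog :=
  .seq (.map (reg 8) 17 (const 0)) <|
  .seq (.map (reg 8) 18 (const 0)) <|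
  .seq (.map (reg 1) 19 (const 0)) <|
  .seq (.map (reg 1) 20 (read 14 (reg 0))) <|
  .seq (.map (reg 1) 21 (const 0)) <|
  .seq (.map (reg 1) 22 (const 0)) <|
  .seq (.map (reg 1) 27 (read 14 (reg 0))) <|
  .seq (.assign 5 (reg 1)) <|
  .seq .scan <|
  .seq (.vec (reg 5) (read 14 (reg 0)) 23 (sub (read 27 (reg 0)) (const 1)) (reg 0)) <|
  .seq (.assign 3 (reg 7))
    (.assign 4 (reg 7))

/-- Rounds are executed until few units are waiting. -/
def rounds : Prog := .loop (lt (reg 9) (reg 4)) round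

end Code

set_option maxHeartbeats 4000000 in
open Code Expr in
theorem Tc.start {w B n A' L r m} (hf : Fits w B start) (hb : Bdd B r m)
    (hB : 32 * n + 2 ≤ B) (h1 : r 1 = n) (h8 : r 8 = 16 * n)
    (hwf : (mnet n m).WF) (h25 : ∀ p < 16 * n, m 25 p = 0) (h26 : ∀ p < 16 * n, m 26 p = 0)
    (hL : Nat.clog 2 (16 * n) + 2 ≤ L) (hA' : (16 * n + 1) * L ≤ A') :
    Tc w start r m A' L fun r' m' => (∃ A, Ready B n A r' m') ∧
      (mnet n m).Start (mflow m') ∧ r' 4 = ∑ v ∈ range n, (mflow m').b v ∧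
      (∀ a ∉ Code.start.arrays, m' a = m a) ∧ ∀ x ∉ Code.start.registers, r' x = r x := by
  have hL1 : 1 ≤ L := by omega
  have hA1 : 16 * n + 1 ≤ A' := by nlinarith
  have hA1' : 1 ≤ A' := by omega
  have hsrc : ∀ v < n, m 14 v ≤ 1 := hwf.src_le
  have hsum : ∑ v ∈ range n, m 14 v ≤ n := by
    calc _ ≤ ∑ v ∈ range n, 1 := sum_le_sum fun v hv => hsrc v (mem_range.1 hv)
      _ = _ := by simp
  have hclog : Nat.clog 2 n ≤ Nat.clog 2 (16 * n) := Nat.clog_mono_right 2 (by omega)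
  refine (Tc.frame (Q := fun r' m' => Bdd B r' m' ∧ Lists n (r' 3) (m' 23) (m 14) ∧
    (mnet n m).Start (mflow m') ∧ r' 4 = ∑ v ∈ range n, (mflow m').b v) ?_).post ?_
  · unfold Code.start
    refine Tc.seq ((Tr.map hf.left hb (16 * n) h8 (by omega) (by simp) (fun _ => 0)
      (fun _ _ => rfl) (fun _ _ => Nat.zero_le _)).toTc hA1 hL1) ?_
    rintro _ m₁ ⟨rfl, hb₁, a17, -, f₁⟩
    have hf := hf.right
    refine Tc.seq ((Tr.map hf.left hb₁ (16 * n) h8 (by omega) (by simp) (fun _ => 0)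
      (fun _ _ => rfl) (fun _ _ => Nat.zero_le _)).toTc hA1 hL1) ?_
    rintro _ m₂ ⟨rfl, hb₂, a18, -, f₂⟩
    have hf := hf.right
    refine Tc.seq ((Tr.map hf.left hb₂ n h1 (by omega) (by simp) (fun _ => 0)
      (fun _ _ => rfl) (fun _ _ => Nat.zero_le _)).toTc (by omega) hL1) ?_
    rintro _ m₃ ⟨rfl, hb₃, a19, -, f₃⟩
    have hf := hf.right
    refine Tc.seq ((Tr.map hf.left hb₃ n h1 (by omega) (by simp) (m 14)
      (fun i _ => by simp [f₃, f₂, f₁]) (fun i _ => hb.2 14 i)).toTc (by omega) hL1) ?_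
    rintro _ m₄ ⟨rfl, hb₄, a20, -, f₄⟩
    have hf := hf.right
    refine Tc.seq ((Tr.map hf.left hb₄ n h1 (by omega) (by simp) (fun _ => 0)
      (fun _ _ => rfl) (fun _ _ => Nat.zero_le _)).toTc (by omega) hL1) ?_
    rintro _ m₅ ⟨rfl, hb₅, a21, -, f₅⟩
    have hf := hf.right
    refine Tc.seq ((Tr.map hf.left hb₅ n h1 (by omega) (by simp) (fun _ => 0)
      (fun _ _ => rfl) (fun _ _ => Nat.zero_le _)).toTc (by omega) hL1) ?_
    rintro _ m₆ ⟨rfl, hb₆, a22, -, f₆⟩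
    have hf := hf.right
    refine Tc.seq ((Tr.map hf.left hb₆ n h1 (by omega) (by simp) (m 14)
      (fun i _ => by simp [f₆, f₅, f₄, f₃, f₂, f₁]) (fun i _ => hb.2 14 i)).toTc (by omega) hL1) ?_
    rintro _ m₇ ⟨rfl, hb₇, a27, -, f₇⟩
    have hf := hf.right
    refine Tc.seq ((Tr.assign hf.left hb₇ n (by simpa using h1) (by omega)).toTc₁ hA1' hL1) ?_
    rintro _ _ ⟨rfl, rfl, hb₈⟩
    have hf := hf.right
    refine Tc.seq (Tc.scan hf.left hb₈ n (by simp) (by omega) _ a27 (by omega) (A := A')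
      (L := L) (by omega) ((Nat.mul_le_mul_right _ (by omega)).trans hA')) ?_
    rintro r₉ m₉ ⟨hb₉, b27, t7, f₉, g₉⟩
    have hf := hf.right
    have e14 : m₉ 14 = m 14 := by
      rw [f₉ 14 (by decide) (by decide), f₇ 14 (by decide), f₆ 14 (by decide), f₅ 14 (by decide),
        f₄ 14 (by decide), f₃ 14 (by decide), f₂ 14 (by decide), f₁ 14 (by decide)]
    refine Tc.seq ((Tr.compact hf.left hb₉ n (by simp [g₉ 5 (by decide) (by decide)]) (by omega)
      (by decide) (by simp) (by simp) (m 14) (fun j => j) hsrc (fun j hj => by simp [e14])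
      b27 (fun j hj _ => by simp)
      (fun j hj => (by omega))).toTc (by omega) hL1) ?_
    rintro _ m₁₀ ⟨rfl, hb₁₀, f₁₀, a23, -⟩
    have hl := Lists.of_pre hsrc a23
    have hf := hf.right
    refine Tc.seq ((Tr.assign hf.left hb₁₀ _ t7 (by omega)).toTc₁ hA1' hL1) ?_
    rintro _ _ ⟨rfl, rfl, hb₁₁⟩
    refine ((Tr.assign hf.right hb₁₁ (∑ i ∈ range n, m 14 i) (by simp [t7]) (by omega)).toTc₁
      hA1' hL1).post ?_
    rintro _ m₁₂ ⟨rfl, rfl, hb₁₂⟩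
    have e20 : ∀ v < n, m₁₂ 20 v = m 14 v := by
      intro v hv
      rw [f₁₀ 20 (by decide), f₉ 20 (by decide) (by decide), f₇ 20 (by decide), f₆ 20 (by decide),
        f₅ 20 (by decide), a20 v hv]
    refine ⟨hb₁₂, by simpa using hl, ⟨?_, ?_, ?_, ?_, ?_, e20⟩, ?_⟩
    · intro p hp
      change m₁₂ 17 p = 0
      rw [f₁₀ 17 (by decide), f₉ 17 (by decide) (by decide), f₇ 17 (by decide), f₆ 17 (by decide), f₅ 17 (by decide), f₄ 17 (by decide), f₃ 17 (by decide), f₂ 17 (by decide), a17 p hp]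
    · intro p hp
      change m₁₂ 18 p = 0
      rw [f₁₀ 18 (by decide), f₉ 18 (by decide) (by decide), f₇ 18 (by decide), f₆ 18 (by decide), f₅ 18 (by decide), f₄ 18 (by decide), f₃ 18 (by decide), a18 p hp]
    · intro p hp
      change m₁₂ 19 p = 0
      rw [f₁₀ 19 (by decide), f₉ 19 (by decide) (by decide), f₇ 19 (by decide), f₆ 19 (by decide), f₅ 19 (by decide), f₄ 19 (by decide), a19 p hp]
    · intro p hp
      change m₁₂ 21 p = 0
      rw [f₁₀ 21 (by decide), f₉ 21 (by decide) (by decide), f₇ 21 (by decide), f₆ 21 (by decide), a21 p hp]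
    · intro p hp
      change m₁₂ 22 p = 0
      rw [f₁₀ 22 (by decide), f₉ 22 (by decide) (by decide), f₇ 22 (by decide), a22 p hp]
    · simp only [Function.update_self]
      exact sum_congr rfl fun v hv => (e20 v (mem_range.1 hv)).symm
  · rintro r' m' ⟨⟨hb', hl, hs, h4⟩, f, g⟩
    have hP : mnet n m' = mnet n m := by
      simp only [mnet, f 10 (by decide), f 11 (by decide), f 12 (by decide), f 13 (by decide),
        f 14 (by decide), f 15 (by decide)]
    refine ⟨⟨r' 3, hb', hB, rfl, hl.congr (fun _ _ => rfl) hs.b, ?_, ?_, ?_, ?_⟩, hs, h4, f, g⟩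
    · rw [f 25 (by decide)]; exact h25
    · rw [f 26 (by decide)]; exact h26
    · rw [hP]; exact hwf
    · rw [hP]; exact hs.inv hwf

-- A round with `U` waiting units lowers the potential by at least `U` and costs work proportional
-- to `(16 * A₁ + 1) * L ≤ 17 * L * U`, as `A₁ ≤ U`. While the loop runs, `U ≥ θ + 1`, so there are
-- at most `Pot / (θ + 1)` rounds.
set_option maxHeartbeats 1000000 in
open Code Expr in
theorem Tc.rounds {w B n A L θ r m} (hf : Fits w B rounds) (h : Ready B n A r m)
    (h9 : r 9 = θ) (h4 : r 4 = ∑ v ∈ range n, (mflow m).b v)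
    (hL : Nat.clog 2 (16 * n) + 2 ≤ L) :
    Tc w rounds r m (17 * L * (mnet n m).Pot (mflow m) + 1)
      (L * ((mnet n m).Pot (mflow m) / (θ + 1)) + 1)
      fun r' m' => (∃ A₁, Ready B n A₁ r' m') ∧ ∑ v ∈ range n, (mflow m').b v ≤ θ ∧
        (∀ a ∉ Code.round.arrays, m' a = m a) ∧ ∀ x ∉ Code.round.registers, r' x = r x := by
  obtain ⟨Z, hZ⟩ : ∃ Z, Z = Code.rounds.size := ⟨_, rfl⟩
  obtain ⟨Y, hY⟩ : ∃ Y, Y = Code.round.size := ⟨_, rfl⟩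
  have hZY : Z = Y + 4 := by simp only [hZ, hY, Code.rounds, Prog.size, Expr.size]; omega
  refine (Tc.frame (Q := fun r' m' => (∃ A₁, Ready B n A₁ r' m') ∧
    ∑ v ∈ range n, (mflow m').b v ≤ θ) ?_).post fun r' m' hh => ⟨hh.1.1, hh.1.2, hh.2.1, hh.2.2⟩
  refine (Tr.loop hf (fun r' m' W S => ∃ A₁, Ready B n A₁ r' m' ∧ r' 9 = θ ∧
    r' 4 = ∑ v ∈ range n, (mflow m').b v ∧ ∃ Φ, (mnet n m').Pot (mflow m') ≤ Φ ∧
    W = Z * (17 * L * Φ + 1) ∧ S = Z * (L * (Φ / (θ + 1)) + 1)) ?_ ?_ ?_ r m _ _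
    ⟨A, h, h9, h4, _, le_rfl, rfl, rfl⟩).mono (by rw [← hZ]) (by rw [← hZ]) ?_
  · rintro r' m' _ _ ⟨A₁, h, -⟩; exact h.bdd
  · rintro r' m' _ _ ⟨A₁, h, -, -, Φ, -, rfl, rfl⟩ _
    simp only [Expr.size]
    constructor <;> rw [mul_add] <;> omega
  · rintro r' m' _ _ ⟨A₁, h, h9', h4', Φ, hΦ, rfl, rfl⟩ hne
    have hlt : θ < ∑ v ∈ range n, (mflow m').b v := by
      simp only [Expr.val, h9', h4'] at hne
      by_contra hc; simp [hc] at hne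
    have hA₁ : A₁ ≤ ∑ v ∈ range n, (mflow m').b v := h.lists.le_sum
    have hA1 : 17 * L * (∑ v ∈ range n, (mflow m').b v) ≥ (16 * A₁ + 1) * L := by
      have : 16 * A₁ + 1 ≤ 17 * ∑ v ∈ range n, (mflow m').b v := by omega
      nlinarith
    have hround := Tc.round (A' := 17 * L * (∑ v ∈ range n, (mflow m').b v)) hf.body h hL hA1
    set U := ∑ v ∈ range n, (mflow m').b v with hU
    have hP' : ∀ m₁, ((mnet n m').Round (mflow m') (mflow m₁) ∧
        ∀ a ∉ Code.round.arrays, m₁ a = m' a) →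
        (mnet n m₁).Pot (mflow m₁) + U ≤ (mnet n m').Pot (mflow m') := by
      rintro m₁ ⟨h1, f⟩
      have hP : mnet n m₁ = mnet n m' := by
        simp only [mnet, f 10 (by decide), f 11 (by decide), f 12 (by decide), f 13 (by decide),
          f 14 (by decide), f 15 (by decide)]
      rw [hP]
      exact Net.Pot_round h.wf h.inv h1
    have hUΦ : U ≤ Φ := by
      refine le_trans ?_ hΦ
      simp only [hU, Net.Pot]; exact Nat.le_add_left _ _
    refine ⟨Y * (17 * L * U), Y * L, Z * (17 * L * (Φ - U) + 1),
      Z * (L * ((Φ - U) / (θ + 1)) + 1), ?_, ?_, ?_⟩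
    · obtain ⟨k, hk⟩ := Nat.exists_eq_add_of_le hUΦ
      rw [hk, Nat.add_sub_cancel_left, hZY]
      simp only [Expr.size]
      have : 1 ≤ L * U := Nat.mul_pos (by omega) (by omega)
      nlinarith
    · have h1 : (Φ - U) / (θ + 1) + 1 ≤ Φ / (θ + 1) := by
        rw [← Nat.add_div_right _ (by omega)]
        exact Nat.div_le_div_right (by omega)
      simp only [Expr.size]
      have h2 : L * ((Φ - U) / (θ + 1)) + L ≤ L * (Φ / (θ + 1)) := by nlinarith
      have h3 : Z * (L * ((Φ - U) / (θ + 1)) + L) ≤ Z * (L * (Φ / (θ + 1))) :=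
        Nat.mul_le_mul_left _ h2
      rw [hZY] at h3 ⊢
      nlinarith
    · rw [hY]
      refine hround.mono le_rfl le_rfl ?_
      rintro r₁ m₁ ⟨⟨A₂, h₂⟩, hr, h4₁, f, g⟩
      have hpot := hP' m₁ ⟨hr, f⟩
      exact ⟨A₂, h₂, by rw [g 9 (by decide), h9'], h4₁, _, by omega, rfl, rfl⟩
  · rintro r' m' ⟨⟨_, _, A₁, h, h9', h4', -⟩, h0⟩
    refine ⟨⟨A₁, h⟩, ?_⟩
    simp only [Expr.val, h9', h4'] at h0
    by_contra hc
    simp [show θ < ∑ v ∈ range n, (mflow m').b v by omega] at h0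

end CutMatch

/-! ### Tracing the paths of the units in parallel -/

namespace CutMatch

open Finset ParRAM

theorem _root_.ParRAM.Tc.forTo {w B x} {N : Expr} {c : Prog} (hf : Fits w B (.forTo x N c)) (n : ℕ)
    (hn : n ≤ B) (Inv : ℕ → Regs → Mem → Prop) (A L : ℕ)
    (hbd : ∀ i r m, Inv i r m → Bdd B r m)
    (hreg : ∀ i r m, Inv i r m → r x = i)
    (hN : ∀ i r m, Inv i r m → N.val r m = n)
    (hstep : ∀ i r m, i < n → Inv i r m → Tc w c r m A L fun r' m' =>
      r' x = i ∧ Bdd B r' m' ∧ Inv (i + 1) (Function.update r' x (i + 1)) m')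
    (r : Regs) (m : Mem) (hb : Bdd B r m) (h0 : Inv 0 (Function.update r x 0) m) {A' L' : ℕ}
    (hA : (n + 1) * (A + 1) ≤ A') (hL : (n + 1) * (L + 1) ≤ L') :
    Tc w (.forTo x N c) r m A' L' fun r' m' => Inv n r' m' := by
  have hc : c.size ≤ (Prog.forTo x N c).size := by rw [Prog.size_forTo]; omega
  have key : ∀ A, (n + 1) * (c.size * A + (Prog.forTo x N c).size) ≤
      (Prog.forTo x N c).size * ((n + 1) * (A + 1)) := by
    intro A
    have := Nat.mul_le_mul_right A hc
    calc _ ≤ (n + 1) * ((Prog.forTo x N c).size * A + (Prog.forTo x N c).size) :=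
          Nat.mul_le_mul_left _ (by omega)
      _ = _ := by ring
  refine (Tr.forTo hf n hn Inv _ _ hbd hreg hN hstep r m hb h0).mono
    ((key A).trans (Nat.mul_le_mul_left _ hA)) ((key L).trans (Nat.mul_le_mul_left _ hL))
    fun _ _ h => h

namespace Net

variable {P : Net} {s : Flow}

theorem Moves.of_lt {v t u : ℕ} (h : P.Moves s v t) (hu : u ≤ t) : P.Moves s v u := by
  by_contra hc
  have h1 : ∀ k, P.pos s v (u + k) = P.pos s v u := by
    intro k
    induction k with
    | zero => rfl
    | succ k ih =>
      rw [← add_assoc, pos_succ_of_not, ih]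
      rwa [Moves, ih]
  obtain ⟨k, rfl⟩ := Nat.exists_eq_add_of_le hu
  rw [Moves, h1] at h
  exact hc h

/-- `T` is the number of steps that the unit starting at `v` makes within the first `t`. -/
def Steps (P : Net) (s : Flow) (v t T : ℕ) : Prop :=
  T ≤ t ∧ (∀ u < T, P.Moves s v u) ∧ (T < t → ¬ P.Moves s v T)

theorem Steps.zero (v : ℕ) : P.Steps s v 0 0 := ⟨le_rfl, by simp, by simp⟩

theorem Steps.eq_of_moves {v t T : ℕ} (h : P.Steps s v t T) (hm : P.Moves s v t) : T = t := by
  by_contra hc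
  have := h.1
  exact h.2.2 (by omega) (hm.of_lt h.1)

theorem Steps.succ_of_moves {v t T : ℕ} (h : P.Steps s v t T) (hm : P.Moves s v t) :
    P.Steps s v (t + 1) (T + 1) := by
  obtain rfl := h.eq_of_moves hm
  refine ⟨le_rfl, fun u hu => ?_, fun h => absurd h (lt_irrefl _)⟩
  exact hm.of_lt (by omega)

theorem Steps.succ_of_not {v t T : ℕ} (h : P.Steps s v t T) (hm : ¬ P.Moves s v t) :
    P.Steps s v (t + 1) T := by
  refine ⟨h.1.trans (Nat.le_succ t), h.2.1, fun _ => ?_⟩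
  rcases h.1.lt_or_eq with h1 | h1
  · exact h.2.2 h1
  · rwa [h1]

/-- A unit makes at most `h v` steps, so after more than that many rounds of tracing it has come to
rest. -/
theorem Steps.len (hP : P.WF) (hi : P.Inv s) {v t T : ℕ} (h : P.Steps s v t T) (hv : v < P.n)
    (hs : 0 < P.sent s v) (ht : P.h v < t) : P.Len s v T := by
  obtain ⟨T', hT', hl⟩ := exists_len hP hi hv hs
  refine ⟨h.2.1, ?_⟩
  rcases h.1.lt_or_eq with h1 | h1
  · exact h.2.2 h1
  · exact absurd (h.2.1 T' (by omega)) hl.2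

end Net

namespace Code

open Expr

/-- Whether a unit is sent from vertex `v` and not returned. -/
def sent (v : Expr) : Expr := sub (read 14 v) (read 22 v)

def lo (x k : Expr) : Expr := add (read 21 x) (psum (read 33) x k)

def li (x k : Expr) : Expr := add (sent x) (psum (fun p => read 33 (read 10 p)) x k)

def pick (x i : Expr) : Expr :=
  sum (fun k => mul (mul (lt i (add (lo x (const k)) (read 33 (slot x (const k)))))
    (sub (const 1) (lt i (lo x (const k))))) (add (slot x (const k)) (const 1))) 16

def arr (p i : Expr) : Expr :=
  add (li (tgt p) (mod (read 10 p) (const 16))) (sub i (lo (own p) (mod p (const 16))))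

/-- The dart along which the unit traced by a thread leaves. -/
def nxt : Expr := sub (read 34 (reg 0)) (const 1)

/-- All units are moved by one step; their paths are recorded in array `9`, with stride in register
`16`, and the lengths of the paths in array `35`. -/
def step : Prog :=
  .seq (.map (reg 1) 34 (mul (sent (reg 0)) (pick (read 31 (reg 0)) (read 32 (reg 0))))) <|
  .seq (.vec (reg 1) (read 34 (reg 0)) 32 (reg 0) (arr nxt (read 32 (reg 0)))) <|
  .seq (.vec (reg 1) (read 34 (reg 0)) 31 (reg 0) (tgt nxt)) <|
  .seq (.vec (reg 1) (read 34 (reg 0)) 35 (reg 0) (add (read 35 (reg 0)) (const 1)))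
    (.vec (reg 1) (read 34 (reg 0)) 9 (add (mul (reg 0) (reg 16)) (read 35 (reg 0)))
      (read 31 (reg 0)))

/-- The units of a phase are traced. -/
def trace : Prog :=
  .seq (.map (reg 8) 33 (sub (read 17 (reg 0)) (read 18 (read 10 (reg 0))))) <|
  .seq (.map (reg 1) 31 (reg 0)) <|
  .seq (.map (reg 1) 32 (const 0))
    (.forTo 12 (reg 13) step)

variable {r : Regs} {m : Mem} {P : Net} {s : Flow}

theorem val_lo (hs : mflow m = s) (h33 : ∀ p < 16 * P.n, m 33 p = P.nf s p)
    {x k : Expr} (hx : x.val r m < P.n) (hk : k.val r m ≤ 16) :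
    (lo x k).val r m = P.lo s (x.val r m) (k.val r m) := by
  simp only [lo, Expr.val, Net.lo]
  rw [val_psum (g := m 33) _ _ hk (fun p => rfl), ← hs]
  congr 1
  refine sum_congr rfl fun j hj => ?_
  rw [mem_range] at hj
  rw [h33 _ (by omega), hs]

theorem val_li (hwf : P.WF) (hP : mnet P.n m = P) (hs : mflow m = s)
    (h33 : ∀ p < 16 * P.n, m 33 p = P.nf s p)
    {x k : Expr} (hx : x.val r m < P.n) (hk : k.val r m ≤ 16) :
    (li x k).val r m = P.li s (x.val r m) (k.val r m) := by
  simp only [li, sent, Expr.val, Net.li, Net.sent]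
  rw [val_psum (g := fun p => m 33 (m 10 p)) _ _ hk (fun p => rfl)]
  have h10 : m 10 = P.rv := by rw [← hP]; rfl
  have h14 : m 14 = P.src := by rw [← hP]; rfl
  have h22 : m 22 = s.fl := by rw [← hs]; rfl
  rw [h10, h14, h22]
  congr 1
  refine sum_congr rfl fun j hj => ?_
  rw [mem_range] at hj
  exact h33 _ (hwf.rv_lt _ (by omega))

theorem val_pick (hs : mflow m = s)
    (h33 : ∀ p < 16 * P.n, m 33 p = P.nf s p) {x i : Expr} (hx : x.val r m < P.n) :
    (pick x i).val r m = P.pick s (x.val r m) (i.val r m) := by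
  simp only [pick, val_sum, Net.pick]
  refine sum_congr rfl fun k hk => ?_
  rw [mem_range] at hk
  have e1 := val_lo hs h33 hx (k := const k) (by simp only [Expr.val]; omega)
  have e2 := h33 (16 * x.val r m + k) (by omega)
  simp only [Expr.val, val_slot] at e1 ⊢
  simp only [e1, e2]

theorem val_arr (hwf : P.WF) (hP : mnet P.n m = P) (hs : mflow m = s)
    (h33 : ∀ p < 16 * P.n, m 33 p = P.nf s p)
    {p i : Expr} (hp : p.val r m < 16 * P.n) :
    (arr p i).val r m = P.arr s (p.val r m) (i.val r m) := by
  have h10 : m 10 = P.rv := by rw [← hP]; rfl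
  have hq := hwf.rv_lt _ hp
  simp only [arr, Expr.val, Net.arr]
  rw [val_li hwf hP hs h33 (by simp only [val_tgt, h10]; omega) (by simp only [Expr.val]; omega),
    val_lo hs h33 (by simp only [val_own]; omega) (by simp only [Expr.val]; omega)]
  simp only [val_tgt, val_own, Expr.val, h10]

end Code

/-- The state of the tracing of a phase after `t` steps. -/
structure Traced (P : Net) (s : Flow) (σ : ℕ) (m₀ m : Mem) (t : ℕ) : Prop where
  nf : ∀ p < 16 * P.n, m 33 p = P.nf s p
  frame : ∀ a < 23, a ≠ 9 → m a = m₀ a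
  vertex : ∀ v < P.n, 0 < P.sent s v → m 31 v = (P.pos s v t).1
  number : ∀ v < P.n, 0 < P.sent s v → m 32 v = (P.pos s v t).2
  steps : ∀ v < P.n, 0 < P.sent s v → P.Steps s v t (m 35 v)
  path : ∀ v < P.n, 0 < P.sent s v → ∀ k ≤ m 35 v, m 9 (v * σ + k) = (P.pos s v k).1
  len_idle : ∀ v < P.n, P.sent s v = 0 → m 35 v = m₀ 35 v
  path_idle : ∀ v < P.n, P.sent s v = 0 → ∀ k < σ, m 9 (v * σ + k) = m₀ 9 (v * σ + k)

theorem row_div {σ v k : ℕ} (hk : k < σ) : (v * σ + k) / σ = v := by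
  rw [Nat.add_comm, Nat.add_mul_div_right _ _ (by omega), Nat.div_eq_of_lt hk, Nat.zero_add]

theorem row_mod {σ v k : ℕ} (hk : k < σ) : (v * σ + k) % σ = k := by
  rw [Nat.add_comm, Nat.add_mul_mod_self_right, Nat.mod_eq_of_lt hk]

-- The thread of `v` writes only row `v` of array `9`. Row length `σ` exceeds the number of steps,
-- so rows do not overlap and quotient and remainder by `σ` recover the vertex and the position on
-- its path.
set_option maxHeartbeats 4000000 in
open Code Expr in
theorem Tc.step {w B σ t r m m₀} {P : Net} {s : Flow} (hf : Fits w B step) (hb : Bdd B r m)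
    (hwf : P.WF) (hinv : P.Inv s) (h1 : r 1 = P.n) (h16 : r 16 = σ) (ht : t + 1 < σ)
    (hσ : σ ≤ B) (hB : 32 * P.n + 2 ≤ B) (hz : ∀ p < 16 * P.n, 16 * P.z p + 1 ≤ B)
    (hP : mnet P.n m₀ = P) (hs : mflow m₀ = s) (h : Traced P s σ m₀ m t) :
    Tc w step r m (P.n + 1) 1 fun r' m' => r' = r ∧ Bdd B r' m' ∧ Traced P s σ m₀ m' (t + 1) := by
  have hPm : ∀ m' : Mem, (∀ a < 23, a ≠ 9 → m' a = m₀ a) → mnet P.n m' = P := fun m' f => by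
    rw [← hP]
    simp [mnet, f]
  have hsm : ∀ m' : Mem, (∀ a < 23, a ≠ 9 → m' a = m₀ a) → mflow m' = s := fun m' f => by
    rw [← hs]
    simp [mflow, f]
  have hpick : ∀ v < P.n, 0 < P.sent s v → P.pick s (P.pos s v t).1 (P.pos s v t).2 ≤ 16 * P.n := by
    intro v hv hsv
    by_cases hm : P.Moves s v t
    · have := (Net.hit_of_pick hm).lt_n (Net.pos_lt hwf hv hsv t).1
      omega
    · rw [not_not.1 hm]; omega
  -- Unit numbers are bounded by one own unit plus the capacities of `16` incoming darts, hence by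
  -- `B`.
  have htot : ∀ x < P.n, P.tot s x ≤ B := by
    intro x hx
    have h2 : ∀ k ∈ range 16, P.nf s (P.rv (16 * x + k)) ≤ (B - 1) / 16 := by
      intro k hk
      have hp := hwf.rv_lt _ (Net.dart_lt hx (mem_range.1 hk))
      have := hz _ hp
      have := hinv.nf_le_z hp
      omega
    have h3 := sum_le_sum h2
    have h4 := hwf.src_le x hx
    simp only [sum_const, card_range, smul_eq_mul] at h3
    simp only [Net.tot, Net.li, Net.sent]
    omega
  set pk : ℕ → ℕ := fun v => P.sent s v * P.pick s (P.pos s v t).1 (P.pos s v t).2 with hpk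
  have hs1 : ∀ v < P.n, P.sent s v ≤ 1 := fun v hv => (Nat.sub_le _ _).trans (hwf.src_le v hv)
  have hpk0 : ∀ v, pk v ≠ 0 ↔ 0 < P.sent s v ∧ P.Moves s v t := by
    intro v; simp only [hpk, Net.Moves, mul_ne_zero_iff]; omega
  have hpkm : ∀ v < P.n, 0 < P.sent s v → pk v = P.pick s (P.pos s v t).1 (P.pos s v t).2 := by
    intro v hv hsv
    have := hs1 v hv
    simp only [hpk, show P.sent s v = 1 by omega, one_mul]
  have hnext : ∀ v, 0 < P.sent s v → P.Moves s v t → v < P.n → pk v - 1 < 16 * P.n ∧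
      P.pos s v (t + 1) = (P.rv (pk v - 1) / 16, P.arr s (pk v - 1) (P.pos s v t).2) := by
    intro v hsv hm hv
    rw [hpkm v hv hsv]
    refine ⟨(Net.hit_of_pick hm).lt_n (Net.pos_lt hwf hv hsv t).1, ?_⟩
    rw [Net.pos_succ, Net.adv, if_neg hm]
  have esent : ∀ v, m 14 v - m 22 v = P.sent s v := by
    intro v
    rw [h.frame 14 (by decide) (by decide), h.frame 22 (by decide) (by decide), ← hP, ← hs]; rfl
  unfold Code.step
  refine Tc.seq ((Tr.map hf.left hb P.n h1 (by omega) ?_ pk ?_ ?_).toTc le_rfl le_rfl) ?_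
  · simp [sent, pick, lo, psum, slot]
  · intro v hv
    simp only [Expr.val, sent, Function.update_self, esent, hpk]
    rcases Nat.eq_zero_or_pos (P.sent s v) with h0 | h0
    · simp [h0]
    · rw [val_pick (hsm m h.frame) h.nf (by
        simp only [Expr.val, Function.update_self, h.vertex v hv h0]
        exact (Net.pos_lt hwf hv h0 t).1)]
      simp only [Expr.val, Function.update_self, h.vertex v hv h0, h.number v hv h0]
  · intro v hv
    rcases Nat.eq_zero_or_pos (P.sent s v) with h0 | h0
    · simp [hpk, h0]
    · rw [hpkm v hv h0]; have := hpick v hv h0; omega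
  rintro _ m₁ ⟨rfl, hb₁, a34, -, f₁⟩
  have hf := hf.right
  refine Tc.seq ((Tr.mapIf hf.left hb₁ P.n h1 (by omega) (by simp) ?_
    (fun v => 0 < P.sent s v ∧ P.Moves s v t) (fun v => (P.pos s v (t + 1)).2) ?_ ?_ ?_).toTc
    le_rfl le_rfl) ?_
  · simp [arr, nxt, sent, li, tgt, own, lo, psum, slot]
  · intro v hv
    simp only [Expr.val, Function.update_self, a34 v hv]
    exact hpk0 v
  · rintro v hv ⟨h0, hm⟩
    have hn := hnext v h0 hm hv
    rw [val_arr hwf (hPm m₁ fun a h1 h2 => by rw [f₁ a (by omega), h.frame a h1 h2])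
      (hsm m₁ fun a h1 h2 => by rw [f₁ a (by omega), h.frame a h1 h2])
      (by rw [f₁ 33 (by decide)]; exact h.nf)]
    · simp only [nxt, Expr.val, Function.update_self, a34 v hv, f₁ 32 (by decide),
        h.number v hv h0]
      rw [hn.2]
    · simp only [nxt, Expr.val, Function.update_self, a34 v hv]
      exact hn.1
  · rintro v hv ⟨h0, hm⟩
    have := Net.pos_lt hwf hv h0 (t + 1)
    exact this.2.le.trans (htot _ this.1)
  rintro _ m₂ ⟨rfl, hb₂, a32, b32, f₂⟩
  have hf := hf.right
  have c34 : ∀ v < P.n, m₂ 34 v = pk v := fun v hv => by rw [f₂ 34 (by decide), a34 v hv]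
  refine Tc.seq ((Tr.mapIf hf.left hb₂ P.n h1 (by omega) (by simp) ?_
    (fun v => 0 < P.sent s v ∧ P.Moves s v t) (fun v => (P.pos s v (t + 1)).1) ?_ ?_ ?_).toTc
    le_rfl le_rfl) ?_
  · simp [nxt, tgt, own]
  · intro v hv
    simp only [Expr.val, Function.update_self, c34 v hv]
    exact hpk0 v
  · rintro v hv ⟨h0, hm⟩
    have hn := hnext v h0 hm hv
    simp only [nxt, val_tgt, Expr.val, Function.update_self, c34 v hv]
    rw [f₂ 10 (by decide), f₁ 10 (by decide), h.frame 10 (by decide) (by decide), hn.2, ← hP]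
    rfl
  · rintro v hv ⟨h0, hm⟩
    have := (Net.pos_lt hwf hv h0 (t + 1)).1
    omega
  rintro _ m₃ ⟨rfl, hb₃, a31, b31, f₃⟩
  have hf := hf.right
  have d34 : ∀ v < P.n, m₃ 34 v = pk v := fun v hv => by rw [f₃ 34 (by decide), c34 v hv]
  have e35 : m₃ 35 = m 35 := by rw [f₃ 35 (by decide), f₂ 35 (by decide), f₁ 35 (by decide)]
  refine Tc.seq ((Tr.mapIf hf.left hb₃ P.n h1 (by omega) (by simp) ?_
    (fun v => 0 < P.sent s v ∧ P.Moves s v t) (fun v => t + 1) ?_ ?_ ?_).toTc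
    le_rfl le_rfl) ?_
  · simp
  · intro v hv
    simp only [Expr.val, Function.update_self, d34 v hv]
    exact hpk0 v
  · rintro v hv ⟨h0, hm⟩
    simp only [Expr.val, Function.update_self, e35, (h.steps v hv h0).eq_of_moves hm]
  · rintro v hv -; omega
  rintro _ m₄ ⟨rfl, hb₄, a35, b35, f₄⟩
  have hf := hf
  have g34 : ∀ v < P.n, m₄ 34 v = pk v := fun v hv => by rw [f₄ 34 (by decide), d34 v hv]
  have e9 : m₄ 9 = m 9 := by
    rw [f₄ 9 (by decide), f₃ 9 (by decide), f₂ 9 (by decide), f₁ 9 (by decide)]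
  -- Array `35` has already been incremented, so the new vertex goes to column `t + 1` of its row.
  refine ((Tr.sweep hf.right hb₄ P.n h1 (by omega) (by simp) (by simp) (by simp)
    (fun k => k / σ < P.n ∧ k % σ = t + 1 ∧ 0 < P.sent s (k / σ) ∧ P.Moves s (k / σ) t)
    (fun k => (P.pos s (k / σ) (t + 1)).1) ?_ ?_ ?_ ?_).toTc le_rfl le_rfl).post ?_
  · intro v hv hne
    simp only [Expr.val, Function.update_self, g34 v hv] at hne
    have hh := (hpk0 v).1 hne
    simp only [Expr.val, Function.update_self, ne_eq, OfNat.ofNat_ne_zero, not_false_eq_true,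
      Function.update_of_ne, h16, a35 v ⟨hv, hh⟩, row_div ht, row_mod ht, true_and]
    exact ⟨⟨hv, hh⟩, by rw [f₄ 31 (by decide), a31 v ⟨hv, hh⟩]⟩
  · rintro k ⟨hk, hk', hh⟩
    refine ⟨k / σ, hk, ?_, ?_⟩
    · simp only [Expr.val, Function.update_self, g34 _ hk]
      exact (hpk0 _).2 hh
    · simp only [Expr.val, Function.update_self, ne_eq, OfNat.ofNat_ne_zero, not_false_eq_true,
        Function.update_of_ne, h16, a35 _ ⟨hk, hh⟩]
      rw [← hk', mul_comm, Nat.div_add_mod]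
  · intro i hi j hj h1 h2 e
    simp only [Expr.val, Function.update_self, g34 _ hi] at h1
    simp only [Expr.val, Function.update_self, g34 _ hj] at h2
    simp only [Expr.val, Function.update_self, ne_eq, OfNat.ofNat_ne_zero, not_false_eq_true,
        Function.update_of_ne, h16, a35 _ ⟨hi, (hpk0 i).1 h1⟩, a35 _ ⟨hj, (hpk0 j).1 h2⟩] at e
    exact Nat.eq_of_mul_eq_mul_right (show 0 < σ by omega) (by omega)
  · rintro k ⟨hk, -, hh, -⟩
    have := (Net.pos_lt hwf hk hh (t + 1)).1
    omega
  rintro _ m₅ ⟨rfl, hb₅, a9, b9, f₅⟩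
  beta_reduce at a9 b9
  have move : ∀ v < P.n, 0 < P.sent s v → P.Moves s v t → m₅ 31 v = (P.pos s v (t + 1)).1 ∧
      m₅ 32 v = (P.pos s v (t + 1)).2 ∧ m₅ 35 v = t + 1 := by
    intro v hv h0 hm
    refine ⟨?_, ?_, ?_⟩
    · rw [f₅ 31 (by decide), f₄ 31 (by decide), a31 v ⟨hv, h0, hm⟩]
    · rw [f₅ 32 (by decide), f₄ 32 (by decide), f₃ 32 (by decide), a32 v ⟨hv, h0, hm⟩]
    · rw [f₅ 35 (by decide), a35 v ⟨hv, h0, hm⟩]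
  have stay : ∀ v < P.n, ¬ (0 < P.sent s v ∧ P.Moves s v t) → m₅ 31 v = m 31 v ∧
      m₅ 32 v = m 32 v ∧ m₅ 35 v = m 35 v := by
    intro v hv hh
    refine ⟨?_, ?_, ?_⟩
    · rw [f₅ 31 (by decide), f₄ 31 (by decide), b31 v fun h => hh h.2, f₂ 31 (by decide),
        f₁ 31 (by decide)]
    · rw [f₅ 32 (by decide), f₄ 32 (by decide), f₃ 32 (by decide), b32 v fun h => hh h.2,
        f₁ 32 (by decide)]
    · rw [f₅ 35 (by decide), b35 v fun h => hh h.2, e35]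
  refine ⟨rfl, hb₅, ?_, ?_, ?_, ?_, ?_, ?_, ?_, ?_⟩
  · rw [f₅ 33 (by decide), f₄ 33 (by decide), f₃ 33 (by decide), f₂ 33 (by decide),
      f₁ 33 (by decide)]
    exact h.nf
  · intro a ha ha9
    rw [f₅ a (by omega), f₄ a (by omega), f₃ a (by omega), f₂ a (by omega),
      f₁ a (by omega)]
    exact h.frame a ha ha9
  · intro v hv h0
    by_cases hm : P.Moves s v t
    · exact (move v hv h0 hm).1
    · rw [(stay v hv fun h => hm h.2).1, Net.pos_succ_of_not hm, h.vertex v hv h0]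
  · intro v hv h0
    by_cases hm : P.Moves s v t
    · exact (move v hv h0 hm).2.1
    · rw [(stay v hv fun h => hm h.2).2.1, Net.pos_succ_of_not hm, h.number v hv h0]
  · intro v hv h0
    by_cases hm : P.Moves s v t
    · rw [(move v hv h0 hm).2.2]
      have := (h.steps v hv h0).succ_of_moves hm
      rwa [(h.steps v hv h0).eq_of_moves hm] at this
    · rw [(stay v hv fun h => hm h.2).2.2]
      exact (h.steps v hv h0).succ_of_not hm
  · intro v hv h0 k hk
    by_cases hm : P.Moves s v t
    · rw [(move v hv h0 hm).2.2] at hk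
      by_cases hkt : k = t + 1
      · subst hkt
        rw [a9 (v * σ + (t + 1)) ⟨by rwa [row_div ht], by rw [row_mod ht], by rwa [row_div ht],
          by rwa [row_div ht]⟩, row_div ht]
      · rw [b9 _ fun hh => hkt (by have := hh.2.1; rwa [row_mod (by omega)] at this), e9]
        exact h.path v hv h0 k (by rw [(h.steps v hv h0).eq_of_moves hm]; omega)
    · rw [(stay v hv fun h => hm h.2).2.2] at hk
      have := (h.steps v hv h0).1
      rw [b9 _ fun hh => absurd hh.2.1 (by rw [row_mod (by omega)]; omega), e9]
      exact h.path v hv h0 k hk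
  · intro v hv h0
    rw [(stay v hv fun h => by omega).2.2]
    exact h.len_idle v hv h0
  · intro v hv h0 k hk
    rw [b9 _ fun hh => absurd hh.2.2.1 (by rw [row_div hk, h0]; omega), e9]
    exact h.path_idle v hv h0 k hk

/-- The paths of the units of a phase. -/
structure Routed (P : Net) (s : Flow) (σ : ℕ) (m₀ m : Mem) : Prop where
  nf : ∀ p < 16 * P.n, m 33 p = P.nf s p
  len : ∀ v < P.n, 0 < P.sent s v → P.Len s v (m 35 v)
  vertex : ∀ v < P.n, 0 < P.sent s v → m 31 v = (P.pos s v (m 35 v)).1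
  number : ∀ v < P.n, 0 < P.sent s v → m 32 v = (P.pos s v (m 35 v)).2
  path : ∀ v < P.n, 0 < P.sent s v → ∀ k ≤ m 35 v, m 9 (v * σ + k) = (P.pos s v k).1
  len_idle : ∀ v < P.n, P.sent s v = 0 → m 35 v = m₀ 35 v
  path_idle : ∀ v < P.n, P.sent s v = 0 → ∀ k < σ, m 9 (v * σ + k) = m₀ 9 (v * σ + k)

set_option maxHeartbeats 1000000 in
open Code Expr in
theorem Tc.trace {w B σ A' L' r m} {P : Net} {s : Flow} (hf : Fits w B trace) (hb : Bdd B r m)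
    (hwf : P.WF) (hinv : P.Inv s) (h1 : r 1 = P.n) (h8 : r 8 = 16 * P.n) (h16 : r 16 = σ + 1)
    (h13 : r 13 = σ)
    (hσ : σ + 1 ≤ B) (hB : 32 * P.n + 2 ≤ B) (hz : ∀ p < 16 * P.n, 16 * P.z p + 1 ≤ B)
    (hP : mnet P.n m = P) (hs : mflow m = s) (hh : ∀ v < P.n, P.h v < σ)
    (h35 : ∀ v < P.n, 0 < P.sent s v → m 35 v = 0)
    (h9 : ∀ v < P.n, 0 < P.sent s v → m 9 (v * (σ + 1)) = v)
    (hA : (σ + 1) * (16 * P.n + 2) ≤ A') (hL : 2 * (σ + 1) ≤ L') :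
    Tc w trace r m A' L' fun r' m' => (∀ x, x ≠ 12 → r' x = r x) ∧ Bdd B r' m' ∧
      (∀ a ∉ trace.arrays, m' a = m a) ∧ Routed P s (σ + 1) m m' := by
  have hA1 : 16 * P.n + 1 ≤ A' := by nlinarith
  refine (Tc.frame (Q := fun r' m' => Bdd B r' m' ∧ Routed P s (σ + 1) m m') ?_).post ?_
  · unfold Code.trace
    refine Tc.seq ((Tr.map hf.left hb (16 * P.n) h8 (by omega) (by simp) (P.nf s) ?_ ?_).toTc
      hA1 (by omega)) ?_
    · intro p hp
      have e17 : m 17 = s.F := by rw [← hs]; rfl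
      have e18 : m 18 = s.R := by rw [← hs]; rfl
      have e10 : m 10 = P.rv := by rw [← hP]; rfl
      simp only [Expr.val, Function.update_self, e17, e18, e10]; rfl
    · intro p hp
      have := hinv.nf_le_z hp
      have := hz p hp
      omega
    rintro _ m₁ ⟨rfl, hb₁, a33, -, f₁⟩
    have hf := hf.right
    refine Tc.seq ((Tr.map hf.left hb₁ P.n h1 (by omega) (by simp) (fun v => v)
      (fun v hv => by simp) (fun v hv => by omega)).toTc (by omega) (by omega)) ?_
    rintro _ m₂ ⟨rfl, hb₂, a31, -, f₂⟩
    have hf := hf.right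
    refine Tc.seq ((Tr.map hf.left hb₂ P.n h1 (by omega) (by simp) (fun v => 0)
      (fun v hv => by simp) (fun v hv => by omega)).toTc (by omega) (by omega)) ?_
    rintro r₃ m₃ ⟨rfl, hb₃, a32, -, f₃⟩
    have e35 : m₃ 35 = m 35 := by rw [f₃ 35 (by decide), f₂ 35 (by decide), f₁ 35 (by decide)]
    have e9 : m₃ 9 = m 9 := by rw [f₃ 9 (by decide), f₂ 9 (by decide), f₁ 9 (by decide)]
    refine (Tc.forTo hf.right σ (by omega) (fun t r' m' => r' = Function.update r₃ 12 t ∧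
      Bdd B r' m' ∧ Traced P s (σ + 1) m m' t) (P.n + 1) 1 ?_ ?_ ?_ ?_ r₃ m₃ hb₃ ?_
      ((Nat.mul_le_mul_left _ (by omega)).trans hA) (by omega)).post ?_
    · rintro t r' m' ⟨-, h, -⟩; exact h
    · rintro t r' m' ⟨rfl, -⟩; simp
    · rintro t r' m' ⟨rfl, -⟩; simpa using h13
    · rintro t r' m' ht ⟨rfl, hb', h⟩
      refine (Tc.step (hf.right.of_le (by rw [Prog.size_forTo]; omega)) hb' hwf hinv (by simpa using h1)
        (by simpa using h16) (by omega) hσ hB hz hP hs h).post ?_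
      rintro _ m₄ ⟨rfl, hb₄, h₄⟩
      refine ⟨by simp, hb₄, by simp, ?_, h₄⟩
      exact hb₄.update_reg (by omega)
    · refine ⟨rfl, hb₃.update_reg (by omega), ⟨?_, ?_, ?_, ?_, ?_, ?_, ?_, ?_⟩⟩
      · intro p hp; rw [f₃ 33 (by decide), f₂ 33 (by decide), a33 p hp]
      · intro a ha _; rw [f₃ a (by omega), f₂ a (by omega), f₁ a (by omega)]
      · intro v hv _; rw [f₃ 31 (by decide), a31 v hv]; rfl
      · intro v hv _; rw [a32 v hv]; rfl
      · intro v hv h0; rw [e35, h35 v hv h0]; exact Net.Steps.zero v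
      · intro v hv h0 k hk
        rw [e35, h35 v hv h0] at hk
        obtain rfl : k = 0 := by omega
        rw [e9, add_zero, h9 v hv h0]; rfl
      · intro v _ _; rw [e35]
      · intro v _ _ k _; rw [e9]
    · rintro r' m' ⟨-, hb', h⟩
      have hlen : ∀ v < P.n, 0 < P.sent s v → P.Len s v (m' 35 v) := fun v hv h0 =>
        (h.steps v hv h0).len hwf hinv hv h0 (hh v hv)
      refine ⟨hb', h.nf, hlen, ?_, ?_, h.path, h.len_idle, h.path_idle⟩
      · intro v hv h0
        rw [h.vertex v hv h0, (hlen v hv h0).stays (h.steps v hv h0).1]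
      · intro v hv h0
        rw [h.number v hv h0, (hlen v hv h0).stays (h.steps v hv h0).1]
  · rintro r' m' ⟨⟨hb', h⟩, f, g⟩
    refine ⟨fun x hx => g x ?_, hb', f, h⟩
    simp [Code.trace, Code.step, Prog.forTo, Prog.map, Prog.vec, Prog.registers, hx]

end CutMatch

/-! ### The record of the matching and the invariant across phases -/

namespace CutMatch

open Finset ParRAM

/-- The record of the matching: matched sources, and lengths and vertices of their paths. -/
structure Rec where
  mt : ℕ → ℕ
  len : ℕ → ℕ
  row : ℕ → ℕ → ℕ

namespace Rec

/-- The last vertex of the path of `v`. -/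
def fin (C : Rec) (v : ℕ) : ℕ := C.row v (C.len v)

end Rec

/-- `f 0, ..., f l` is a simple path. -/
structure Route (n : ℕ) (rv f : ℕ → ℕ) (l : ℕ) : Prop where
  lt : ∀ k ≤ l, f k < n
  dart : ∀ k < l, ∃ p < 16 * n, rv p ≠ p ∧ p / 16 = f k ∧ rv p / 16 = f (k + 1)
  inj : ∀ k ≤ l, ∀ k' ≤ l, f k = f k' → k = k'

/-- The path `f 0, ..., f l` uses the edge of dart `p` in one of the directions. -/
def Uses (rv f : ℕ → ℕ) (l p : ℕ) : Prop :=
  ∃ k < l, (f k = p / 16 ∧ f (k + 1) = rv p / 16) ∨ (f k = rv p / 16 ∧ f (k + 1) = p / 16)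

namespace Net

/-- The record after a phase. -/
structure Records (P : Net) (s : Flow) (σ : ℕ) (C C' : Rec) : Prop where
  mt_idle : ∀ v < P.n, P.sent s v = 0 → C'.mt v = C.mt v
  len_idle : ∀ v < P.n, P.sent s v = 0 → C'.len v = C.len v
  row_idle : ∀ v < P.n, P.sent s v = 0 → ∀ k ≤ σ, C'.row v k = C.row v k
  len : ∀ v < P.n, 0 < P.sent s v → P.Len s v (C'.len v)
  row : ∀ v < P.n, 0 < P.sent s v → ∀ k ≤ C'.len v, C'.row v k = (P.pos s v k).1
  mt : ∀ v < P.n, 0 < P.sent s v → C'.mt v = C.mt v +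
    if (P.pos s v (C'.len v)).2 < s.ab (P.pos s v (C'.len v)).1 then 1 else 0

open Classical in
/-- The invariant after `i` phases, for an execution that starts with the network `P₀` and the
matched vertices `mt₀`. -/
structure Good (P₀ : Net) (mt₀ : ℕ → ℕ) (c D θ i : ℕ) (P : Net) (C : Rec) : Prop where
  n : P.n = P₀.n
  rv : P.rv = P₀.rv
  wf : P.WF
  h_le : ∀ v < P.n, P.h v ≤ i
  src_h : ∀ v < P.n, P.src v ≠ 0 → P.h v = i
  z_le : ∀ p < 16 * P.n, P.z p ≤ c
  ell_le : ∀ p < 16 * P.n, P.ell p ≤ 2 * i + 1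
  src_le : ∀ v < P.n, P.src v ≤ P₀.src v
  fr_le : ∀ v < P.n, P.fr v ≤ P₀.fr v
  weight : ∑ p ∈ P.edges, (2 * c - P.z p) * P.ell p + 2 * D * ∑ v ∈ range P.n, P.src v ≤
    c * P.edges.card + 2 * D * ∑ v ∈ range P.n, P₀.src v
  mt_le : ∀ v < P.n, C.mt v ≤ 1
  fresh : ∀ v < P.n, P.src v ≠ 0 → C.mt v = 0 ∧ C.len v = 0 ∧ C.row v 0 = v
  len_le : ∀ v < P.n, C.mt v ≠ 0 → C.len v ≤ D
  first : ∀ v < P.n, C.mt v ≠ 0 → C.row v 0 = v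
  route : ∀ v < P.n, C.mt v ≠ 0 → Route P.n P.rv (C.row v) (C.len v)
  origin : ∀ v < P.n, C.mt v ≠ 0 → (mt₀ v ≠ 0 ∧ C.len v = 0) ∨
    (P₀.src v ≠ 0 ∧ P₀.fr (C.fin v) ≠ 0 ∧ P.fr (C.fin v) = 0)
  fin_inj : ∀ v < P.n, ∀ v' < P.n, C.mt v ≠ 0 → C.mt v' ≠ 0 → P₀.src v ≠ 0 → P₀.src v' ≠ 0 →
    C.fin v = C.fin v' → v = v'
  covered : ∀ x < P.n, P₀.fr x ≠ 0 → P.fr x = 0 →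
    ∃ v < P.n, C.mt v ≠ 0 ∧ P₀.src v ≠ 0 ∧ C.fin v = x
  mt₀ : ∀ v < P.n, mt₀ v ≠ 0 → C.mt v ≠ 0
  lost : ((range P.n).filter fun v => P₀.src v ≠ 0 ∧ P.src v = 0 ∧ C.mt v = 0).card ≤ i * θ
  load : ∀ p < 16 * P.n, P.rv p ≠ p → Load c (P.ell p) (P.z p)
    ((range P.n).filter fun v => C.mt v ≠ 0 ∧ Uses P.rv (C.row v) (C.len v) p).card

/-- Darts are determined by their ends. -/
def Simple (P : Net) : Prop := ∀ p < 16 * P.n, ∀ p' < 16 * P.n, P.rv p ≠ p → P.rv p' ≠ p' →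
  p / 16 = p' / 16 → P.rv p / 16 = P.rv p' / 16 → p = p'

variable {P : Net} {s : Flow}

theorem Moves.dart (hP : P.WF) (hi : P.Inv s) {v t : ℕ} (hv : v < P.n) (h0 : 0 < P.sent s v)
    (h : P.Moves s v t) : ∃ p < 16 * P.n, P.rv p ≠ p ∧ P.Hit s (P.pos s v t).1 (P.pos s v t).2 p ∧
      p / 16 = (P.pos s v t).1 ∧ P.rv p / 16 = (P.pos s v (t + 1)).1 := by
  obtain ⟨p, hp, e⟩ := h.hit
  have hx := (pos_lt hP hv h0 t).1
  have hpn := hp.lt_n hx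
  refine ⟨p, hpn, fun hc => ?_, hp, hp.1, by rw [e]⟩
  have := hp.adm hi hx
  rw [adm_null hP hpn hc] at this
  omega

/-- Vertices on a trace are distinct because heights drop strictly along it. -/
theorem Len.route (hP : P.WF) (hi : P.Inv s) {v T : ℕ} (hv : v < P.n) (h0 : 0 < P.sent s v)
    (h : P.Len s v T) {f : ℕ → ℕ} (hf : ∀ k ≤ T, f k = (P.pos s v k).1) :
    Route P.n P.rv f T := by
  refine ⟨fun k hk => ?_, fun k hk => ?_, ?_⟩
  · rw [hf k hk]; exact (pos_lt hP hv h0 k).1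
  · obtain ⟨p, h1, h2, -, h3, h4⟩ := (h.1 k hk).dart hP hi hv h0
    exact ⟨p, h1, h2, by rw [h3, hf k hk.le], by rw [h4, hf (k + 1) hk]⟩
  · have key : ∀ k ≤ T, ∀ k' ≤ T, f k = f k' → k ≤ k' → k = k' := by
      intro k hk k' hk' e hle
      have := height_add_le hP hi hv h0 h.1 hle hk'
      rw [hf k hk, hf k' hk'] at e
      rw [e] at this
      omega
    intro k hk k' hk' e
    rcases le_total k k' with hle | hle
    · exact key k hk k' hk' e hle
    · exact (key k' hk' k hk e.symm hle).symm

theorem sent_of_src {v : ℕ} (h : 0 < P.sent s v) : P.src v ≠ 0 := by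
  simp only [sent] at h; omega

/-- In a simple graph the ends of a traversed edge identify the dart, so the unit uses `p` or its
reversal. By `card_use` at most `nf` units use each of them. -/
theorem used_le_card (hP : P.WF) (hi : P.Inv s) (hsim : P.Simple) {f : ℕ → ℕ → ℕ} {l : ℕ → ℕ}
    (hl : ∀ v < P.n, 0 < P.sent s v → P.Len s v (l v))
    (hf : ∀ v < P.n, 0 < P.sent s v → ∀ k ≤ l v, f v k = (P.pos s v k).1) {p : ℕ}
    (hp : p < 16 * P.n) (hpr : P.rv p ≠ p) {N : Finset ℕ} (hN : ∀ v ∈ N, v < P.n ∧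
      0 < P.sent s v ∧ Uses P.rv (f v) (l v) p) : N.card ≤ P.used s p := by
  classical
  have hq := hP.rv_lt p hp
  have hqr : P.rv (P.rv p) ≠ P.rv p := fun h => hpr (by rw [hP.rv_rv p hp] at h; exact h.symm)
  have h1 := card_use (s := s) hP p
  have h2 := card_use (s := s) hP (P.rv p)
  refine (card_le_card (fun v hv => ?_)).trans ((card_union_le _ _).trans (add_le_add h1 h2))
  obtain ⟨hvn, h0, k, hk, h⟩ := hN v hv
  obtain ⟨p', hp', hpr', hit, e1, e2⟩ := ((hl v hvn h0).1 k hk).dart hP hi hvn h0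
  rw [hf v hvn h0 k hk.le, hf v hvn h0 (k + 1) hk, ← e1, ← e2] at h
  have hm : ∀ u ≤ k, P.Moves s v u := fun u hu => (hl v hvn h0).1 u (by omega)
  simp only [mem_union, mem_filter, mem_range]
  rcases h with ⟨h3, h4⟩ | ⟨h3, h4⟩
  · obtain rfl := hsim _ hp' _ hp hpr' hpr h3 h4
    exact Or.inl ⟨hvn, h0, k, hm, hit⟩
  · obtain rfl := hsim _ hp' _ hq hpr' hqr h3 (by rw [h4, hP.rv_rv p hp])
    exact Or.inr ⟨hvn, h0, k, hm, hit⟩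

-- Recorded paths are never touched again: a vertex that is already matched is not an active source,
-- so its unit is not sent. Every field splits into the old record, where `sent = 0`, and the units
-- sent in this phase.
set_option maxHeartbeats 1000000 in
theorem Good.next {P₀ P' : Net} {mt₀ : ℕ → ℕ} {c D θ i : ℕ} {C C' : Rec} (hc : 0 < c)
    (hg : Good P₀ mt₀ c D θ i P C) (hd : ∀ v < P.n, mt₀ v ≠ 0 → P₀.src v = 0) (hi : P.Inv s) (hsim : P₀.Simple) (hiD : i ≤ D)
    (hn : P.Next s c P') (hC : P.Records s D C C') (hθ : ∑ v ∈ range P.n, s.b v ≤ θ) :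
    Good P₀ mt₀ c D θ (i + 1) P' C' := by
  classical
  have hP := hg.wf
  have hsim' : P.Simple := by
    simp only [Simple, hg.n, hg.rv]; exact hsim
  have hsrc : ∀ v < P.n, P'.src v = s.fl v := hn.src
  have hsent : ∀ v < P.n, P.src v = P.sent s v + P'.src v := by
    intro v hv
    have := hi.fl_le v hv
    rw [hsrc v hv]; simp only [sent]; omega
  have hE : P'.edges = P.edges := by simp only [edges, hn.n, hn.rv]
  have hlen : ∀ v < P.n, 0 < P.sent s v → C'.len v ≤ D := by
    intro v hv h0
    obtain ⟨T, hT, h⟩ := exists_len hP hi hv h0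
    have := h.unique (hC.len v hv h0)
    have := hg.h_le v hv
    omega
  have hmt0 : ∀ v < P.n, 0 < P.sent s v → C.mt v = 0 := fun v hv h0 =>
    (hg.fresh v hv (sent_of_src h0)).1
  have hends : ∀ v < P.n, 0 < P.sent s v → C'.mt v ≠ 0 → P.Ends s v (C'.len v) (C'.fin v) := by
    intro v hv h0 h
    have h2 := hC.mt v hv h0
    rw [hmt0 v hv h0] at h2
    have e : C'.fin v = (P.pos s v (C'.len v)).1 := hC.row v hv h0 _ le_rfl
    refine ⟨hv, h0, hC.len v hv h0, e.symm, ?_⟩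
    rw [e]
    by_contra hcon
    rw [if_neg hcon] at h2; omega
  have hends' : ∀ v T x, P.Ends s v T x → C'.mt v ≠ 0 ∧ C'.fin v = x := by
    rintro v T x ⟨hv, h0, hl, hx, hab⟩
    have e := hl.unique (hC.len v hv h0)
    subst e
    have e : C'.fin v = (P.pos s v (C'.len v)).1 := hC.row v hv h0 _ le_rfl
    rw [e, hx]
    refine ⟨?_, rfl⟩
    rw [hC.mt v hv h0, hx, if_pos hab]; omega
  have hold : ∀ v < P.n, C.mt v ≠ 0 → P.sent s v = 0 := by
    intro v hv h
    by_contra h0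
    exact h (hmt0 v hv (Nat.pos_of_ne_zero h0))
  have hfin : ∀ v < P.n, P.sent s v = 0 → C.mt v ≠ 0 → C'.fin v = C.fin v := by
    intro v hv h0 hm
    simp only [Rec.fin]
    rw [hC.len_idle v hv h0, hC.row_idle v hv h0 _ (hg.len_le v hv hm)]
  have hfr : ∀ v < P.n, P'.fr v = P.fr v - s.ab v := hn.fr
  have hends_fr : ∀ v T x, P.Ends s v T x → x < P.n ∧ P.fr x = 1 ∧ s.ab x = 1 := by
    rintro v T x ⟨hv, h0, -, hx, hab⟩
    have hxn : x < P.n := hx ▸ (pos_lt hP hv h0 T).1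
    have := hi.ab_le x hxn
    have := hP.fr_le x hxn
    refine ⟨hxn, ?_, ?_⟩ <;> omega
  constructor
  · rw [hn.n, hg.n]
  · rw [hn.rv, hg.rv]
  · exact hn.wf hc hP hi
  · intro v hv
    rw [hn.n] at hv
    rw [hn.h v hv]
    exact Nat.add_le_add (hg.h_le v hv) (hi.dd_le v hv)
  -- A failed unit has made its source dead, so the source rises together with the phase counter.
  · intro v hv h
    rw [hn.n] at hv
    rw [hsrc v hv] at h
    rw [hn.h v hv, hi.fl_dd v hv h, hg.src_h v hv]
    have := hi.fl_le v hv; omega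
  · intro p hp
    rw [hn.n] at hp
    have h1 := hg.z_le p hp
    have h2 := hi.used_le hP hp
    rw [hn.z p hp]
    split_ifs with h <;> omega
  · intro p hp
    rw [hn.n] at hp
    exact (hn.ell_le hP hi hg.h_le hp (hg.ell_le p hp)).trans (by omega)
  · intro v hv
    rw [hn.n] at hv
    have := hg.src_le v hv
    have := hsent v hv
    omega
  · intro v hv
    rw [hn.n] at hv
    have := hg.fr_le v hv
    rw [hfr v hv]; omega
  -- Each unit sent leaves the second sum of the invariant, which frees `2 * D`, and adds at most `2
  -- * i ≤ 2 * D` to the weight.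
  · have h1 := hn.weight hP hi hg.z_le
    have h2 := hi.sum_nf_ell hP hg.h_le
    have h3 := hg.weight
    have h4 : ∑ v ∈ range P.n, P.src v =
        ∑ v ∈ range P.n, (P.src v - s.fl v) + ∑ v ∈ range P.n, P'.src v := by
      rw [← sum_add_distrib]
      exact sum_congr rfl fun v hv => hsent v (mem_range.1 hv)
    have h5 := Nat.mul_le_mul_right (∑ v ∈ range P.n, (P.src v - s.fl v)) hiD
    rw [hE, hn.n, h1]
    rw [h4] at h3
    nlinarith
  · intro v hv
    rw [hn.n] at hv
    rcases Nat.eq_zero_or_pos (P.sent s v) with h0 | h0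
    · rw [hC.mt_idle v hv h0]; exact hg.mt_le v hv
    · rw [hC.mt v hv h0, hmt0 v hv h0]; split_ifs <;> omega
  · intro v hv h
    rw [hn.n] at hv
    have h1 := hsent v hv
    have h2 := hP.src_le v hv
    have h0 : P.sent s v = 0 := by omega
    rw [hC.mt_idle v hv h0, hC.len_idle v hv h0, hC.row_idle v hv h0 0 (Nat.zero_le _)]
    exact hg.fresh v hv (by omega)
  · intro v hv h
    rw [hn.n] at hv
    rcases Nat.eq_zero_or_pos (P.sent s v) with h0 | h0
    · rw [hC.mt_idle v hv h0] at h
      rw [hC.len_idle v hv h0]; exact hg.len_le v hv h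
    · exact hlen v hv h0
  · intro v hv h
    rw [hn.n] at hv
    rcases Nat.eq_zero_or_pos (P.sent s v) with h0 | h0
    · rw [hC.mt_idle v hv h0] at h
      rw [hC.row_idle v hv h0 0 (Nat.zero_le _)]; exact hg.first v hv h
    · rw [hC.row v hv h0 0 (Nat.zero_le _)]; rfl
  · intro v hv h
    rw [hn.n] at hv
    rw [hn.n, hn.rv]
    rcases Nat.eq_zero_or_pos (P.sent s v) with h0 | h0
    · rw [hC.mt_idle v hv h0] at h
      have h1 := hg.route v hv h
      have h2 := hg.len_le v hv h
      have h3 := hC.row_idle v hv h0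
      rw [hC.len_idle v hv h0]
      refine ⟨fun k hk => ?_, fun k hk => ?_, fun k hk k' hk' e => ?_⟩
      · rw [h3 k (by omega)]; exact h1.lt k hk
      · rw [h3 k (by omega), h3 (k + 1) (by omega)]; exact h1.dart k hk
      · rw [h3 k (by omega), h3 k' (by omega)] at e; exact h1.inj k hk k' hk' e
    · exact (hC.len v hv h0).route hP hi hv h0 (hC.row v hv h0)
  · intro v hv h
    rw [hn.n] at hv
    rcases Nat.eq_zero_or_pos (P.sent s v) with h0 | h0
    · rw [hC.mt_idle v hv h0] at h
      have h2 := hg.len_le v hv h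
      rw [hC.len_idle v hv h0, hfin v hv h0 h]
      rcases hg.origin v hv h with h1 | ⟨h1, h3, h4⟩
      · exact Or.inl h1
      · refine Or.inr ⟨h1, h3, ?_⟩
        have hx : C.fin v < P.n := (hg.route v hv h).lt _ le_rfl
        rw [hfr _ hx, h4]; omega
    · have he := hends v hv h0 h
      obtain ⟨hx, h1, h2⟩ := hends_fr _ _ _ he
      have h3 := sent_of_src h0
      have h4 := hg.src_le v hv
      have h5 := hg.fr_le _ hx
      refine Or.inr ⟨by omega, by omega, ?_⟩
      rw [hfr _ hx]; omega
  -- An earlier path ends at a sink that is no longer free, a new one at a sink that was free until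
  -- this phase. Two new paths with a common end coincide by `Ends.inj`.
  · intro v hv v' hv' h h' hs hs' e
    rw [hn.n] at hv hv'
    have key : ∀ v < P.n, ∀ v' < P.n, C.mt v ≠ 0 → P.sent s v = 0 → P₀.src v ≠ 0 →
        0 < P.sent s v' → C'.mt v' ≠ 0 → C'.fin v = C'.fin v' → False := by
      intro v hv v' hv' h h0 hs h0' h' e
      rw [hfin v hv h0 h] at e
      obtain ⟨hx, h1, -⟩ := hends_fr _ _ _ (hends v' hv' h0' h')
      rcases hg.origin v hv h with ⟨h2, -⟩ | ⟨-, -, h2⟩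
      · exact hs (hd v hv h2)
      · rw [e] at h2; omega
    rcases Nat.eq_zero_or_pos (P.sent s v) with h0 | h0 <;>
      rcases Nat.eq_zero_or_pos (P.sent s v') with h0' | h0'
    · rw [hC.mt_idle v hv h0] at h
      rw [hC.mt_idle v' hv' h0'] at h'
      rw [hfin v hv h0 h, hfin v' hv' h0' h'] at e
      exact hg.fin_inj v hv v' hv' h h' hs hs' e
    · rw [hC.mt_idle v hv h0] at h
      exact (key v hv v' hv' h h0 hs h0' h' e).elim
    · rw [hC.mt_idle v' hv' h0'] at h'
      exact (key v' hv' v hv h' h0' hs' h0 h e.symm).elim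
    · exact (hends v hv h0 h).inj hP hi (e ▸ hends v' hv' h0' h')
  · intro x hx h1 h2
    rw [hn.n] at hx ⊢
    by_cases h3 : P.fr x = 0
    · obtain ⟨v, hv, h4, h5, h6⟩ := hg.covered x hx h1 h3
      have h0 := hold v hv h4
      exact ⟨v, hv, by rwa [hC.mt_idle v hv h0], h5, by rw [hfin v hv h0 h4, h6]⟩
    · rw [hfr x hx] at h2
      obtain ⟨v, T, he⟩ := exists_ends hP hi hx (by omega)
      obtain ⟨h4, h5⟩ := hends' v T x he
      have h6 := sent_of_src he.2.1
      have h7 := hg.src_le v he.1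
      exact ⟨v, he.1, h4, by omega, h5⟩
  · intro v hv h
    rw [hn.n] at hv
    have h1 := hg.mt₀ v hv h
    rwa [hC.mt_idle v hv (hold v hv h1)]
  -- Newly lost sources have sent a unit that was not absorbed. There are at most `∑ b ≤ θ` of them
  -- by `card_lost`.
  · rw [hn.n]
    have h1 := card_lost hP hi
    refine (card_le_card (t := ((range P.n).filter fun v => P₀.src v ≠ 0 ∧ P.src v = 0 ∧
      C.mt v = 0) ∪ (range P.n).filter fun v => 0 < P.sent s v ∧ ¬ ∃ T x, P.Ends s v T x)
      fun v hv => ?_).trans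
      ((card_union_le _ _).trans ((add_le_add hg.lost (h1.trans hθ)).trans (by rw [add_mul]; omega)))
    simp only [mem_union, mem_filter, mem_range] at hv ⊢
    obtain ⟨hvn, h2, h3, h4⟩ := hv
    have h5 := hsent v hvn
    rcases Nat.eq_zero_or_pos (P.sent s v) with h0 | h0
    · left
      rw [hC.mt_idle v hvn h0] at h4
      exact ⟨hvn, h2, by omega, h4⟩
    · right
      refine ⟨hvn, h0, ?_⟩
      rintro ⟨T, x, he⟩
      exact (hends' v T x he).1 h4
  -- The load grows at most by the number of new paths through the edge, which is at most `used`.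
  · intro p hp hpr
    rw [hn.n] at hp
    rw [hn.rv] at hpr
    refine hn.load hP hi hp (hg.load p hp hpr) ?_
    rw [hn.n, hn.rv]
    refine (card_le_card (t := ((range P.n).filter fun v => C.mt v ≠ 0 ∧
      Uses P.rv (C.row v) (C.len v) p) ∪ (range P.n).filter fun v => 0 < P.sent s v ∧
      Uses P.rv (C'.row v) (C'.len v) p) fun v hv => ?_).trans ((card_union_le _ _).trans
      (Nat.add_le_add_left (used_le_card hP hi hsim' hC.len hC.row hp hpr fun v hv => ?_) _))
    · simp only [mem_union, mem_filter, mem_range] at hv ⊢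
      obtain ⟨hvn, h1, k, hk, h2⟩ := hv
      rcases Nat.eq_zero_or_pos (P.sent s v) with h0 | h0
      · left
        rw [hC.mt_idle v hvn h0] at h1
        have h3 := hg.len_le v hvn h1
        rw [hC.len_idle v hvn h0] at hk
        rw [hC.row_idle v hvn h0 k (by omega), hC.row_idle v hvn h0 (k + 1) (by omega)] at h2
        exact ⟨hvn, h1, k, hk, h2⟩
      · exact Or.inr ⟨hvn, h0, k, hk, h2⟩
    · simp only [mem_filter, mem_range] at hv
      exact hv

end Net

end CutMatch

/-! ### End of a phase, and a phase as a whole -/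

namespace CutMatch

open Finset ParRAM

namespace Code

open Expr

/-- The phase ends: matched sources are recorded, and lengths, capacities, heights, sinks and
sources are updated. -/
def finish : Prog :=
  .seq (.map (reg 1) 16 (add (read 16 (reg 0))
    (mul (sent (reg 0)) (lt (read 32 (reg 0)) (read 21 (read 31 (reg 0))))))) <|
  .seq (.map (reg 8) 36 (add (read 33 (reg 0)) (read 33 (read 10 (reg 0))))) <|
  .seq (.map (reg 8) 12 (add (read 12 (reg 0))
    (mul (read 12 (reg 0)) (eq (read 36 (reg 0)) (read 13 (reg 0)))))) <|
  .seq (.map (reg 8) 13 (add (sub (read 13 (reg 0)) (read 36 (reg 0)))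
    (mul (reg 10) (eq (read 36 (reg 0)) (read 13 (reg 0)))))) <|
  .seq (.map (reg 1) 11 (add (read 11 (reg 0)) (read 19 (reg 0)))) <|
  .seq (.map (reg 1) 15 (sub (read 15 (reg 0)) (read 21 (reg 0))))
    (.map (reg 1) 14 (read 22 (reg 0)))

/-- A phase. -/
def phase : Prog := .seq start (.seq rounds (.seq trace finish))

end Code

/-- The record stored in memory, with stride `σ` for the paths. -/
def mrec (σ : ℕ) (m : Mem) : Rec := ⟨m 16, m 35, fun v k => m 9 (v * σ + k)⟩

-- Matches are recorded while arrays `14`, `21` and `22` still describe the finished phase, and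
-- lengths are updated before capacities, as the test for saturation compares with the old capacity.
set_option maxHeartbeats 2000000 in
open Code Expr in
theorem Tc.finish {w B D c A' L' r m m₀} {P : Net} {s : Flow} (hf : Fits w B finish)
    (hb : Bdd B r m) (hwf : P.WF) (hinv : P.Inv s) (h1 : r 1 = P.n) (h8 : r 8 = 16 * P.n)
    (h10 : r 10 = c)
    (hB : 32 * P.n + 2 ≤ B) (hz : ∀ p < 16 * P.n, P.z p ≤ c) (hc : 2 * c ≤ B)
    (hell : ∀ p < 16 * P.n, 2 * P.ell p ≤ B) (hh : ∀ v < P.n, P.h v + 1 ≤ B)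
    (hP : mnet P.n m = P) (hs : mflow m = s) (hr : Routed P s (D + 1) m₀ m)
    (h16 : m 16 = m₀ 16) (hmt : ∀ v < P.n, m 16 v ≤ 1)
    (hA : 16 * P.n + 1 ≤ A') (hL : 1 ≤ L') :
    Tc w finish r m A' L' fun r' m' => Bdd B r' m' ∧ P.Next s c (mnet P.n m') ∧
      P.Records s D (mrec (D + 1) m₀) (mrec (D + 1) m') := by
  have e10 : m 10 = P.rv := by rw [← hP]; rfl
  have e11 : m 11 = P.h := by rw [← hP]; rfl
  have e12 : m 12 = P.ell := by rw [← hP]; rfl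
  have e13 : m 13 = P.z := by rw [← hP]; rfl
  have e14 : m 14 = P.src := by rw [← hP]; rfl
  have e15 : m 15 = P.fr := by rw [← hP]; rfl
  have e19 : m 19 = s.dd := by rw [← hs]; rfl
  have e21 : m 21 = s.ab := by rw [← hs]; rfl
  have e22 : m 22 = s.fl := by rw [← hs]; rfl
  have hs1 : ∀ v < P.n, P.sent s v ≤ 1 := fun v hv => (Nat.sub_le _ _).trans (hwf.src_le v hv)
  unfold Code.finish
  refine Tc.seq ((Tr.map hf.left hb P.n h1 (by omega) (by simp [sent])
    (fun v => m 16 v + P.sent s v * if m 32 v < s.ab (m 31 v) then 1 else 0) ?_ ?_).toTc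
    (by omega) hL) ?_
  · intro v hv
    simp only [Expr.val, sent, Function.update_self, e14, e22, e21]
    rfl
  · intro v hv
    have := hmt v hv
    have := hs1 v hv
    split_ifs <;> omega
  rintro _ m₁ ⟨rfl, hb₁, a16, -, f₁⟩
  have hf := hf.right
  refine Tc.seq ((Tr.map hf.left hb₁ (16 * P.n) h8 (by omega) (by simp) (P.used s) ?_ ?_).toTc
    hA hL) ?_
  · intro p hp
    simp only [Expr.val, Function.update_self, f₁ 33 (by decide), f₁ 10 (by decide), e10,
      hr.nf p hp, hr.nf _ (hwf.rv_lt p hp)]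
    rfl
  · intro p hp
    have := hinv.used_le hwf hp
    have := hz p hp
    omega
  rintro _ m₂ ⟨rfl, hb₂, a36, -, f₂⟩
  have hf := hf.right
  refine Tc.seq ((Tr.map hf.left hb₂ (16 * P.n) h8 (by omega) (by simp)
    (fun p => P.ell p + P.ell p * if P.used s p = P.z p then 1 else 0) ?_ ?_).toTc
    hA hL) ?_
  · intro p hp
    simp only [Expr.val, Function.update_self, a36 p hp, f₂ 12 (by decide), f₁ 12 (by decide), e12,
      f₂ 13 (by decide), f₁ 13 (by decide), e13]
  · intro p hp
    have := hell p hp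
    split_ifs <;> omega
  rintro _ m₃ ⟨rfl, hb₃, a12, -, f₃⟩
  have hf := hf.right
  refine Tc.seq ((Tr.map hf.left hb₃ (16 * P.n) h8 (by omega) (by simp)
    (fun p => P.z p - P.used s p + c * if P.used s p = P.z p then 1 else 0) ?_ ?_).toTc
    hA hL) ?_
  · intro p hp
    simp only [Expr.val, Function.update_self, f₃ 36 (by decide), a36 p hp,
      f₃ 13 (by decide), f₂ 13 (by decide), f₁ 13 (by decide), e13, ne_eq, OfNat.ofNat_ne_zero,
      not_false_eq_true, Function.update_of_ne, h10]
  · intro p hp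
    have := hz p hp
    split_ifs <;> omega
  rintro _ m₄ ⟨rfl, hb₄, a13, -, f₄⟩
  have hf := hf.right
  refine Tc.seq ((Tr.map hf.left hb₄ P.n h1 (by omega) (by simp)
    (fun v => P.h v + s.dd v) ?_ ?_).toTc (by omega) hL) ?_
  · intro v hv
    simp only [Expr.val, Function.update_self, f₄ 11 (by decide), f₃ 11 (by decide),
      f₂ 11 (by decide), f₁ 11 (by decide), f₄ 19 (by decide), f₃ 19 (by decide),
      f₂ 19 (by decide), f₁ 19 (by decide), e11, e19]
  · intro v hv
    have := hh v hv
    have := hinv.dd_le v hv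
    omega
  rintro _ m₅ ⟨rfl, hb₅, a11, -, f₅⟩
  have hf := hf.right
  refine Tc.seq ((Tr.map hf.left hb₅ P.n h1 (by omega) (by simp)
    (fun v => P.fr v - s.ab v) ?_ ?_).toTc (by omega) hL) ?_
  · intro v hv
    simp only [Expr.val, Function.update_self, f₅ 15 (by decide), f₄ 15 (by decide),
      f₃ 15 (by decide), f₂ 15 (by decide), f₁ 15 (by decide), f₅ 21 (by decide),
      f₄ 21 (by decide), f₃ 21 (by decide), f₂ 21 (by decide), f₁ 21 (by decide), e15, e21]
  · intro v hv
    have := hwf.fr_le v hv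
    omega
  rintro _ m₆ ⟨rfl, hb₆, a15, -, f₆⟩
  refine ((Tr.map hf.right hb₆ P.n h1 (by omega) (by simp) s.fl ?_ ?_).toTc (by omega) hL).post ?_
  · intro v hv
    simp only [Expr.val, Function.update_self, f₆ 22 (by decide), f₅ 22 (by decide),
      f₄ 22 (by decide), f₃ 22 (by decide), f₂ 22 (by decide), f₁ 22 (by decide), e22]
  · intro v hv
    have := hinv.fl_le v hv
    have := hwf.src_le v hv
    omega
  rintro _ m₇ ⟨rfl, hb₇, a14, -, f₇⟩
  have c16 : ∀ v < P.n, m₇ 16 v = m 16 v + P.sent s v * if m 32 v < s.ab (m 31 v) then 1 else 0 :=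
    fun v hv => by
      rw [f₇ 16 (by decide), f₆ 16 (by decide), f₅ 16 (by decide), f₄ 16 (by decide),
        f₃ 16 (by decide), f₂ 16 (by decide), a16 v hv]
  have c35 : m₇ 35 = m 35 := by
    rw [f₇ 35 (by decide), f₆ 35 (by decide), f₅ 35 (by decide), f₄ 35 (by decide),
        f₃ 35 (by decide), f₂ 35 (by decide), f₁ 35 (by decide)]
  have c9 : m₇ 9 = m 9 := by
    rw [f₇ 9 (by decide), f₆ 9 (by decide), f₅ 9 (by decide), f₄ 9 (by decide),
        f₃ 9 (by decide), f₂ 9 (by decide), f₁ 9 (by decide)]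
  refine ⟨hb₇, ⟨rfl, ?_, ?_, ?_, ?_, ?_, ?_⟩, ⟨?_, ?_, ?_, ?_, ?_, ?_⟩⟩
  · change m₇ 10 = P.rv
    rw [f₇ 10 (by decide), f₆ 10 (by decide), f₅ 10 (by decide), f₄ 10 (by decide),
      f₃ 10 (by decide), f₂ 10 (by decide), f₁ 10 (by decide), e10]
  · intro v hv
    change m₇ 11 v = _
    rw [f₇ 11 (by decide), f₆ 11 (by decide), a11 v hv]
  · intro p hp
    change m₇ 12 p = _
    rw [f₇ 12 (by decide), f₆ 12 (by decide), f₅ 12 (by decide), f₄ 12 (by decide), a12 p hp]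
  · intro p hp
    change m₇ 13 p = _
    rw [f₇ 13 (by decide), f₆ 13 (by decide), f₅ 13 (by decide), a13 p hp]
  · intro v hv
    change m₇ 14 v = _
    rw [a14 v hv]
  · intro v hv
    change m₇ 15 v = _
    rw [f₇ 15 (by decide), a15 v hv]
  · intro v hv h0
    change m₇ 16 v = m₀ 16 v
    rw [c16 v hv, h0, h16, Nat.zero_mul, Nat.add_zero]
  · intro v hv h0
    change m₇ 35 v = m₀ 35 v
    rw [c35, hr.len_idle v hv h0]
  · intro v hv h0 k hk
    change m₇ 9 (v * (D + 1) + k) = m₀ 9 (v * (D + 1) + k)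
    rw [c9, hr.path_idle v hv h0 k (by omega)]
  · intro v hv h0
    change P.Len s v (m₇ 35 v)
    rw [c35]; exact hr.len v hv h0
  · intro v hv h0 k hk
    change m₇ 9 (v * (D + 1) + k) = _
    change k ≤ m₇ 35 v at hk
    rw [c35] at hk
    rw [c9, hr.path v hv h0 k hk]
  · intro v hv h0
    change m₇ 16 v = m₀ 16 v + if (P.pos s v (m₇ 35 v)).2 < s.ab (P.pos s v (m₇ 35 v)).1 then 1
      else 0
    rw [c16 v hv, c35, ← hr.vertex v hv h0, ← hr.number v hv h0, h16,
      show P.sent s v = 1 by have := hs1 v hv; omega, one_mul]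

/-- The state after `i` phases. -/
structure State (B : ℕ) (P₀ : Net) (mt₀ : ℕ → ℕ) (c D θ i : ℕ) (r : Regs) (m : Mem) : Prop where
  bdd : Bdd B r m
  r1 : r 1 = P₀.n
  r8 : r 8 = 16 * P₀.n
  r9 : r 9 = θ
  r10 : r 10 = c
  r13 : r 13 = D
  r16 : r 16 = D + 1
  aF : ∀ p < 16 * P₀.n, m 25 p = 0
  aR : ∀ p < 16 * P₀.n, m 26 p = 0
  good : Net.Good P₀ mt₀ c D θ i (mnet P₀.n m) (mrec (D + 1) m)

theorem Net.Start.Pot_le {P : Net} {s : Flow} {c : ℕ} (h : P.Start s) (hP : P.WF)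
    (hz : ∀ p < 16 * P.n, P.z p ≤ c) :
    P.Pot s ≤ 2 * c * P.edges.card + ∑ v ∈ range P.n, P.src v := by
  refine add_le_add ?_ (sum_le_sum fun v hv => (h.b v (mem_range.1 hv)).le)
  calc _ ≤ ∑ p ∈ P.edges, 2 * c := sum_le_sum fun p hp => by
        have hp := (Net.mem_edges.1 hp).1
        have := hz p hp
        have := Net.div_lt (hP.rv_lt p hp)
        rw [Net.pot, h.dd _ this, if_neg (by omega), h.F p hp]; omega
    _ = _ := by simp [mul_comm]

-- `R` controls the number of rounds: the potential is at most `(2c + 1) * |edges|`, and `|edges| ≤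
-- (θ + 1) * R` turns the quotient by `θ + 1` into `(2c + 1) * R`, which does not depend on the
-- graph.
set_option maxHeartbeats 1000000 in
open Code in
theorem Tc.phase {w B c D θ i A' L R r m} {P₀ : Net} {mt₀ : ℕ → ℕ} (hf : Fits w B phase)
    (h : State B P₀ mt₀ c D θ i r m) (hi : i < D) (hB : 32 * P₀.n + 2 ≤ B)
    (hBD : 4 * D + 2 ≤ B) (hBc : 16 * c + 1 ≤ B) (hc : 0 < c)
    (hd : ∀ v < P₀.n, mt₀ v ≠ 0 → P₀.src v = 0) (hsim : P₀.Simple)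
    (hsrc : ∑ v ∈ range P₀.n, P₀.src v ≤ P₀.edges.card)
    (hθ : P₀.edges.card ≤ (θ + 1) * R)
    (hL : Nat.clog 2 (16 * P₀.n) + 2 ≤ L)
    (hA₁ : 17 * L * ((2 * c + 1) * P₀.edges.card) + 1 ≤ A') (hA₂ : (16 * P₀.n + 1) * L ≤ A')
    (hA₃ : (D + 1) * (16 * P₀.n + 2) ≤ A') {L' : ℕ}
    (hL₁ : L * ((2 * c + 1) * R) + 1 ≤ L') (hL₂ : L ≤ L') (hL₃ : 2 * (D + 1) ≤ L') :
    Tc w phase r m A' L' fun r' m' => State B P₀ mt₀ c D θ (i + 1) r' m' ∧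
      ∀ x ∉ Code.phase.registers, r' x = r x := by
  set n := P₀.n with hn
  have hg := h.good
  set P := mnet n m with hP
  have hPn : P.n = n := rfl
  have hwf := hg.wf
  have hE : P.edges.card = P₀.edges.card := by
    simp only [Net.edges, hg.n, hg.rv]
  have hsrc' : ∑ v ∈ range n, P.src v ≤ P₀.edges.card :=
    (sum_le_sum fun v hv => hg.src_le v (mem_range.1 hv)).trans hsrc
  refine (Tc.frame (Q := fun r' m' => Bdd B r' m' ∧ (∀ p < 16 * n, m' 25 p = 0) ∧
    (∀ p < 16 * n, m' 26 p = 0) ∧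
    Net.Good P₀ mt₀ c D θ (i + 1) (mnet n m') (mrec (D + 1) m')) ?_).post ?_
  · unfold Code.phase
    refine Tc.seq ((Tc.start hf.left h.bdd hB h.r1 h.r8 hwf h.aF h.aR hL hA₂).mono le_rfl
      (Nat.mul_le_mul_left _ hL₂) fun _ _ h => h) ?_
    rintro r₁ m₁ ⟨⟨A₁, hr₁⟩, hst, h4, f₁, g₁⟩
    have hP₁ : mnet n m₁ = P := by
      simp only [hP, mnet, f₁ 10 (by decide), f₁ 11 (by decide), f₁ 12 (by decide),
        f₁ 13 (by decide), f₁ 14 (by decide), f₁ 15 (by decide)]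
    have hpot : (mnet n m₁).Pot (mflow m₁) ≤ (2 * c + 1) * P₀.edges.card := by
      rw [hP₁]
      have : P.Pot (mflow m₁) ≤ 2 * c * P.edges.card + ∑ v ∈ range n, P.src v :=
        hst.Pot_le hwf hg.z_le
      rw [hE] at this
      rw [add_mul, one_mul]
      exact this.trans (by omega)
    have hf := hf.right
    refine Tc.seq ((Tc.rounds hf.left hr₁ (by rw [g₁ 9 (by decide), h.r9]) h4 hL).mono
      (Nat.mul_le_mul_left _ ((Nat.add_le_add_right (Nat.mul_le_mul_left _ hpot) _).trans hA₁))
      (Nat.mul_le_mul_left _ ((Nat.add_le_add_right (Nat.mul_le_mul_left _ ?_) _).trans hL₁))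
      fun _ _ h => h) ?_
    · refine Nat.div_le_of_le_mul (hpot.trans ?_)
      calc _ ≤ (2 * c + 1) * ((θ + 1) * R) := Nat.mul_le_mul_left _ hθ
        _ = _ := by ring
    rintro r₂ m₂ ⟨⟨A₂, hr₂⟩, hb₂, f₂, g₂⟩
    have hP₂ : mnet n m₂ = P := by
      rw [← hP₁]
      simp only [mnet, f₂ 10 (by decide), f₂ 11 (by decide), f₂ 12 (by decide),
        f₂ 13 (by decide), f₂ 14 (by decide), f₂ 15 (by decide)]
    have hinv : P.Inv (mflow m₂) := by rw [← hP₂]; exact hr₂.inv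
    have e9 : m₂ 9 = m 9 := by rw [f₂ 9 (by decide), f₁ 9 (by decide)]
    have e35 : m₂ 35 = m 35 := by rw [f₂ 35 (by decide), f₁ 35 (by decide)]
    have e16 : m₂ 16 = m 16 := by rw [f₂ 16 (by decide), f₁ 16 (by decide)]
    have hf := hf.right
    have k₂ : ∀ x, x ∉ Code.start.registers → x ∉ Code.round.registers → r₂ x = r x :=
      fun x h h' => by rw [g₂ x h', g₁ x h]
    refine Tc.seq (Tc.trace hf.left hr₂.bdd hwf hinv
      (by rw [k₂ 1 (by decide) (by decide)]; exact h.r1)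
      (by rw [k₂ 8 (by decide) (by decide)]; exact h.r8)
      (by rw [k₂ 16 (by decide) (by decide)]; exact h.r16)
      (by rw [k₂ 13 (by decide) (by decide)]; exact h.r13)
      (by omega) hB (fun p hp => ?_) hP₂ rfl (fun v hv => ?_) (fun v hv h0 => ?_)
      (fun v hv h0 => ?_) hA₃ hL₃) ?_
    · have := hg.z_le p hp; omega
    · have := hg.h_le v hv; omega
    · rw [e35]; exact (hg.fresh v hv (Net.sent_of_src h0)).2.1
    · rw [e9]; exact (hg.fresh v hv (Net.sent_of_src h0)).2.2
    rintro r₃ m₃ ⟨g₃, hb₃, f₃, hrt⟩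
    have hP₃ : mnet n m₃ = P := by
      rw [← hP₂]
      simp only [mnet, f₃ 10 (by decide), f₃ 11 (by decide), f₃ 12 (by decide),
        f₃ 13 (by decide), f₃ 14 (by decide), f₃ 15 (by decide)]
    have hs₃ : mflow m₃ = mflow m₂ := by
      simp only [mflow, f₃ 17 (by decide), f₃ 18 (by decide), f₃ 19 (by decide),
        f₃ 20 (by decide), f₃ 21 (by decide), f₃ 22 (by decide)]
    have e16' : m₃ 16 = m₂ 16 := f₃ 16 (by decide)
    refine (Tc.frame (Tc.finish (c := c) (D := D) (m₀ := m₂) hf.right hb₃ hwf hinv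
      (by rw [g₃ 1 (by decide), k₂ 1 (by decide) (by decide)]; exact h.r1)
      (by rw [g₃ 8 (by decide), k₂ 8 (by decide) (by decide)]; exact h.r8)
      (by rw [g₃ 10 (by decide), k₂ 10 (by decide) (by decide)]; exact h.r10)
      hB hg.z_le (by omega) (fun p hp => ?_) (fun v hv => ?_) hP₃ hs₃ hrt e16' (fun v hv => ?_)
      (by nlinarith) (by omega))).post ?_
    · have := hg.ell_le p hp; omega
    · have := hg.h_le v hv; omega
    · rw [e16', e16]; exact hg.mt_le v hv
    rintro r₄ m₄ ⟨⟨hb₄, hnx, hrec⟩, f₄, -⟩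
    refine ⟨hb₄, ?_, ?_, ?_⟩
    · intro p hp
      rw [f₄ 25 (by decide), f₃ 25 (by decide)]; exact hr₂.aF p hp
    · intro p hp
      rw [f₄ 26 (by decide), f₃ 26 (by decide)]; exact hr₂.aR p hp
    · have hrec' : mrec (D + 1) m₂ = mrec (D + 1) m := by simp only [mrec, e9, e35, e16]
      rw [hrec'] at hrec
      exact hg.next hc hd hinv hsim hi.le hnx hrec hb₂
  · rintro r' m' ⟨⟨hb', h25, h26, hg'⟩, -, g⟩
    refine ⟨⟨hb', ?_, ?_, ?_, ?_, ?_, ?_, h25, h26, hg'⟩, g⟩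
    · rw [g 1 (by decide)]; exact h.r1
    · rw [g 8 (by decide)]; exact h.r8
    · rw [g 9 (by decide)]; exact h.r9
    · rw [g 10 (by decide)]; exact h.r10
    · rw [g 13 (by decide)]; exact h.r13
    · rw [g 16 (by decide)]; exact h.r16

end CutMatch

/-! ### From adjacency lists to the involution on darts -/

namespace CutMatch

open Finset ParRAM

/-- Adjacency lists of a simple graph of maximum degree at most `16`. -/
structure Adjacency (n : ℕ) (deg : ℕ → ℕ) (nb : ℕ → ℕ → ℕ) : Prop where
  deg_le : ∀ v < n, deg v ≤ 16
  lt : ∀ v < n, ∀ k < deg v, nb v k < n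
  ne : ∀ v < n, ∀ k < deg v, nb v k ≠ v
  inj : ∀ v < n, ∀ k < deg v, ∀ k' < deg v, nb v k = nb v k' → k = k'
  symm : ∀ v < n, ∀ k < deg v, ∃ j < deg (nb v k), nb (nb v k) j = v

/-- Position of `v` in the list of `u`. -/
def place (deg : ℕ → ℕ) (nb : ℕ → ℕ → ℕ) (u v : ℕ) : ℕ :=
  ∑ j ∈ range 16, (if j < deg u then 1 else 0) * (if nb u j = v then 1 else 0) * j

/-- The reversal of darts. -/
def flip (deg : ℕ → ℕ) (nb : ℕ → ℕ → ℕ) (p : ℕ) : ℕ :=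
  if p % 16 < deg (p / 16) then
    16 * nb (p / 16) (p % 16) + place deg nb (nb (p / 16) (p % 16)) (p / 16)
  else p

namespace Adjacency

variable {n : ℕ} {deg : ℕ → ℕ} {nb : ℕ → ℕ → ℕ}

theorem place_eq (h : Adjacency n deg nb) {u v j : ℕ} (hu : u < n) (hj : j < deg u)
    (e : nb u j = v) : place deg nb u v = j := by
  have := h.deg_le u hu
  rw [place, sum_eq_single j]
  · simp [hj, e]
  · intro i _ hne
    by_cases hi : i < deg u
    · rw [if_neg (show ¬ nb u i = v from fun h' => hne (h.inj u hu i hi j hj (h'.trans e.symm))),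
        mul_zero, zero_mul]
    · rw [if_neg hi, zero_mul, zero_mul]
  · intro hc; rw [mem_range] at hc; omega

theorem flip_eq (h : Adjacency n deg nb) {v k j : ℕ} (hv : v < n) (hk : k < deg v)
    (hj : j < deg (nb v k)) (e : nb (nb v k) j = v) :
    flip deg nb (16 * v + k) = 16 * nb v k + j := by
  have := h.deg_le v hv
  rw [flip, dart_div v (by omega), dart_mod v (by omega), if_pos hk,
    h.place_eq (h.lt v hv k hk) hj e]

theorem exists_flip (h : Adjacency n deg nb) {p : ℕ} (hp : p < 16 * n) :
    (flip deg nb p = p ∧ deg (p / 16) ≤ p % 16) ∨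
      ∃ k < deg (p / 16), ∃ j < deg (nb (p / 16) k), nb (nb (p / 16) k) j = p / 16 ∧
        p = 16 * (p / 16) + k ∧ flip deg nb p = 16 * nb (p / 16) k + j := by
  have hv : p / 16 < n := by omega
  by_cases hk : p % 16 < deg (p / 16)
  · right
    obtain ⟨j, hj, e⟩ := h.symm _ hv _ hk
    have h1 := h.flip_eq hv hk hj e
    refine ⟨_, hk, j, hj, e, by omega, ?_⟩
    rw [← h1]; congr 1; omega
  · left
    exact ⟨if_neg hk, by omega⟩

theorem flip_lt (h : Adjacency n deg nb) {p : ℕ} (hp : p < 16 * n) : flip deg nb p < 16 * n := by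
  rcases h.exists_flip hp with ⟨e, -⟩ | ⟨k, hk, j, hj, -, -, e⟩
  · rwa [e]
  · have h1 := h.lt _ (by omega) k hk
    have h2 := h.deg_le _ h1
    omega

theorem flip_flip (h : Adjacency n deg nb) {p : ℕ} (hp : p < 16 * n) :
    flip deg nb (flip deg nb p) = p := by
  rcases h.exists_flip hp with ⟨e, -⟩ | ⟨k, hk, j, hj, e1, e2, e3⟩
  · rw [e, e]
  · have h1 := h.lt _ (by omega) k hk
    rw [e3, h.flip_eq h1 hj (by rwa [e1]) (by rw [e1]), e1]
    exact e2.symm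

theorem flip_ne (h : Adjacency n deg nb) {v k : ℕ} (hv : v < n) (hk : k < deg v) :
    flip deg nb (16 * v + k) ≠ 16 * v + k ∧ flip deg nb (16 * v + k) / 16 = nb v k := by
  obtain ⟨j, hj, e⟩ := h.symm v hv k hk
  have h1 := h.deg_le v hv
  have h2 := h.deg_le _ (h.lt v hv k hk)
  have h3 := h.ne v hv k hk
  rw [h.flip_eq hv hk hj e]
  omega

theorem of_flip_ne (h : Adjacency n deg nb) {p : ℕ} (hp : p < 16 * n) (hne : flip deg nb p ≠ p) :
    p % 16 < deg (p / 16) ∧ flip deg nb p / 16 = nb (p / 16) (p % 16) := by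
  rcases h.exists_flip hp with ⟨e, -⟩ | ⟨k, hk, j, hj, -, e2, e3⟩
  · exact absurd e hne
  · have h1 := h.deg_le (p / 16) (by omega)
    have h2 := h.deg_le _ (h.lt _ (by omega) k hk)
    have e4 : p % 16 = k := by omega
    rw [e4]
    exact ⟨hk, by omega⟩

theorem simple (h : Adjacency n deg nb) {P : Net} (hn : P.n = n)
    (hrv : ∀ p < 16 * n, P.rv p = flip deg nb p) : P.Simple := by
  intro p hp p' hp' hne hne' e e'
  rw [hn] at hp hp'
  rw [hrv p hp] at hne e'
  rw [hrv p' hp'] at hne' e'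
  obtain ⟨h1, h2⟩ := h.of_flip_ne hp hne
  obtain ⟨h3, h4⟩ := h.of_flip_ne hp' hne'
  rw [h2, h4, ← e] at e'
  rw [← e] at h3
  have := h.inj _ (by omega) _ h1 _ h3 e'
  omega

theorem card_edges (h : Adjacency n deg nb) {P : Net} (hn : P.n = n)
    (hrv : ∀ p < 16 * n, P.rv p = flip deg nb p) :
    P.edges.card = ∑ v ∈ range n, deg v := by
  have h1 : P.edges = (range (16 * n)).filter fun p => p % 16 < deg (p / 16) := by
    ext p
    rw [Net.mem_edges, mem_filter, mem_range, hn]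
    refine and_congr_right fun hp => ?_
    rw [hrv p hp]
    constructor
    · exact fun hne => (h.of_flip_ne hp hne).1
    · intro hk
      have := (h.flip_ne (show p / 16 < n by omega) hk).1
      rwa [Nat.div_add_mod] at this
  rw [h1, card_filter, sum_darts]
  refine sum_congr rfl fun v hv => ?_
  rw [mem_range] at hv
  have hd := h.deg_le v hv
  rw [sum_congr rfl (g := fun k => if k < deg v then 1 else 0) fun k hk => by
    rw [mem_range] at hk; rw [dart_div v hk, dart_mod v hk], ← card_filter]
  have : (range 16).filter (fun k => k < deg v) = range (deg v) := by
    ext k; simp only [mem_filter, mem_range]; omega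
  rw [this, card_range]

end Adjacency

namespace IsInput

variable {n : ℕ} {G : SimpleGraph (Fin n)} [DecidableRel G.Adj] {S T : Finset (Fin n)} {q : ℕ}
  {m : Mem}

theorem deg_eq (h : IsInput G S T q m) (v : Fin n) : m 1 (v + 1) - m 1 v = G.degree v := by
  rw [h.offset_succ v]; omega

/-- `IsInput` only says that all neighbours occur among `degree` many entries. By counting, no entry
is repeated. -/
theorem nb_inj (h : IsInput G S T q m) (v : Fin n) :
    Set.InjOn (fun k => m 2 (m 1 v + k)) (range (G.degree v)) := by
  have h1 : ((range (G.degree v)).image fun k => m 2 (m 1 v + k)).card =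
      (range (G.degree v)).card := by
    refine le_antisymm card_image_le ?_
    have e : G.degree v = ((G.neighborFinset v).image Fin.val).card := by
      rw [card_image_of_injective _ Fin.val_injective, G.card_neighborFinset_eq_degree]
    rw [card_range]
    refine e.le.trans (card_le_card fun x hx => ?_)
    rw [mem_image] at hx
    obtain ⟨u, hu, rfl⟩ := hx
    rw [SimpleGraph.mem_neighborFinset] at hu
    obtain ⟨i, hi, e⟩ := h.list_all v u hu
    rw [mem_image]
    exact ⟨i, mem_range.2 hi, e⟩
  exact card_image_iff.1 h1

theorem adjacency (h : IsInput G S T q m) (hdeg : ∀ v, G.degree v ≤ 16) :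
    Adjacency n (fun v => m 1 (v + 1) - m 1 v) fun v k => m 2 (m 1 v + k) where
  deg_le v hv := by
    have := hdeg ⟨v, hv⟩
    have := h.deg_eq ⟨v, hv⟩
    simp only at this; omega
  lt v hv k hk := by
    rw [h.deg_eq ⟨v, hv⟩] at hk
    obtain ⟨u, -, e⟩ := h.list_adj ⟨v, hv⟩ k hk
    simp only at e; rw [e]; exact u.2
  ne v hv k hk := by
    rw [h.deg_eq ⟨v, hv⟩] at hk
    obtain ⟨u, hu, e⟩ := h.list_adj ⟨v, hv⟩ k hk
    simp only at e; rw [e]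
    intro hc
    have : u = ⟨v, hv⟩ := Fin.ext hc
    rw [this] at hu
    exact G.loopless.irrefl _ hu
  inj v hv k hk k' hk' e := by
    rw [h.deg_eq ⟨v, hv⟩] at hk hk'
    exact h.nb_inj ⟨v, hv⟩ (by simpa using hk) (by simpa using hk') e
  symm v hv k hk := by
    rw [h.deg_eq ⟨v, hv⟩] at hk
    obtain ⟨u, hu, e⟩ := h.list_adj ⟨v, hv⟩ k hk
    simp only at e
    rw [e]
    obtain ⟨j, hj, e'⟩ := h.list_all u ⟨v, hv⟩ hu.symm
    rw [← h.deg_eq u] at hj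
    exact ⟨j, hj, e'⟩

theorem offset_eq (h : IsInput G S T q m) {k : ℕ} (hk : k ≤ n) :
    m 1 k = ∑ v ∈ range k, (m 1 (v + 1) - m 1 v) := by
  induction k with
  | zero => simp [h.offset_zero]
  | succ k ih =>
    rw [sum_range_succ, ← ih (by omega)]
    have := h.offset_succ ⟨k, hk⟩
    simp only at this; omega

theorem total (h : IsInput G S T q m) : m 1 n = 2 * numEdges G := by
  rw [h.offset_eq le_rfl, numEdges, ← G.sum_degrees_eq_twice_card_edges, ← Fin.sum_univ_eq_sum_range
    (fun v => m 1 (v + 1) - m 1 v)]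
  exact sum_congr rfl fun v _ => h.deg_eq v

theorem offset_le (h : IsInput G S T q m) (hdeg : ∀ v, G.degree v ≤ 16) (k : ℕ) :
    m 1 k ≤ 16 * n := by
  by_cases hk : k ≤ n
  · rw [h.offset_eq hk]
    calc _ ≤ ∑ v ∈ range k, 16 := sum_le_sum fun v hv =>
          (h.adjacency hdeg).deg_le v (by have := mem_range.1 hv; omega)
      _ ≤ _ := by simp; omega
  · rw [h.rest_one k (by omega)]; omega

theorem list_lt (h : IsInput G S T q m) (k : ℕ) (hk : k ≤ n) :
    ∀ i < m 1 k, m 2 i < n := by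
  induction k with
  | zero => rw [h.offset_zero]; intro i hi; omega
  | succ k ih =>
    intro i hi
    have h1 := h.offset_succ ⟨k, hk⟩
    simp only at h1
    by_cases hik : i < m 1 k
    · exact ih (by omega) i hik
    · obtain ⟨u, -, e⟩ := h.list_adj ⟨k, hk⟩ (i - m 1 k) (by omega)
      simp only at e
      rw [show m 1 k + (i - m 1 k) = i by omega] at e
      rw [e]; exact u.2

theorem bdd (h : IsInput G S T q m) (hdeg : ∀ v, G.degree v ≤ 16) {B : ℕ} (hn : 32 * n + 2 ≤ B)
    (hq : q ≤ B) : Bdd B (fun _ => 0) m := by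
  refine ⟨fun _ => Nat.zero_le _, fun a i => ?_⟩
  by_cases ha : 5 ≤ a
  · rw [h.rest a i ha]; omega
  interval_cases a
  · by_cases hi : 2 ≤ i
    · rw [h.rest_zero i hi]; omega
    · interval_cases i
      · rw [h.size]; omega
      · rw [h.param]; exact hq
  · have := h.offset_le hdeg i; omega
  · by_cases hi : m 1 n ≤ i
    · rw [h.rest_two i hi]; omega
    · have := h.list_lt n le_rfl i (by omega); omega
  · by_cases hi : n ≤ i
    · rw [h.rest_three i hi]; omega
    · have := h.sources ⟨i, by omega⟩
      simp only at this
      rw [this]; split_ifs <;> omega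
  · by_cases hi : n ≤ i
    · rw [h.rest_four i hi]; omega
    · have := h.sinks ⟨i, by omega⟩
      simp only at this
      rw [this]; split_ifs <;> omega

end IsInput

end CutMatch

/-! ### Initialization -/

namespace CutMatch

open Finset ParRAM

theorem Net.Good.init {P : Net} {C : Rec} {c D θ : ℕ} (hP : P.WF) (hh : ∀ v < P.n, P.h v = 0)
    (hell : ∀ p < 16 * P.n, P.ell p = 1) (hz : ∀ p < 16 * P.n, P.z p = c)
    (hmt : ∀ v < P.n, C.mt v ≤ 1) (hd : ∀ v < P.n, C.mt v ≠ 0 → P.src v = 0)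
    (hlen : ∀ v < P.n, C.len v = 0) (hrow : ∀ v < P.n, C.row v 0 = v) :
    Net.Good P C.mt c D θ 0 P C where
  n := rfl
  rv := rfl
  wf := hP
  h_le v hv := (hh v hv).le
  src_h v hv _ := hh v hv
  z_le p hp := (hz p hp).le
  ell_le p hp := by rw [hell p hp]
  src_le _ _ := le_rfl
  fr_le _ _ := le_rfl
  weight := by
    refine Nat.add_le_add_right ?_ _
    calc _ = ∑ p ∈ P.edges, c := sum_congr rfl fun p hp => by
          have hp := (Net.mem_edges.1 hp).1
          rw [hz p hp, hell p hp]; omega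
      _ ≤ _ := by simp [mul_comm]
  mt_le := hmt
  fresh v hv h := by
    refine ⟨?_, hlen v hv, hrow v hv⟩
    by_contra hc
    exact h (hd v hv hc)
  len_le v hv _ := by rw [hlen v hv]; exact Nat.zero_le _
  first v hv _ := hrow v hv
  route v hv _ := by
    rw [hlen v hv]
    refine ⟨fun k hk => ?_, fun k hk => by omega, fun k hk k' hk' _ => by omega⟩
    rw [Nat.le_zero.1 hk, hrow v hv]; exact hv
  origin v hv h := Or.inl ⟨h, hlen v hv⟩
  fin_inj v hv _ _ h _ hs := absurd (hd v hv h) hs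
  covered x _ h h' := absurd h' h
  mt₀ _ _ h := h
  lost := by
    rw [filter_false_of_mem]
    · simp
    · rintro v - ⟨h1, h2, -⟩; exact h1 h2
  load p hp _ := by
    classical
    rw [filter_false_of_mem]
    · exact ⟨0, by rw [hell p hp, pow_zero], by rw [hz p hp]; simp⟩
    · rintro v hv ⟨-, k, hk, -⟩
      rw [hlen v (mem_range.1 hv)] at hk; omega

namespace Code

open Expr

def deg (v : Expr) : Expr := sub (read 1 (add v (const 1))) (read 1 v)

def nb (v k : Expr) : Expr := read 2 (add (read 1 v) k)

def place (u v : Expr) : Expr :=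
  sum (fun j => mul (mul (lt (const j) (deg u)) (eq (nb u (const j)) v)) (const j)) 16

def real (p : Expr) : Expr := lt (mod p (const 16)) (deg (own p))

def flip (p : Expr) : Expr :=
  add (mul (real p) (add (mul (const 16) (nb (own p) (mod p (const 16))))
    (place (nb (own p) (mod p (const 16))) (own p)))) (mul (sub (const 1) (real p)) p)

variable {r : Regs} {m : Mem}

theorem val_place (u v : Expr) : (place u v).val r m =
    CutMatch.place (fun v => m 1 (v + 1) - m 1 v) (fun v k => m 2 (m 1 v + k)) (u.val r m)
      (v.val r m) := by
  simp only [place, CutMatch.place, val_sum]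
  rfl

theorem val_flip (p : Expr) : (flip p).val r m =
    CutMatch.flip (fun v => m 1 (v + 1) - m 1 v) (fun v k => m 2 (m 1 v + k)) (p.val r m) := by
  have e : (real p).val r m = if p.val r m % 16 < m 1 (p.val r m / 16 + 1) - m 1 (p.val r m / 16)
    then 1 else 0 := rfl
  simp only [flip, CutMatch.flip, Expr.val, val_place, e, nb, val_own]
  split_ifs <;> simp

/-- Initialization. -/
def init : Prog :=
  .seq (.assign 1 (read 0 (const 0))) <|
  .seq (.assign 2 (read 0 (const 1))) <|
  .seq (.assign 8 (mul (const 16) (reg 1))) <|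
  .seq (.assign 13 (mul (const 2) (reg 2))) <|
  .seq (.assign 16 (add (reg 13) (const 1))) <|
  .seq (.assign 10 (mul (const 4) (reg 2))) <|
  .seq (.assign 9 (div (read 1 (reg 1)) (mul (const 64) (mul (reg 2) (reg 2))))) <|
  .seq (.map (reg 8) 10 (flip (reg 0))) <|
  .seq (.map (reg 8) 12 (const 1)) <|
  .seq (.map (reg 8) 13 (reg 10)) <|
  .seq (.map (reg 1) 14 (mul (mul (read 3 (reg 0)) (sub (const 1) (read 4 (reg 0))))
    (lt (const 0) (deg (reg 0))))) <|
  .seq (.map (reg 1) 15 (mul (read 4 (reg 0)) (sub (const 1) (read 3 (reg 0))))) <|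
  .seq (.map (reg 1) 16 (mul (read 3 (reg 0)) (read 4 (reg 0))))
    (.vec (reg 1) (const 1) 9 (mul (reg 0) (reg 16)) (reg 0))

end Code

/-- The network at the beginning. -/
structure Initial {n : ℕ} (G : SimpleGraph (Fin n)) [DecidableRel G.Adj] (S T : Finset (Fin n))
    (P : Net) (mt : ℕ → ℕ) : Prop where
  size : P.n = n
  simple : P.Simple
  adj : ∀ p < 16 * n, P.rv p ≠ p → ∃ u v : Fin n, G.Adj u v ∧ p / 16 = u ∧ P.rv p / 16 = v
  dart : ∀ u v : Fin n, G.Adj u v → ∃ p < 16 * n, P.rv p ≠ p ∧ p / 16 = u ∧ P.rv p / 16 = v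
  card : P.edges.card = 2 * numEdges G
  src : ∀ v : Fin n, P.src v ≠ 0 ↔ v ∈ S ∧ v ∉ T ∧ 0 < G.degree v
  src_sum : ∑ v ∈ range n, P.src v ≤ P.edges.card
  fr : ∀ v : Fin n, P.fr v ≠ 0 ↔ v ∈ T ∧ v ∉ S
  mt : ∀ v : Fin n, mt v ≠ 0 ↔ v ∈ S ∧ v ∈ T

-- The last offset is `2 * numEdges G`, so the threshold for waiting units is one division. Isolated
-- vertices are excluded from the active sources, which bounds the number of active sources by the
-- number of darts (`src_sum`). Vertices of `S ∩ T` count as matched from the beginning, by paths of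
-- length `0`.
set_option maxHeartbeats 2000000 in
open Code Expr in
theorem Tc.init {w B A' n q : ℕ} {G : SimpleGraph (Fin n)} [DecidableRel G.Adj]
    {S T : Finset (Fin n)} {m : Mem} (hf : Fits w B Code.init) (h : IsInput G S T q m)
    (hdeg : ∀ v, G.degree v ≤ 16) (hB : 32 * n + 2 ≤ B) (hq : 64 * (q * q) ≤ B) (hq0 : 0 < q)
    (hA : 16 * n + 1 ≤ A') :
    Tc w Code.init (fun _ => 0) m A' 1 fun r' m' =>
      State B (mnet n m') (m' 16) (4 * q) (2 * q) (2 * numEdges G / (64 * (q * q))) 0 r' m' ∧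
      Initial G S T (mnet n m') (m' 16) ∧ m' 3 = m 3 ∧ r' 2 = q ∧ m' 1 = m 1 := by
  have hqq : q ≤ q * q := Nat.le_mul_self q
  have hA1 : 1 ≤ A' := by omega
  have hadj := h.adjacency hdeg
  have hb := h.bdd hdeg hB (by omega)
  refine (Tc.frame (Q := fun r' m' => Bdd B r' m' ∧ r' 1 = n ∧ r' 2 = q ∧ r' 8 = 16 * n ∧
    r' 13 = 2 * q ∧ r' 16 = 2 * q + 1 ∧ r' 10 = 4 * q ∧
    r' 9 = 2 * numEdges G / (64 * (q * q)) ∧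
    (∀ p < 16 * n, m' 10 p = CutMatch.flip (fun v => m 1 (v + 1) - m 1 v)
      (fun v k => m 2 (m 1 v + k)) p) ∧
    (∀ p < 16 * n, m' 12 p = 1) ∧ (∀ p < 16 * n, m' 13 p = 4 * q) ∧
    (∀ v < n, m' 14 v = m 3 v * (1 - m 4 v) * if 0 < m 1 (v + 1) - m 1 v then 1 else 0) ∧
    (∀ v < n, m' 15 v = m 4 v * (1 - m 3 v)) ∧ (∀ v < n, m' 16 v = m 3 v * m 4 v) ∧
    (∀ v < n, m' 9 (v * (2 * q + 1)) = v)) ?_).post ?_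
  · have hθ : 2 * numEdges G / (64 * (q * q)) ≤ B := by
      rw [← h.total]; exact (Nat.div_le_self _ _).trans (hb.2 _ _)
    unfold Code.init
    refine Tc.seq ((Tr.assign hf.left hb n (by simpa using h.size) (by omega)).toTc₁ hA1 le_rfl) ?_
    rintro _ _ ⟨rfl, rfl, hc0⟩
    have hf := hf.right
    refine Tc.seq ((Tr.assign hf.left hc0 q (by simpa using h.param) (by omega)).toTc₁ hA1 le_rfl) ?_
    rintro _ _ ⟨rfl, rfl, hc1⟩
    have hf := hf.right
    refine Tc.seq ((Tr.assign hf.left hc1 (16 * n) (by simp) (by omega)).toTc₁ hA1 le_rfl) ?_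
    rintro _ _ ⟨rfl, rfl, hc2⟩
    have hf := hf.right
    refine Tc.seq ((Tr.assign hf.left hc2 (2 * q) (by simp) (by omega)).toTc₁ hA1 le_rfl) ?_
    rintro _ _ ⟨rfl, rfl, hc3⟩
    have hf := hf.right
    refine Tc.seq ((Tr.assign hf.left hc3 (2 * q + 1) (by simp) (by omega)).toTc₁ hA1 le_rfl) ?_
    rintro _ _ ⟨rfl, rfl, hc4⟩
    have hf := hf.right
    refine Tc.seq ((Tr.assign hf.left hc4 (4 * q) (by simp) (by omega)).toTc₁ hA1 le_rfl) ?_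
    rintro _ _ ⟨rfl, rfl, hc5⟩
    have hf := hf.right
    refine Tc.seq ((Tr.assign hf.left hc5 (2 * numEdges G / (64 * (q * q)))
      (by simp [h.total]) hθ).toTc₁ hA1 le_rfl) ?_
    rintro r₀ m₀ ⟨hr₀, rfl, hb₀⟩
    have r1 : r₀ 1 = n := by simp [hr₀]
    have r2 : r₀ 2 = q := by simp [hr₀]
    have r8 : r₀ 8 = 16 * n := by simp [hr₀]
    have r13 : r₀ 13 = 2 * q := by simp [hr₀]
    have r16 : r₀ 16 = 2 * q + 1 := by simp [hr₀]
    have r10 : r₀ 10 = 4 * q := by simp [hr₀]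
    have r9 : r₀ 9 = 2 * numEdges G / (64 * (q * q)) := by simp [hr₀]
    clear hr₀
    have hf := hf.right
    refine Tc.seq ((Tr.map hf.left hb₀ (16 * n) r8 (by omega)
      (by simp [Code.flip, real, own, Code.nb, deg, Code.place]) _
      (fun p hp => val_flip _) (fun p hp => ?_)).toTc hA le_rfl) ?_
    · simp only [Expr.val, Function.update_self]
      have := hadj.flip_lt hp
      omega
    rintro _ m₁ ⟨rfl, hb₁, a10, -, f₁⟩
    have hf := hf.right
    refine Tc.seq ((Tr.map hf.left hb₁ (16 * n) r8 (by omega) (by simp) (fun _ => 1)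
      (fun _ _ => rfl) (fun _ _ => by omega)).toTc hA le_rfl) ?_
    rintro _ m₂ ⟨rfl, hb₂, a12, -, f₂⟩
    have hf := hf.right
    refine Tc.seq ((Tr.map hf.left hb₂ (16 * n) r8 (by omega) (by simp) (fun _ => 4 * q)
      (fun _ _ => by simp [r10]) (fun _ _ => by omega)).toTc hA le_rfl) ?_
    rintro _ m₃ ⟨rfl, hb₃, a13, -, f₃⟩
    have hf := hf.right
    have hm3 : ∀ v < n, m₀ 3 v ≤ 1 := fun v hv => by
      have := h.sources ⟨v, hv⟩
      simp only at this; rw [this]; split_ifs <;> omega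
    have hm4 : ∀ v < n, m₀ 4 v ≤ 1 := fun v hv => by
      have := h.sinks ⟨v, hv⟩
      simp only at this; rw [this]; split_ifs <;> omega
    have e3 : m₃ 3 = m₀ 3 := by rw [f₃ 3 (by decide), f₂ 3 (by decide), f₁ 3 (by decide)]
    have e4 : m₃ 4 = m₀ 4 := by rw [f₃ 4 (by decide), f₂ 4 (by decide), f₁ 4 (by decide)]
    have e1 : m₃ 1 = m₀ 1 := by rw [f₃ 1 (by decide), f₂ 1 (by decide), f₁ 1 (by decide)]
    refine Tc.seq ((Tr.map hf.left hb₃ n r1 (by omega) (by simp [deg])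
      (fun v => m₀ 3 v * (1 - m₀ 4 v) * if 0 < m₀ 1 (v + 1) - m₀ 1 v then 1 else 0)
      (fun v _ => by simp only [Expr.val, deg, Function.update_self, e3, e4, e1])
      (fun v hv => ?_)).toTc (by omega) le_rfl) ?_
    · have h2 : m₀ 3 v * (1 - m₀ 4 v) ≤ 1 * 1 := Nat.mul_le_mul (hm3 v hv) (by omega)
      split_ifs <;> omega
    rintro _ m₄ ⟨rfl, hb₄, a14, -, f₄⟩
    have hf := hf.right
    refine Tc.seq ((Tr.map hf.left hb₄ n r1 (by omega) (by simp)
      (fun v => m₀ 4 v * (1 - m₀ 3 v))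
      (fun v _ => by simp [f₄, e3, e4])
      (fun v hv => ?_)).toTc (by omega) le_rfl) ?_
    · have h2 : m₀ 4 v * (1 - m₀ 3 v) ≤ 1 * 1 := Nat.mul_le_mul (hm4 v hv) (by omega)
      omega
    rintro _ m₅ ⟨rfl, hb₅, a15, -, f₅⟩
    have hf := hf.right
    refine Tc.seq ((Tr.map hf.left hb₅ n r1 (by omega) (by simp)
      (fun v => m₀ 3 v * m₀ 4 v)
      (fun v _ => by simp [f₅, f₄, e3, e4])
      (fun v hv => ?_)).toTc (by omega) le_rfl) ?_
    · have h2 : m₀ 3 v * m₀ 4 v ≤ 1 * 1 := Nat.mul_le_mul (hm3 v hv) (hm4 v hv)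
      omega
    rintro _ m₆ ⟨rfl, hb₆, a16, -, f₆⟩
    refine ((Tr.gather hf.right hb₆ n r1 (by omega) (by simp) (by simp)
      (fun k => ∃ v < n, v * (2 * q + 1) = k) (fun k => k / (2 * q + 1))
      (fun v => v * (2 * q + 1)) (fun v _ => by simp [r16]) (fun v hv => ⟨v, hv, rfl⟩)
      (fun v _ => by simp) (fun k hk => hk)
      (fun i _ j _ e => Nat.eq_of_mul_eq_mul_right (by omega) e) ?_).toTc (by omega) le_rfl).post ?_
    · rintro _ ⟨v, hv, rfl⟩
      rw [Nat.mul_div_cancel _ (by omega)]; omega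
    rintro _ m₇ ⟨rfl, hb₇, a9, -, f₇⟩
    refine ⟨hb₇, r1, r2, r8, r13, r16, r10, r9, ?_, ?_, ?_, ?_, ?_, ?_, ?_⟩
    · intro p hp
      rw [f₇ 10 (by decide), f₆ 10 (by decide), f₅ 10 (by decide), f₄ 10 (by decide),
        f₃ 10 (by decide), f₂ 10 (by decide), a10 p hp]
      simp
    · intro p hp
      rw [f₇ 12 (by decide), f₆ 12 (by decide), f₅ 12 (by decide), f₄ 12 (by decide),
        f₃ 12 (by decide), a12 p hp]
    · intro p hp
      rw [f₇ 13 (by decide), f₆ 13 (by decide), f₅ 13 (by decide), f₄ 13 (by decide), a13 p hp]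
    · intro v hv
      rw [f₇ 14 (by decide), f₆ 14 (by decide), f₅ 14 (by decide), a14 v hv]
    · intro v hv
      rw [f₇ 15 (by decide), f₆ 15 (by decide), a15 v hv]
    · intro v hv
      rw [f₇ 16 (by decide), a16 v hv]
    · intro v hv
      rw [a9 _ ⟨v, hv, rfl⟩]
      exact Nat.mul_div_cancel _ (by omega)
  · rintro r' m' ⟨⟨hb', r1, r2, r8, r13, r16, r10, r9, a10, a12, a13, a14, a15, a16, a9⟩, f, g⟩
    have hm3 : ∀ v < n, m 3 v ≤ 1 := fun v hv => by
      have := h.sources ⟨v, hv⟩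
      simp only at this; rw [this]; split_ifs <;> omega
    have hm4 : ∀ v < n, m 4 v ≤ 1 := fun v hv => by
      have := h.sinks ⟨v, hv⟩
      simp only at this; rw [this]; split_ifs <;> omega
    have h14 : ∀ v < n, m' 14 v ≤ 1 := fun v hv => by
      have h1 := hm3 v hv
      rw [a14 v hv]
      have h2 : m 3 v * (1 - m 4 v) ≤ 1 * 1 := Nat.mul_le_mul h1 (by omega)
      split_ifs <;> omega
    have h14' : ∀ v < n, m' 14 v ≤ m 1 (v + 1) - m 1 v := fun v hv => by
      have := h14 v hv
      have h2 := a14 v hv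
      split_ifs at h2 with h3
      · omega
      · rw [mul_zero] at h2; omega
    have hsrc : ∀ v : Fin n, m' 14 v ≠ 0 ↔ v ∈ S ∧ v ∉ T ∧ 0 < G.degree v := fun v => by
      rw [a14 v v.2, h.sources v, h.sinks v, h.deg_eq v]
      split_ifs <;> simp_all
    have hfr : ∀ v : Fin n, m' 15 v ≠ 0 ↔ v ∈ T ∧ v ∉ S := fun v => by
      rw [a15 v v.2, h.sources v, h.sinks v]
      split_ifs <;> simp_all
    have hmt : ∀ v : Fin n, m' 16 v ≠ 0 ↔ v ∈ S ∧ v ∈ T := fun v => by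
      rw [a16 v v.2, h.sources v, h.sinks v]
      split_ifs <;> simp_all
    have hz : ∀ a, 5 ≤ a → a ∉ Code.init.arrays → ∀ i, m' a i = 0 := fun a ha ha' i => by
      rw [f a ha']; exact h.rest a i ha
    have hrv : ∀ p < 16 * n, (mnet n m').rv p = CutMatch.flip (fun v => m 1 (v + 1) - m 1 v)
      (fun v k => m 2 (m 1 v + k)) p := a10
    have hcard := hadj.card_edges rfl hrv
    have hwf : (mnet n m').WF := by
      refine ⟨?_, ?_, ?_, ?_, ?_, ?_, h14, ?_, ?_, ?_⟩
      · intro p hp; rw [hrv p hp]; exact hadj.flip_lt hp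
      · intro p hp
        rw [hrv p hp, hrv _ (hadj.flip_lt hp)]; exact hadj.flip_flip hp
      · intro p hp; change 0 < m' 12 p; rw [a12 p hp]; omega
      · intro p hp
        rw [hrv p hp]
        change m' 12 _ = m' 12 p
        rw [a12 p hp, a12 _ (hadj.flip_lt hp)]
      · intro p hp; change 0 < m' 13 p; rw [a13 p hp]; omega
      · intro p hp
        rw [hrv p hp]
        change m' 13 _ = m' 13 p
        rw [a13 p hp, a13 _ (hadj.flip_lt hp)]
      · intro v hv
        change m' 15 v ≤ 1
        rw [a15 v hv]
        have h2 : m 4 v * (1 - m 3 v) ≤ 1 * 1 := Nat.mul_le_mul (hm4 v hv) (by omega)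
        omega
      · intro v _ _; exact hz 11 (by decide) (by decide) v
      · intro p _
        change m' 11 _ ≤ _
        rw [hz 11 (by decide) (by decide)]; omega
    refine ⟨⟨hb', r1, r8, r9, r10, r13, r16, fun p _ => hz 25 (by decide) (by decide) p,
      fun p _ => hz 26 (by decide) (by decide) p, ?_⟩, ⟨rfl, hadj.simple rfl hrv, ?_, ?_, ?_, hsrc,
      ?_, hfr, hmt⟩, f 3 (by decide), r2, f 1 (by decide)⟩
    · refine Net.Good.init (C := mrec (2 * q + 1) m') hwf
        (fun v _ => hz 11 (by decide) (by decide) v) a12 a13 ?_ ?_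
        (fun v _ => hz 35 (by decide) (by decide) v) a9
      · intro v hv
        change m' 16 v ≤ 1
        rw [a16 v hv]
        exact Nat.mul_le_mul (hm3 v hv) (hm4 v hv)
      · intro v hv hne
        have h1 := (hmt ⟨v, hv⟩).1 hne
        by_contra h2
        exact ((hsrc ⟨v, hv⟩).1 h2).2.1 h1.2
    · intro p hp hne
      rw [hrv p hp] at hne ⊢
      obtain ⟨h1, h2⟩ := hadj.of_flip_ne hp hne
      have hv : p / 16 < n := by omega
      have h3 := h.deg_eq ⟨p / 16, hv⟩
      simp only at h3
      obtain ⟨u, hu, e⟩ := h.list_adj ⟨p / 16, hv⟩ (p % 16) (by omega)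
      exact ⟨⟨p / 16, hv⟩, u, hu, rfl, h2.trans e⟩
    · intro u v huv
      obtain ⟨i, hi, e⟩ := h.list_all u v huv
      rw [← h.deg_eq u] at hi
      have h1 := hadj.flip_ne u.2 hi
      have h2 := hadj.deg_le u u.2
      beta_reduce at h2
      have hu := u.2
      have hp : 16 * (u : ℕ) + i < 16 * n := by omega
      refine ⟨16 * u + i, hp, ?_, by omega, ?_⟩
      · rw [hrv _ hp]; exact h1.1
      · rw [hrv _ hp, h1.2]; exact e
    · rw [hcard, ← h.offset_eq le_rfl, h.total]
    · rw [hcard]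
      exact sum_le_sum fun v hv => h14' v (mem_range.1 hv)

end CutMatch

/-! ### Choice of a level, output, and the complete program -/

namespace CutMatch

open Finset ParRAM

/-- Number of darts that leave the set of vertices of height at least `l`. -/
def levelCut (P : Net) (l : ℕ) : ℕ :=
  ∑ p ∈ range (16 * P.n), (if l ≤ P.h (p / 16) then 1 else 0) *
    (1 - if l ≤ P.h (P.rv p / 16) then 1 else 0)

/-- `b` is a level `1, ..., i` with small cut, or `0` if there is none. -/
structure Best (P : Net) (D M i b : ℕ) : Prop where
  le : b ≤ i
  small : b ≠ 0 → levelCut P b * D ≤ M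
  none : b = 0 → ∀ l < i, M < levelCut P (l + 1) * D

theorem levelCut_le (P : Net) (l : ℕ) : levelCut P l ≤ 16 * P.n := by
  calc _ ≤ ∑ p ∈ range (16 * P.n), 1 := sum_le_sum fun p _ => by split_ifs <;> omega
    _ = _ := by simp

namespace Code

open Expr

/-- Whether a level is not suitable. -/
def bad : Expr := lt (read 1 (reg 1)) (mul (reg 7) (reg 13))

/-- The cut of a level is examined. -/
def level : Prog :=
  .seq (.map (reg 8) 27 (mul (lt (reg 14) (read 11 (own (reg 0))))
    (sub (const 1) (lt (reg 14) (read 11 (tgt (reg 0))))))) <|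
  .seq (.assign 5 (reg 8)) <|
  .seq .scan
    (.assign 15 (add (mul bad (reg 15)) (mul (sub (const 1) bad) (add (reg 14) (const 1)))))

/-- A level with small cut is selected. -/
def levels : Prog := .seq (.assign 15 (const 0)) (.forTo 14 (reg 13) level)

/-- The output is written. -/
def output : Prog :=
  .seq (.map (reg 1) 5 (sub (const 1) (mul (lt (read 11 (reg 0)) (reg 15))
    (sub (const 1) (mul (read 3 (reg 0)) (sub (const 1) (read 16 (reg 0)))))))) <|
  .seq (.map (reg 1) 27 (read 16 (reg 0))) <|
  .seq (.assign 5 (reg 1)) <|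
  .seq .scan <|
  .seq (.vec (reg 1) (read 16 (reg 0)) 7 (sub (read 27 (reg 0)) (const 1))
    (mul (reg 0) (reg 16))) <|
  .seq (.vec (reg 1) (read 16 (reg 0)) 8 (sub (read 27 (reg 0)) (const 1)) (read 35 (reg 0)))
    (.map (const 1) 6 (reg 7))

/-- The algorithm. -/
def main : Prog := .seq init (.seq (.forTo 11 (reg 13) phase) (.seq levels output))

end Code

set_option maxHeartbeats 1000000 in
open Code Expr in
theorem Tc.levels {w B D n A A' L L' r m} {P : Net} (hf : Fits w B levels) (hb : Bdd B r m)
    (hP : mnet n m = P) (h1 : r 1 = n) (h8 : r 8 = 16 * n) (h13 : r 13 = D)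
    (hB : 32 * n + 2 ≤ B) (hD : D + 1 ≤ B) (hL : Nat.clog 2 (16 * n) + 2 ≤ L)
    (hA : (16 * n + 1) * L ≤ A) (hA' : (D + 1) * (A + 1) ≤ A') (hL' : (D + 1) * (L + 1) ≤ L') :
    Tc w levels r m A' L' fun r' m' => Bdd B r' m' ∧ Best P D (m 1 n) D (r' 15) ∧
      (∀ a, a ≠ 27 → a ≠ 28 → m' a = m a) ∧
      ∀ x, x < 5 ∨ x = 8 ∨ x = 16 → r' x = r x := by
  have hA'1 : 1 ≤ A' := by nlinarith
  have hL'1 : 1 ≤ L' := by nlinarith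
  have hA1 : 16 * n + 1 ≤ A := by nlinarith
  have hA0 : 1 ≤ A := by omega
  have hL1 : 1 ≤ L := by omega
  refine (Tc.frame (Q := fun r' m' => Bdd B r' m' ∧ Best P D (m 1 n) D (r' 15)) ?_).post ?_
  · unfold Code.levels
    refine Tc.seq ((Tr.assign hf.left hb 0 rfl (by omega)).toTc₁ hA'1 hL'1) ?_
    rintro _ m₀ ⟨rfl, rfl, hb₀⟩
    refine (Tc.forTo hf.right D (by omega) (fun i r' m' => Bdd B r' m' ∧ r' 14 = i ∧
      (∀ a, a ≠ 27 → a ≠ 28 → m' a = m₀ a) ∧ r' 1 = n ∧ r' 8 = 16 * n ∧ r' 13 = D ∧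
      Best P D (m₀ 1 n) i (r' 15)) A L ?_ ?_ ?_ ?_ _ m₀ hb₀ ?_ hA' hL').post ?_
    · rintro t r' m' ⟨h, -⟩; exact h
    · rintro t r' m' ⟨-, h, -⟩; exact h
    · rintro t r' m' ⟨-, -, -, -, -, h, -⟩; exact h
    · rintro i r' m' hi ⟨hb', h14, f, h1', h8', h13', hbest⟩
      have hf : Fits w B level := hf.right.of_le (by rw [Prog.size_forTo]; omega)
      have hP' : mnet n m' = P := by
        rw [← hP]
        simp only [mnet, f 10 (by decide) (by decide), f 11 (by decide) (by decide),
          f 12 (by decide) (by decide), f 13 (by decide) (by decide), f 14 (by decide) (by decide),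
          f 15 (by decide) (by decide)]
      have e10 : m' 10 = P.rv := by rw [← hP']; rfl
      have e11 : m' 11 = P.h := by rw [← hP']; rfl
      have hn : P.n = n := by rw [← hP]; rfl
      set g : ℕ → ℕ := fun p => (if i + 1 ≤ P.h (p / 16) then 1 else 0) *
        (1 - if i + 1 ≤ P.h (P.rv p / 16) then 1 else 0) with hg
      have hcut : ∑ p ∈ range (16 * n), g p = levelCut P (i + 1) := by rw [levelCut, hn]
      have hle := levelCut_le P (i + 1)
      rw [hn] at hle
      unfold Code.level
      refine Tc.seq ((Tr.map hf.left hb' (16 * n) h8' (by omega) (by simp [own, tgt]) g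
        (fun p hp => ?_) (fun p hp => ?_)).toTc hA1 hL1) ?_
      · simp only [Expr.val, val_own, val_tgt, Function.update_self, e10, e11, hg]
        simp only [ne_eq, OfNat.ofNat_ne_zero, not_false_eq_true, Function.update_of_ne, h14,
          Nat.succ_le_iff]
      · simp only [hg]; split_ifs <;> omega
      rintro r₁ m₁ ⟨rfl, hb₁, a27, -, f₁⟩
      have hf := hf.right
      refine Tc.seq ((Tr.assign hf.left hb₁ (16 * n) (by simpa using h8') (by omega)).toTc₁
        hA0 hL1) ?_
      rintro _ m₂ ⟨rfl, rfl, hb₂⟩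
      have hf := hf.right
      refine Tc.seq (Tc.scan hf.left hb₂ (16 * n) (by simp) (by omega) g a27 (by omega) (A := A)
        (L := L) (by omega) hA) ?_
      rintro r₃ m₃ ⟨hb₃, -, t7, f₃, g₃⟩
      have k₃ : ∀ x, x ≠ 5 → x ≠ 6 → x ≠ 7 → r₃ x = r₁ x := fun x h5 h6 h7 => by
        rw [g₃ x h6 h7]; simp [h5]
      have e1 : m₃ 1 = m₀ 1 := by
        rw [f₃ 1 (by decide) (by decide), f₁ 1 (by decide), f 1 (by decide) (by decide)]
      have e15 : r₃ 15 ≤ B := hb₃.1 15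
      refine ((Tr.assign hf.right hb₃
        (if m₀ 1 n < levelCut P (i + 1) * D then r₁ 15 else i + 1) ?_ ?_).toTc₁ hA0 hL1).post ?_
      · simp only [bad, Expr.val, t7, hcut, e1, k₃ 1 (by decide) (by decide) (by decide), h1',
          k₃ 13 (by decide) (by decide) (by decide), h13', k₃ 14 (by decide) (by decide) (by decide),
          h14, k₃ 15 (by decide) (by decide) (by decide)]
        split_ifs <;> simp
      · rw [← k₃ 15 (by decide) (by decide) (by decide)]
        split_ifs <;> omega
      rintro _ m₄ ⟨rfl, rfl, hb₄⟩
      have hinv : Bdd B (Function.update (Function.update r₃ 15 (if m₀ 1 n < levelCut P (i + 1) * D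
          then r₁ 15 else i + 1)) 14 (i + 1)) m₄ := hb₄.update_reg (by omega)
      refine ⟨?_, hb₄, hinv, by simp, ?_, ?_, ?_, ?_, ?_⟩
      · simp [k₃ 14 (by decide) (by decide) (by decide), h14]
      · intro a h27 h28; rw [f₃ a h27 h28, f₁ a h27, f a h27 h28]
      · simp [k₃ 1 (by decide) (by decide) (by decide), h1']
      · simp [k₃ 8 (by decide) (by decide) (by decide), h8']
      · simp [k₃ 13 (by decide) (by decide) (by decide), h13']
      -- Iteration `i` examines level `i + 1`, so `0` remains free to signal that no suitable level
      -- has been found.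
      · change Best P D (m₀ 1 n) (i + 1) (if m₀ 1 n < levelCut P (i + 1) * D then r₁ 15 else i + 1)
        split_ifs with hlt
        · refine ⟨hbest.le.trans (by omega), hbest.small, fun h0 l hl => ?_⟩
          rcases (show l < i ∨ l = i by omega) with hl | rfl
          · exact hbest.none h0 l hl
          · exact hlt
        · exact ⟨le_rfl, fun _ => by omega, fun h0 => by omega⟩
    · exact ⟨hb₀.update_reg (by omega), by simp, fun _ _ _ => rfl, by simpa using h1,
        by simpa using h8, by simpa using h13,
        ⟨by simp, by simp, fun _ l hl => by omega⟩⟩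
    · rintro r' m' ⟨hb', -, -, -, -, -, hbest⟩
      exact ⟨hb', hbest⟩
  · rintro r' m' ⟨⟨h1, h2⟩, h3, h4⟩
    refine ⟨h1, h2, fun a h h' => h3 a ?_, fun x hx => h4 x ?_⟩
    · simp [Code.levels, Code.level, Prog.forTo, Prog.scan, Prog.scanStep, Prog.map, Prog.vec,
        Prog.arrays, h, h']
    · simp only [Code.levels, Code.level, Prog.forTo, Prog.scan, Prog.scanStep, Prog.map, Prog.vec,
        Prog.registers, List.mem_append, List.mem_singleton, List.not_mem_nil,
        false_or, or_false]
      omega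

set_option maxHeartbeats 1000000 in
open Code Expr in
theorem Tc.output {w B n σ b A' L r m} (hf : Fits w B output) (hb : Bdd B r m)
    (h1 : r 1 = n) (h15 : r 15 = b) (h16 : r 16 = σ) (hB : 32 * n + 2 ≤ B) (hσ : n * σ ≤ B)
    (hmt : ∀ v < n, m 16 v ≤ 1)
    (hL : Nat.clog 2 (16 * n) + 2 ≤ L) (hA : (16 * n + 1) * L ≤ A') :
    Tc w output r m A' L fun _ m' =>
      (∀ v < n, m' 5 v = 1 - (if m 11 v < b then 1 else 0) * (1 - m 3 v * (1 - m 16 v))) ∧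
      m' 6 0 = ∑ v ∈ range n, m 16 v ∧
      (∀ v < n, m 16 v ≠ 0 → m' 7 (pre (m 16) v - 1) = v * σ) ∧
      (∀ v < n, m 16 v ≠ 0 → m' 8 (pre (m 16) v - 1) = m 35 v) ∧ m' 9 = m 9 := by
  have hA1 : 16 * n + 1 ≤ A' := by nlinarith
  have hA0 : 1 ≤ A' := by omega
  have hL1 : 1 ≤ L := by omega
  have hsum : ∑ v ∈ range n, m 16 v ≤ n := by
    calc _ ≤ ∑ v ∈ range n, 1 := sum_le_sum fun v hv => hmt v (mem_range.1 hv)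
      _ = _ := by simp
  have hclog : Nat.clog 2 n ≤ Nat.clog 2 (16 * n) := Nat.clog_mono_right 2 (by omega)
  unfold Code.output
  refine Tc.seq ((Tr.map hf.left hb n h1 (by omega) (by simp)
    (fun v => 1 - (if m 11 v < b then 1 else 0) * (1 - m 3 v * (1 - m 16 v)))
    (fun v hv => by simp [h15]) (fun v hv => by omega)).toTc (by omega) hL1) ?_
  rintro _ m₁ ⟨rfl, hb₁, a5, -, f₁⟩
  have hf := hf.right
  refine Tc.seq ((Tr.map hf.left hb₁ n h1 (by omega) (by simp) (m 16)
    (fun v hv => by simp [f₁]) (fun v hv => hb.2 16 v)).toTc (by omega) hL1) ?_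
  rintro _ m₂ ⟨rfl, hb₂, a27, -, f₂⟩
  have hf := hf.right
  refine Tc.seq ((Tr.assign hf.left hb₂ n (by simpa using h1) (by omega)).toTc₁ hA0 hL1) ?_
  rintro _ m₃ ⟨rfl, rfl, hb₃⟩
  have hf := hf.right
  refine Tc.seq (Tc.scan hf.left hb₃ n (by simp) (by omega) _ a27 (by omega) (A := A')
    (L := L) (by omega) ((Nat.mul_le_mul_right _ (by omega)).trans hA)) ?_
  rintro r₄ m₄ ⟨hb₄, b27, t7, f₄, g₄⟩
  have e16 : m₄ 16 = m 16 := by rw [f₄ 16 (by decide) (by decide), f₂ 16 (by decide), f₁ 16 (by decide)]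
  have e35 : m₄ 35 = m 35 := by rw [f₄ 35 (by decide) (by decide), f₂ 35 (by decide), f₁ 35 (by decide)]
  have e9 : m₄ 9 = m 9 := by rw [f₄ 9 (by decide) (by decide), f₂ 9 (by decide), f₁ 9 (by decide)]
  have r1 : r₄ 1 = n := by rw [g₄ 1 (by decide) (by decide)]; simpa using h1
  have r16 : r₄ 16 = σ := by rw [g₄ 16 (by decide) (by decide)]; simpa using h16
  have hf := hf.right
  refine Tc.seq ((Tr.compact hf.left hb₄ n r1 (by omega) (by decide) (by simp) (by simp) (m 16)
    (fun v => v * σ) hmt (fun v hv => by simp [e16]) b27 (fun v hv _ => by simp [r16])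
    (fun v hv => (Nat.mul_le_mul_right _ hv.le).trans hσ)).toTc (by omega) hL1) ?_
  rintro _ m₅ ⟨rfl, hb₅, f₅, a7, -⟩
  have hf := hf.right
  refine Tc.seq ((Tr.compact hf.left hb₅ n r1 (by omega) (by decide) (by simp) (by simp) (m 16)
    (m 35) hmt (fun v hv => by simp [f₅, e16]) (fun v hv => by rw [f₅ 27 (by decide), b27 v hv])
    (fun v hv _ => by simp [f₅, e35]) (fun v hv => hb.2 35 v)).toTc (by omega) hL1) ?_
  rintro _ m₆ ⟨rfl, hb₆, f₆, a8, -⟩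
  refine ((Tr.map hf.right hb₆ 1 rfl (by omega) (by simp) (fun _ => ∑ v ∈ range n, m 16 v)
    (fun v hv => by simp [t7]) (fun v hv => by omega)).toTc (n := 1 + 1) ?_ hL1).post ?_
  · rcases Nat.eq_zero_or_pos n with h0 | h0
    · nlinarith
    · omega
  rintro _ m₇ ⟨rfl, -, a6, -, f₇⟩
  refine ⟨fun v hv => ?_, a6 0 (by decide), fun v hv h0 => ?_, fun v hv h0 => ?_, ?_⟩
  · rw [f₇ 5 (by decide), f₆ 5 (by decide), f₅ 5 (by decide), f₄ 5 (by decide) (by decide),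
      f₂ 5 (by decide), a5 v hv]
  · rw [f₇ 7 (by decide), f₆ 7 (by decide), a7 v hv h0]
  · rw [f₇ 8 (by decide), a8 v hv h0]
  · rw [f₇ 9 (by decide), f₆ 9 (by decide), f₅ 9 (by decide), e9]

/-- What the algorithm leaves behind. -/
structure Final {n : ℕ} (G : SimpleGraph (Fin n)) [DecidableRel G.Adj] (S T : Finset (Fin n))
    (q : ℕ) (P₀ : Net) (mt₀ : ℕ → ℕ) (P : Net) (C : Rec) (b : ℕ) (m : Mem) : Prop where
  start : Initial G S T P₀ mt₀
  good : Net.Good P₀ mt₀ (4 * q) (2 * q) (2 * numEdges G / (64 * (q * q))) (2 * q) P C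
  best : Best P (2 * q) (2 * numEdges G) (2 * q) b
  cut : ∀ v : Fin n, m 5 v = if b ≤ P.h v ∨ (v ∈ S ∧ C.mt v = 0) then 1 else 0
  count : m 6 0 = ∑ v ∈ range n, C.mt v
  offset : ∀ v < n, C.mt v ≠ 0 → m 7 (pre C.mt v - 1) = v * (2 * q + 1)
  length : ∀ v < n, C.mt v ≠ 0 → m 8 (pre C.mt v - 1) = C.len v
  vertex : ∀ v k, m 9 (v * (2 * q + 1) + k) = C.row v k

-- Up to the size of the code, `A` and `Z` bound work and span of a single phase. They also cover
-- the inspection of one level, so both loops of `2 * q` iterations fit into the same total.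
set_option maxHeartbeats 1000000 in
open Code Expr in
theorem Tc.main {w B A' L L' n q : ℕ} {G : SimpleGraph (Fin n)} [DecidableRel G.Adj]
    {S T : Finset (Fin n)} {m : Mem} (hf : Fits w B Code.main) (h : IsInput G S T q m)
    (hdeg : ∀ v, G.degree v ≤ 16) (hB : 32 * n + 2 ≤ B) (hq : 64 * (q * q) + 2 ≤ B) (hq0 : 0 < q)
    (hnq : n * (2 * q + 1) ≤ B) (hL : Nat.clog 2 (16 * n) + 2 ≤ L)
    (hA' : (2 * q + 1) * (17 * L * ((8 * q + 1) * (2 * numEdges G)) +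
      (16 * n + 2) * L * (2 * q + 1) + 2) ≤ A')
    (hL' : (2 * q + 1) * (L * ((8 * q + 1) * (64 * (q * q))) + 2 * L * (2 * q + 1) + 2) ≤ L') :
    Tc w Code.main (fun _ => 0) m A' L' fun _ m' => ∃ P₀ mt₀ P C b,
      Final G S T q P₀ mt₀ P C b m' := by
  have hqq : q ≤ q * q := Nat.le_mul_self q
  have hL2 : 2 ≤ L := by omega
  set X := 17 * L * ((8 * q + 1) * (2 * numEdges G)) with hX
  set A := X + (16 * n + 2) * L * (2 * q + 1) + 1 with hA
  set Y := L * ((8 * q + 1) * (64 * (q * q))) with hY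
  set Z := Y + 2 * L * (2 * q + 1) + 1 with hZ
  have a1 : (16 * n + 1) * L ≤ A := by
    have : (16 * n + 2) * L * 1 ≤ (16 * n + 2) * L * (2 * q + 1) := Nat.mul_le_mul_left _ (by omega)
    nlinarith
  have a2 : (2 * q + 1) * (16 * n + 2) ≤ A := by
    have : (16 * n + 2) * 1 * (2 * q + 1) ≤ (16 * n + 2) * L * (2 * q + 1) :=
      Nat.mul_le_mul_right _ (Nat.mul_le_mul_left _ (by omega))
    have e : (2 * q + 1) * (16 * n + 2) = (16 * n + 2) * 1 * (2 * q + 1) := by ring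
    omega
  have a3 : 16 * n + 1 ≤ A := by nlinarith
  have a4 : A ≤ A' := (by nlinarith : A ≤ (2 * q + 1) * (A + 1)).trans hA'
  have z1 : L ≤ Z := by nlinarith
  have z2 : 2 * (2 * q + 1) ≤ Z := by nlinarith
  have z3 : Z ≤ L' := (by nlinarith : Z ≤ (2 * q + 1) * (Z + 1)).trans hL'
  unfold Code.main
  refine Tc.seq ((Tc.init hf.left h hdeg hB (by omega) hq0 a3).mono (Nat.mul_le_mul_left _ a4)
    (Nat.mul_le_mul_left _ (by omega)) fun _ _ h => h) ?_
  rintro r₀ m₀ ⟨hst, hinit, e3, r2, e1⟩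
  have hf := hf.right
  set P₀ := mnet n m₀ with hP₀
  have hn : P₀.n = n := rfl
  have hdis : ∀ v < P₀.n, m₀ 16 v ≠ 0 → P₀.src v = 0 := by
    intro v hv hne
    have h1 := (hinit.mt ⟨v, hv⟩).1 hne
    by_contra h2
    exact ((hinit.src ⟨v, hv⟩).1 h2).2.1 h1.2
  refine Tc.seq (Tc.forTo hf.left (2 * q) (by omega) (fun i r' m' => r' 11 = i ∧
    State B P₀ (m₀ 16) (4 * q) (2 * q) (2 * numEdges G / (64 * (q * q))) i r' m' ∧
    (∀ a < 5, m' a = m₀ a)) A Z ?_ ?_ ?_ ?_ r₀ m₀ hst.bdd ?_ hA' hL') ?_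
  · rintro i r' m' ⟨-, h, -⟩; exact h.bdd
  · rintro i r' m' ⟨h, -⟩; exact h
  · rintro i r' m' ⟨-, h, -⟩; exact h.r13
  · rintro i r' m' hi ⟨r11, h', f⟩
    refine (Tc.frame (Tc.phase (L := L) (R := 64 * (q * q))
      (hf.left.of_le (by rw [Prog.size_forTo]; omega)) h' hi hB (by omega) (by omega) (by omega)
      hdis hinit.simple hinit.src_sum ?_ hL ?_ a1 a2 ?_ z1 z2)).post ?_
    -- With `θ = 2m / (64 q²)` rounded down, `2m < 64 q² * (θ + 1)`, so `R = 64 q²` works.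
    · rw [hinit.card, mul_comm (_ + 1)]
      exact (Nat.lt_mul_div_succ _ (show 0 < 64 * (q * q) by positivity)).le
    · rw [hinit.card, show 2 * (4 * q) + 1 = 8 * q + 1 by ring]
      omega
    · rw [show 2 * (4 * q) + 1 = 8 * q + 1 by ring]
      omega
    · rintro r₁ m₁ ⟨⟨h₁, g₁⟩, f₁, -⟩
      have hbd : Bdd B (Function.update r₁ 11 (i + 1)) m₁ := h₁.bdd.update_reg (by omega)
      refine ⟨by rw [g₁ 11 (by decide), r11], h₁.bdd, by simp, ⟨hbd, ?_, ?_, ?_, ?_, ?_, ?_, h₁.aF,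
        h₁.aR, h₁.good⟩, fun a ha => ?_⟩
      · simpa using h₁.r1
      · simpa using h₁.r8
      · simpa using h₁.r9
      · simpa using h₁.r10
      · simpa using h₁.r13
      · simpa using h₁.r16
      · rw [f₁ a (by interval_cases a <;> decide), f a ha]
  · have hbd : Bdd B (Function.update r₀ 11 0) m₀ := hst.bdd.update_reg (by omega)
    refine ⟨by simp, ⟨hbd, ?_, ?_, ?_, ?_, ?_, ?_, hst.aF, hst.aR, hst.good⟩, fun _ _ => rfl⟩
    · simpa using hst.r1
    · simpa using hst.r8
    · simpa using hst.r9
    · simpa using hst.r10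
    · simpa using hst.r13
    · simpa using hst.r16
  rintro r₁ m₁ ⟨-, hs₁, f₁⟩
  have hf := hf.right
  refine Tc.seq (Tc.levels (A := A) (L := L) (n := n) hf.left hs₁.bdd rfl hs₁.r1 hs₁.r8 hs₁.r13 hB
    (by omega) hL a1 hA' ((Nat.mul_le_mul_left _ (by omega)).trans hL')) ?_
  rintro r₂ m₂ ⟨hb₂, hbest, f₂, g₂⟩
  have e16 : m₂ 16 = m₁ 16 := f₂ 16 (by decide) (by decide)
  refine ((Tc.output (n := n) (σ := 2 * q + 1) (b := r₂ 15) (L := L) hf.right hb₂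
    (by rw [g₂ 1 (by decide)]; exact hs₁.r1) rfl (by rw [g₂ 16 (by decide)]; exact hs₁.r16) hB hnq
    (by rw [e16]; exact hs₁.good.mt_le) hL (a1.trans a4)).mono le_rfl
    (Nat.mul_le_mul_left _ (z1.trans z3)) fun r₃ m₃ hpost => ?_)
  obtain ⟨a5, a6, a7, a8, e9⟩ := hpost
  have k3 : m₂ 3 = m 3 := by
    rw [f₂ 3 (by decide) (by decide), f₁ 3 (by decide), e3]
  rw [e16] at a5 a6 a7 a8
  rw [f₂ 35 (by decide) (by decide)] at a8
  rw [f₂ 11 (by decide) (by decide), k3] at a5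
  rw [f₁ 1 (by decide), e1, h.total] at hbest
  refine ⟨P₀, m₀ 16, mnet n m₁, mrec (2 * q + 1) m₁, r₂ 15, hinit, hs₁.good, hbest, fun v => ?_,
    a6, a7, a8, fun v k => ?_⟩
  · rw [a5 v v.2, h.sources v]
    have h1 : m₁ 16 v ≤ 1 := hs₁.good.mt_le v v.2
    change _ = if r₂ 15 ≤ m₁ 11 v ∨ v ∈ S ∧ m₁ 16 v = 0 then 1 else 0
    by_cases hv : v ∈ S
    · rcases (show m₁ 16 v = 0 ∨ m₁ 16 v = 1 by omega) with h2 | h2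
      · simp [hv, h2]
      · by_cases h3 : m₁ 11 v < r₂ 15
        · simp [hv, h2, h3]
        · simp [hv, h2, h3, show r₂ 15 ≤ m₁ 11 v by omega]
    · by_cases h3 : m₁ 11 v < r₂ 15
      · simp [hv, h3]
      · simp [hv, h3, show r₂ 15 ≤ m₁ 11 v by omega]
  · change m₃ 9 _ = m₁ 9 _
    rw [e9, f₂ 9 (by decide) (by decide)]

end CutMatch

/-! ### The sparse level cut and the list of paths -/

namespace CutMatch

open Finset ParRAM

/-- The summand is `1` exactly for the levels `l + 1` in `(b, a]`, all of which are at most `D`. -/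
theorem sum_ind_le (a D : ℕ) (h : a ≤ D) (b : ℕ) :
    ∑ l ∈ range D, (if l + 1 ≤ a then 1 else 0) * (1 - if l + 1 ≤ b then 1 else 0) = a - b := by
  calc _ = ∑ l ∈ range D, if l ∈ Ico b a then 1 else 0 := by
        refine sum_congr rfl fun l _ => ?_
        simp only [mem_Ico]
        split_ifs <;> omega
    _ = ((range D).filter fun l => l ∈ Ico b a).card := (card_filter _ _).symm
    _ = (Ico b a).card := by
        congr 1
        ext l
        simp only [mem_filter, mem_range, mem_Ico]
        omega
    _ = a - b := Nat.card_Ico b a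

/-- A dart leaves as many level sets as its drop in height. Of the two darts of an edge at most one
drops, by at most the length because of `valid`. The sum over darts sees every edge twice, hence the
factor `2`. -/
theorem sum_levelCut_le {P : Net} (hP : P.WF) {D : ℕ} (hD : ∀ v < P.n, P.h v ≤ D) :
    2 * ∑ l ∈ range D, levelCut P (l + 1) ≤ ∑ p ∈ P.edges, P.ell p := by
  have e : ∑ l ∈ range D, levelCut P (l + 1) =
      ∑ p ∈ P.edges, (P.h (p / 16) - P.h (P.rv p / 16)) := by
    simp only [levelCut]
    rw [sum_comm, Net.edges, sum_filter]
    refine sum_congr rfl fun p hp => ?_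
    rw [mem_range] at hp
    rw [sum_ind_le _ _ (hD _ (by omega))]
    split_ifs with h
    · rfl
    · rw [not_not.1 h]; omega
  rw [e, two_mul]
  nth_rw 1 [← Net.sum_rv hP]
  rw [← sum_add_distrib]
  refine sum_le_sum fun p hp => ?_
  have hp := (Net.mem_edges.1 hp).1
  have h1 := hP.valid p hp
  have h2 := hP.valid _ (hP.rv_lt p hp)
  rw [hP.ell_rv p hp] at h2
  rw [hP.rv_rv p hp] at h2 ⊢
  omega

theorem exists_walk {V : Type*} {G : SimpleGraph V} (l : ℕ) (f : ℕ → V)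
    (h : ∀ k < l, G.Adj (f k) (f (k + 1))) :
    ∃ p : G.Walk (f 0) (f l), p.length = l ∧ ∀ k ≤ l, p.getVert k = f k := by
  induction l generalizing f with
  | zero => exact ⟨.nil, rfl, fun k hk => by rw [Nat.le_zero.1 hk]; rfl⟩
  | succ l ih =>
    obtain ⟨p, h1, h2⟩ := ih (fun k => f (k + 1)) fun k hk => h (k + 1) (by omega)
    refine ⟨.cons (h 0 (by omega)) p, by simp [h1], fun k hk => ?_⟩
    cases k with
    | zero => rfl
    | succ k => simpa using h2 k (by omega)

variable {n : ℕ} {G : SimpleGraph (Fin n)} [DecidableRel G.Adj] {S T : Finset (Fin n)} {q : ℕ}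
  {P₀ P : Net} {mt₀ : ℕ → ℕ} {C : Rec} {b : ℕ} {m : Mem}

namespace Final

theorem size (h : Final G S T q P₀ mt₀ P C b m) : P.n = n := h.good.n.trans h.start.size

theorem edges (h : Final G S T q P₀ mt₀ P C b m) : P.edges.card = 2 * numEdges G := by
  rw [← h.start.card]
  simp only [Net.edges, h.good.n, h.good.rv]

/-- Since `z ≤ c`, the weight dominates `c * ∑ ell`. The invariant bounds it by `c` times the number
of darts plus `2D` times the number of sources, where `2D = c = 4q` and there are at most as many
sources as darts. -/
theorem sum_ell (h : Final G S T q P₀ mt₀ P C b m) (hq : 0 < q) :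
    ∑ p ∈ P.edges, P.ell p ≤ 2 * (2 * numEdges G) := by
  have h1 := h.good.weight
  have h2 : ∑ p ∈ P.edges, 4 * q * P.ell p ≤ ∑ p ∈ P.edges, (2 * (4 * q) - P.z p) * P.ell p :=
    sum_le_sum fun p hp => Nat.mul_le_mul_right _ (by
      have := h.good.z_le p (Net.mem_edges.1 hp).1
      omega)
  have h3 := h.start.src_sum
  rw [h.start.card] at h3
  rw [← mul_sum] at h2
  rw [h.edges, h.size] at h1
  have h4 := Nat.mul_le_mul_left (2 * (2 * q)) h3
  have h5 : 4 * q * ∑ p ∈ P.edges, P.ell p ≤ 4 * q * (2 * (2 * numEdges G)) := by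
    have e : 4 * q * (2 * (2 * numEdges G)) =
      4 * q * (2 * numEdges G) + 2 * (2 * q) * (2 * numEdges G) := by ring
    omega
  exact Nat.le_of_mul_le_mul_left h5 (by omega)

/-- Averaging: the `2q` level cuts sum to at most `2m`, so not all of them can exceed `2m / (2q)`.
-/
theorem best_ne (h : Final G S T q P₀ mt₀ P C b m) (hq : 0 < q) : b ≠ 0 := by
  intro h0
  have h1 := sum_levelCut_le h.good.wf h.good.h_le
  have h2 := h.sum_ell hq
  have h3 : ∑ l ∈ range (2 * q), (2 * numEdges G + 1) ≤
      ∑ l ∈ range (2 * q), levelCut P (l + 1) * (2 * q) :=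
    sum_le_sum fun l hl => h.best.none h0 l (mem_range.1 hl)
  rw [← sum_mul, sum_const, card_range, smul_eq_mul, mul_comm _ (2 * q)] at h3
  have := Nat.le_of_mul_le_mul_left h3 (by omega)
  omega

theorem mt_ne (h : Final G S T q P₀ mt₀ P C b m) {v : Fin n} (hS : v ∈ S) (hT : v ∈ T) :
    C.mt v ≠ 0 :=
  h.good.mt₀ v (h.size ▸ v.2) ((h.start.mt v).2 ⟨hS, hT⟩)

/-- Edges leaving `A` inject into the darts that leave level `b`, at most `2m / (2q)`, and the `16`
slots of each lost source. There are at most `2q * t` lost sources with `t * 64 q² ≤ 2m`, so this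
second part is also at most `2m / (2q)`. -/
theorem cut_le (h : Final G S T q P₀ mt₀ P C b m) (hq : 0 < q) {A : Finset (Fin n)}
    (hA : ∀ v, v ∈ A ↔ b ≤ P.h v ∨ (v ∈ S ∧ C.mt v = 0)) :
    cutSize G A * q ≤ 2 * numEdges G := by
  have hn := h.size
  set N := (range P.n).filter fun v => P₀.src v ≠ 0 ∧ P.src v = 0 ∧ C.mt v = 0 with hN
  set E := (range (16 * n)).filter fun p => b ≤ P.h (p / 16) ∧ ¬ b ≤ P.h (P.rv p / 16) with hE
  have hcut : E.card = levelCut P b := by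
    rw [hE, levelCut, card_filter, hn]
    refine sum_congr rfl fun p _ => ?_
    by_cases h1 : b ≤ P.h (p / 16) <;> by_cases h2 : b ≤ P.h (P.rv p / 16) <;> simp [h1, h2]
  have hrv : P.rv = P₀.rv := h.good.rv
  have h1 : cutSize G A ≤ E.card + (N ×ˢ range 16).card := by
    choose! d hd using h.start.dart
    rw [cutSize]
    refine (card_le_card_of_injOn (t := E ∪ (N ×ˢ range 16).image fun x => 16 * x.1 + x.2)
      (fun x => d x.1 x.2) ?_ ?_).trans
      ((card_union_le _ _).trans (Nat.add_le_add_left card_image_le _))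
    · rintro ⟨u, v⟩ hx
      rw [mem_coe, SimpleGraph.mem_interedges_iff] at hx
      obtain ⟨hu, hv, hadj⟩ := hx
      rw [mem_compl, hA, not_or] at hv
      obtain ⟨h2, -, h3, h4⟩ := hd u v hadj
      simp only [coe_union, Set.mem_union, mem_coe]
      by_cases hb : b ≤ P.h u
      · left
        simp only [hE, mem_filter, mem_range]
        exact ⟨h2, by rwa [h3], by rw [hrv, h4]; exact hv.1⟩
      · right
        rw [hA] at hu
        obtain ⟨hS, hm⟩ := hu.resolve_left hb
        rw [mem_image]
        refine ⟨(u, d u v % 16), ?_, by dsimp only; omega⟩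
        simp only [mem_product, mem_range, hN, mem_filter]
        have hun : (u : ℕ) < P.n := hn ▸ u.2
        refine ⟨⟨hun, (h.start.src u).2 ⟨hS, fun hT => h.mt_ne hS hT hm, ?_⟩, ?_, hm⟩, by omega⟩
        · exact (G.degree_pos_iff_exists_adj u).2 ⟨v, hadj⟩
        -- A source still active at the end has height `2q ≥ b`, so an unmatched vertex below `b`
        -- with an edge must have been lost.
        · by_contra hs
          exact hb (h.best.le.trans (h.good.src_h u hun hs).ge)
    · rintro ⟨u, v⟩ hx ⟨u', v'⟩ hx' e
      rw [mem_coe, SimpleGraph.mem_interedges_iff] at hx hx'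
      obtain ⟨-, -, h3, h4⟩ := hd u v hx.2.2
      obtain ⟨-, -, h3', h4'⟩ := hd u' v' hx'.2.2
      dsimp only at e
      rw [e] at h3 h4
      exact Prod.ext (Fin.ext (h3.symm.trans h3')) (Fin.ext (h4.symm.trans h4'))
  rw [card_product, card_range, hcut] at h1
  have h2 := h.best.small (h.best_ne hq)
  have h3 : N.card ≤ 2 * q * (2 * numEdges G / (64 * (q * q))) := by
    rw [hN]; convert h.good.lost
  have h4 := Nat.div_mul_le_self (2 * numEdges G) (64 * (q * q))
  set t := 2 * numEdges G / (64 * (q * q))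
  have h5 := Nat.mul_le_mul_right (2 * q) h1
  have h6 := Nat.mul_le_mul_right (32 * q) h3
  have e1 : 2 * q * t * (32 * q) = t * (64 * (q * q)) := by ring
  have e2 : (levelCut P b + N.card * 16) * (2 * q) = levelCut P b * (2 * q) + N.card * (32 * q) := by
    ring
  have e3 : cutSize G A * (2 * q) = 2 * (cutSize G A * q) := by ring
  omega

/-- The path of a matched source. -/
theorem exists_path (h : Final G S T q P₀ mt₀ P C b m) {v : ℕ} (hv : v < n) (hm : C.mt v ≠ 0) :
    ∃ r : RoutedPair G, (r.src : ℕ) = v ∧ r.path.length = C.len v ∧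
      ∀ k ≤ C.len v, (r.path.getVert k : ℕ) = C.row v k := by
  have hn := h.size
  have hr := h.good.route v (hn ▸ hv) hm
  have h0 : 0 < n := by omega
  -- The default vertex only makes `f` total. It is not used at indices up to `C.len v`.
  set f : ℕ → Fin n := fun k => if hk : C.row v k < n then ⟨C.row v k, hk⟩ else ⟨0, h0⟩ with hf
  have hfv : ∀ k ≤ C.len v, (f k : ℕ) = C.row v k := fun k hk => by
    simp only [hf]
    rw [dif_pos (hn ▸ hr.lt k hk)]
  obtain ⟨p, h1, h2⟩ := exists_walk (G := G) (C.len v) f fun k hk => by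
    obtain ⟨p, hp, hne, e1, e2⟩ := hr.dart k hk
    rw [hn] at hp
    rw [h.good.rv] at hne e2
    obtain ⟨x, y, hxy, e3, e4⟩ := h.start.adj p hp hne
    have e5 : f k = x := Fin.ext (by rw [hfv k hk.le, ← e1, e3])
    have e6 : f (k + 1) = y := Fin.ext (by rw [hfv (k + 1) hk, ← e2, e4])
    rwa [e5, e6]
  refine ⟨⟨f 0, f (C.len v), p, ?_⟩, ?_, h1, fun k hk => ?_⟩
  · rw [← SimpleGraph.Walk.IsPath.getVert_injOn_iff]
    intro k hk k' hk' e
    simp only [Set.mem_ofPred_eq, h1] at hk hk'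
    rw [h2 k hk, h2 k' hk'] at e
    refine hr.inj k hk k' hk' ?_
    rw [← hfv k hk, ← hfv k' hk', e]
  · dsimp only
    rw [hfv 0 (Nat.zero_le _), h.good.first v (hn ▸ hv) hm]
  · dsimp only
    rw [h2 k hk, hfv k hk]

/-- The list of paths. -/
theorem exists_list (h : Final G S T q P₀ mt₀ P C b m) : ∃ L : List (RoutedPair G),
    L.length = ∑ v ∈ range n, C.mt v ∧
    (∀ (j : ℕ) (hj : j < L.length), C.mt L[j].src ≠ 0 ∧ pre C.mt L[j].src - 1 = j ∧
      L[j].path.length = C.len L[j].src ∧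
      ∀ k ≤ C.len L[j].src, (L[j].path.getVert k : ℕ) = C.row L[j].src k) ∧
    ∀ v : Fin n, C.mt v ≠ 0 → ∃ r ∈ L, r.src = v := by
  have hn := h.size
  have hex : ∀ j : Fin (∑ v ∈ range n, C.mt v), ∃ r : RoutedPair G, C.mt r.src ≠ 0 ∧
      pre C.mt r.src - 1 = j ∧ r.path.length = C.len r.src ∧
      ∀ k ≤ C.len r.src, (r.path.getVert k : ℕ) = C.row r.src k := by
    intro j
    obtain ⟨v, hv, hm, e⟩ := exists_pre_eq n (fun v hv => h.good.mt_le v (hn ▸ hv)) j.2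
    obtain ⟨r, h1, h2, h3⟩ := h.exists_path hv hm
    refine ⟨r, ?_⟩
    rw [h1]
    exact ⟨hm, e, h2, h3⟩
  choose r hr using hex
  refine ⟨List.ofFn r, by simp, fun j hj => ?_, fun v hv => ?_⟩
  · have e : (List.ofFn r)[j] = r ⟨j, by simpa using hj⟩ := List.getElem_ofFn hj
    rw [e]
    exact hr _
  · have h1 := pre_le_total C.mt v.2
    have h2 := pre_pos hv
    have h3 : pre C.mt v - 1 < ∑ v ∈ range n, C.mt v := by omega
    refine ⟨r ⟨_, h3⟩, List.mem_ofFn.2 ⟨_, rfl⟩, Fin.ext ?_⟩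
    exact pre_inj (hr _).1 hv (hr ⟨_, h3⟩).2.1

end Final

end CutMatch

/-! ### Correctness of the output -/

namespace CutMatch

open Finset ParRAM

namespace Final

variable {n : ℕ} {G : SimpleGraph (Fin n)} [DecidableRel G.Adj] {S T : Finset (Fin n)} {q : ℕ}
  {P₀ P : Net} {mt₀ : ℕ → ℕ} {C : Rec} {b : ℕ} {m : Mem}

/-- The alternatives for a matched source and the end `x` of its path. -/
theorem source (h : Final G S T q P₀ mt₀ P C b m) {v x : Fin n} (hm : C.mt v ≠ 0)
    (hx : C.fin v = x) :
    (v ∈ S ∧ v ∈ T ∧ x = v) ∨ (v ∈ S ∧ v ∉ T ∧ x ∈ T ∧ x ∉ S) := by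
  have hvn : (v : ℕ) < P.n := h.size ▸ v.2
  rcases h.good.origin v hvn hm with ⟨h1, h2⟩ | ⟨h1, h2, -⟩
  · obtain ⟨h3, h4⟩ := (h.start.mt v).1 h1
    refine Or.inl ⟨h3, h4, Fin.ext ?_⟩
    rw [← hx, Rec.fin, h2, h.good.first v hvn hm]
  · rw [hx] at h2
    obtain ⟨h3, h4, -⟩ := (h.start.src v).1 h1
    exact Or.inr ⟨h3, h4, (h.start.fr x).1 h2⟩

/-- Trivial paths end in `S ∩ T` and all others in `T \ S`, so the two kinds cannot share an end.
Within the second kind injectivity is part of the invariant. -/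
theorem fin_inj (h : Final G S T q P₀ mt₀ P C b m) {v v' x : Fin n} (hm : C.mt v ≠ 0)
    (hm' : C.mt v' ≠ 0) (hx : C.fin v = x) (hx' : C.fin v' = x) : v = v' := by
  have hvn : (v : ℕ) < P.n := h.size ▸ v.2
  have hvn' : (v' : ℕ) < P.n := h.size ▸ v'.2
  have key : ∀ u : Fin n, C.mt u ≠ 0 → u ∉ T → P₀.src u ≠ 0 := by
    intro u hu hT
    rcases h.good.origin u (h.size ▸ u.2) hu with ⟨h1, -⟩ | ⟨h1, -⟩
    · exact absurd ((h.start.mt u).1 h1).2 hT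
    · exact h1
  rcases h.source hm hx with ⟨h1, h2, h3⟩ | ⟨h1, h2, h3, h4⟩ <;>
    rcases h.source hm' hx' with ⟨h1', h2', h3'⟩ | ⟨h1', h2', h3', h4'⟩
  · rw [← h3, ← h3']
  · rw [h3] at h4'; exact absurd h1 h4'
  · rw [h3'] at h4; exact absurd h1' h4
  · exact Fin.ext (h.good.fin_inj v hvn v' hvn' hm hm' (key v hm h2) (key v' hm' h2')
      (hx.trans hx'.symm))

/-- The output of the algorithm. -/
theorem output (h : Final G S T q P₀ mt₀ P C b m) (hq : 0 < q) :
    ∃ (A : Finset (Fin n)) (L : List (RoutedPair G)), IsOutput A L m ∧ EmbedsMatching S T L ∧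
      (∀ e ∈ G.edgeSet, congestion L e ≤ n ∧
        ∃ j, 2 ^ j ≤ 4 * q + 1 ∧ congestion L e ≤ 4 * q * (j + 1)) ∧
      (∀ s ∈ S, (∀ p ∈ L, p.src ≠ s) → s ∈ A) ∧
      (∀ t ∈ T, (∀ p ∈ L, p.dst ≠ t) → t ∉ A) ∧
      cutSize G A * q ≤ 2 * numEdges G := by
  classical
  have hn := h.size
  obtain ⟨L, hlen, hL, hall⟩ := h.exists_list
  set A : Finset (Fin n) := univ.filter fun v : Fin n => b ≤ P.h v ∨ (v ∈ S ∧ C.mt v = 0) with hAd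
  have hA : ∀ v, v ∈ A ↔ b ≤ P.h v ∨ (v ∈ S ∧ C.mt v = 0) := fun v => by simp [hAd]
  have hmem : ∀ r ∈ L, C.mt r.src ≠ 0 ∧ r.path.length = C.len r.src ∧
      ∀ k ≤ C.len r.src, (r.path.getVert k : ℕ) = C.row r.src k := by
    intro r hr
    obtain ⟨j, hj, rfl⟩ := List.mem_iff_getElem.1 hr
    obtain ⟨h1, -, h2⟩ := hL j hj
    exact ⟨h1, h2⟩
  have hdst : ∀ r ∈ L, C.fin r.src = r.dst := by
    intro r hr
    obtain ⟨-, h1, h2⟩ := hmem r hr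
    rw [Rec.fin, ← h2 _ le_rfl, ← h1, SimpleGraph.Walk.getVert_length]
  have hsrc : ∀ (i j : ℕ) (hi : i < L.length) (hj : j < L.length), L[i].src = L[j].src → i = j := by
    intro i j hi hj e
    rw [← (hL i hi).2.1, ← (hL j hj).2.1, e]
  have hnd : (L.map RoutedPair.src).Nodup := by
    rw [List.nodup_iff_injective_get]
    rintro ⟨i, hi⟩ ⟨j, hj⟩ e
    simp only [List.get_eq_getElem, List.getElem_map] at e
    exact Fin.ext (hsrc i j _ _ e)
  refine ⟨A, L, ⟨fun v => ?_, ?_, fun j hj => ?_, fun j hj k hk => ?_⟩, ⟨fun r hr => ?_, hnd, ?_⟩,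
    fun e he => ?_, fun s hs hns => ?_, fun t ht hnt => ?_, h.cut_le hq hA⟩
  · rw [h.cut]
    simp only [hA]
  · rw [h.count, hlen]
  · obtain ⟨h1, h2, h3, -⟩ := hL j hj
    have := h.length _ L[j].src.2 h1
    rw [h2] at this
    rw [this, h3]
  · obtain ⟨h1, h2, h3, h4⟩ := hL j hj
    have := h.offset _ L[j].src.2 h1
    rw [h2] at this
    rw [this, h.vertex, h4 k (h3 ▸ hk)]
  · rcases h.source (hmem r hr).1 (hdst r hr) with ⟨h1, h2, h3⟩ | ⟨h1, -, h3, -⟩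
    · exact ⟨h1, h3 ▸ h2⟩
    · exact ⟨h1, h3⟩
  · rw [List.nodup_iff_injective_get]
    rintro ⟨i, hi⟩ ⟨j, hj⟩ e
    simp only [List.get_eq_getElem, List.getElem_map] at e
    rw [List.length_map] at hi hj
    have hmi := L.getElem_mem hi
    have hmj := L.getElem_mem hj
    exact Fin.ext (hsrc i j hi hj (h.fin_inj (hmem _ hmi).1 (hmem _ hmj).1 (hdst _ hmi)
      (e ▸ hdst _ hmj)))
  · induction e with
    | _ u v =>
    obtain ⟨p, hp, hne, hu, hv⟩ := h.start.dart u v he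
    have hne' : P.rv p ≠ p := by rwa [h.good.rv]
    have hload := h.good.load p (by omega) hne'
    set N := (range P.n).filter fun v => C.mt v ≠ 0 ∧ Uses P.rv (C.row v) (C.len v) p with hN
    have hcong : congestion L s(u, v) ≤ N.card := by
      set L' := L.filter fun r => decide (s(u, v) ∈ r.path.edges) with hL'
      have hnd' : (L'.map fun r => (r.src : ℕ)).Nodup := by
        have h1 : (L'.map RoutedPair.src).Nodup := hnd.sublist (List.filter_sublist.map _)
        have h2 := h1.map Fin.val_injective
        rwa [List.map_map] at h2
      rw [congestion, List.countP_eq_length_filter, ← List.length_map (fun r => (r.src : ℕ)),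
        ← List.toFinset_card_of_nodup hnd']
      refine card_le_card fun x hx => ?_
      rw [List.mem_toFinset, List.mem_map] at hx
      obtain ⟨r, hr, rfl⟩ := hx
      rw [hL', List.mem_filter] at hr
      obtain ⟨hr, he⟩ := hr
      obtain ⟨h1, h2, h3⟩ := hmem r hr
      obtain ⟨k, hk, e⟩ := (SimpleGraph.Walk.mk_mem_edges_iff_exists _).1 (of_decide_eq_true he)
      rw [h2] at hk
      rw [hN, mem_filter, mem_range]
      refine ⟨hn ▸ r.src.2, h1, k, hk, ?_⟩
      rw [← h3 k hk.le, ← h3 (k + 1) hk, h.good.rv, hu, hv]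
      rcases Sym2.eq_iff.1 e with ⟨e1, e2⟩ | ⟨e1, e2⟩
      · exact Or.inl ⟨by rw [e1], by rw [e2]⟩
      · exact Or.inr ⟨by rw [e1], by rw [e2]⟩
    obtain ⟨j, hj, hle⟩ := hload
    have hell := h.good.ell_le p (by omega)
    -- Both bounds are recorded: the one by `n` serves the range in which `q` is larger than `n`.
    refine ⟨hcong.trans ((card_filter_le _ _).trans (by rw [card_range, hn])), j, ?_, ?_⟩
    · rw [← hj]; omega
    · have hle' : N.card + P.z p ≤ 4 * q * j + 4 * q := by rw [hN]; convert hle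
      rw [mul_add, mul_one]; omega
  · rw [hA]
    refine Or.inr ⟨hs, ?_⟩
    by_contra hm
    obtain ⟨r, hr, e⟩ := hall s hm
    exact hns r hr e
  -- A sink that ends no path is outside `S` and still free by `covered`, hence at height `0`, below
  -- the chosen level.
  · have hmt : ∀ v : Fin n, C.mt v ≠ 0 → C.fin v ≠ t := by
      intro v hm e
      obtain ⟨r, hr, rfl⟩ := hall v hm
      exact hnt r hr (Fin.ext ((hdst r hr).symm.trans e))
    have htS : t ∉ S := by
      intro hS
      have hm := h.mt_ne hS ht
      obtain ⟨r, hr, e⟩ := hall t hm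
      rcases h.source (hmem r hr).1 (hdst r hr) with ⟨-, -, h3⟩ | ⟨-, h2, -⟩
      · exact hnt r hr (h3.trans e)
      · exact h2 (e ▸ ht)
    have htn : (t : ℕ) < P.n := hn ▸ t.2
    have hfr : P.fr t ≠ 0 := by
      intro h0
      obtain ⟨v, hv, h1, -, h2⟩ := h.good.covered t htn ((h.start.fr t).2 ⟨ht, htS⟩) h0
      exact hmt ⟨v, hn ▸ hv⟩ h1 h2
    have hb := h.best_ne hq
    rw [hA, h.good.wf.h_fr t htn hfr]
    rintro (h1 | ⟨h1, -⟩)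
    · omega
    · exact htS h1

end Final

end CutMatch

/-! ### Numerical estimates -/

namespace CutMatch

open Finset ParRAM

/-- A vertex is isolated or contributes at least `1` to the sum of degrees. Thus work of order `n`
is covered by `m + n₀`. -/
theorem le_two_mul_numEdges_add {n : ℕ} (G : SimpleGraph (Fin n)) [DecidableRel G.Adj] :
    n ≤ 2 * numEdges G + numIsolated G := by
  rw [numEdges, ← G.sum_degrees_eq_twice_card_edges, numIsolated, card_filter, ← sum_add_distrib]
  calc n = ∑ _v : Fin n, 1 := by simp
    _ ≤ _ := sum_le_sum fun v _ => by split_ifs <;> omega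

theorem work_le {n s m L q : ℕ} (hs : n ≤ 2 * s) (hm : m ≤ s) (h1 : 1 ≤ s) (hL : 1 ≤ L)
    (hq : 1 ≤ q) :
    (2 * q + 1) * (17 * L * ((8 * q + 1) * (2 * m)) + (16 * n + 2) * L * (2 * q + 1) + 2) ≤
      1300 * (q ^ 2 * L * s) := by
  have a1 : 2 * q + 1 ≤ 3 * q := by omega
  have a2 : 8 * q + 1 ≤ 9 * q := by omega
  have a3 : 16 * n + 2 ≤ 34 * s := by omega
  have a4 : 1 ≤ L * q * s := Nat.mul_pos (Nat.mul_pos hL hq) h1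
  calc _ ≤ 3 * q * (17 * L * (9 * q * (2 * s)) + 34 * s * L * (3 * q) + 2 * (L * q * s)) := by
        gcongr; omega
    _ = 1230 * (q ^ 2 * L * s) := by ring
    _ ≤ _ := by gcongr; norm_num

theorem span_le {L q : ℕ} (hL : 1 ≤ L) (hq : 1 ≤ q) :
    (2 * q + 1) * (L * ((8 * q + 1) * (64 * (q * q))) + 2 * L * (2 * q + 1) + 2) ≤
      1800 * (q ^ 4 * L) := by
  have a1 : 2 * q + 1 ≤ 3 * q := by omega
  have a2 : 8 * q + 1 ≤ 9 * q := by omega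
  have a3 : q ≤ q ^ 3 := Nat.le_self_pow (by norm_num) q
  have a4 : 1 ≤ L * q ^ 3 := Nat.mul_pos hL (pow_pos hq 3)
  calc _ ≤ 3 * q * (L * (9 * q * (64 * (q * q))) + 2 * L * (3 * q ^ 3) + 2 * (L * q ^ 3)) := by
        gcongr
        · omega
        · omega
    _ = 1752 * (q ^ 4 * L) := by ring
    _ ≤ _ := by gcongr; norm_num

/-- The constant comes from `3 / log 2 < 5`. -/
theorem le_log_of_two_pow_le {n k : ℕ} (h : 2 ^ k ≤ (n + 2) ^ 3) :
    (k : ℝ) ≤ 5 * Real.log (n + 2) := by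
  have h1 : Real.log (2 ^ k) ≤ Real.log ((n + 2) ^ 3) :=
    Real.log_le_log (by positivity) (by exact_mod_cast h)
  rw [Real.log_pow, Real.log_pow] at h1
  have h2 := Real.log_two_gt_d9
  have h3 : (0 : ℝ) ≤ k := Nat.cast_nonneg k
  push_cast at h1
  nlinarith

theorem one_le_log {n : ℕ} (hn : 0 < n) : 1 ≤ Real.log (n + 2) := by
  rw [Real.le_log_iff_exp_le (by positivity)]
  have h1 := Real.exp_one_lt_d9
  have h2 : (1 : ℝ) ≤ n := by exact_mod_cast hn
  linarith

theorem clog_le_log {n : ℕ} (hn : 0 < n) :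
    ((Nat.clog 2 (16 * n) + 2 : ℕ) : ℝ) ≤ 8 * Real.log (n + 2) := by
  have h1 := one_le_log hn
  have h2 := Nat.pow_pred_clog_lt_self (b := 2) (by norm_num) (show 1 < 16 * n by omega)
  have h3 := le_log_of_two_pow_le (n := n) (h2.le.trans (by nlinarith [sq_nonneg n]))
  have h4 : Nat.clog 2 (16 * n) = (Nat.clog 2 (16 * n)).pred + 1 := by
    have := Nat.clog_pos (b := 2) (by norm_num) (show 2 ≤ 16 * n by omega)
    rw [Nat.pred_eq_sub_one]; omega
  rw [h4]
  push_cast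
  linarith

/-- The natural bound has a factor `log q`. For `q ≤ n` it is at most of order `log n`, and for `q ≥
n` the number of paths is at most `n ≤ q`. So the polylogarithmic factor depends on `n` alone. -/
theorem congestion_le {n q j X : ℕ} (hn : 0 < n) (hX : X ≤ n) (hj : 2 ^ j ≤ 4 * q + 1)
    (h : X ≤ 4 * q * (j + 1)) : (X : ℝ) ≤ 24 * q * Real.log (n + 2) := by
  have h1 := one_le_log hn
  rcases le_total q n with hq | hq
  · have h2 := le_log_of_two_pow_le (n := n) (hj.trans (by nlinarith [sq_nonneg n]))
    calc (X : ℝ) ≤ 4 * q * (j + 1) := by exact_mod_cast h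
      _ ≤ 4 * q * (6 * Real.log (n + 2)) := by gcongr; linarith
      _ = _ := by ring
  · have h2 : (X : ℝ) ≤ q := by exact_mod_cast hX.trans hq
    have h3 : (0 : ℝ) ≤ q := Nat.cast_nonneg q
    nlinarith

/-- With `B = (n + q) ^ 6` the values of expressions are at most `(n + q) ^ (6 * size) ≤ 2 ^ (6 *
size * clog)`. One further multiple of the logarithm makes the inequality strict. -/
theorem fits_main {n q : ℕ} (h : 3 ≤ n + q) :
    Fits ((6 * Code.main.size + 1) * Nat.clog 2 (n + q)) ((n + q) ^ 6) Code.main := by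
  refine ⟨(by omega : 2 ≤ n + q).trans (Nat.le_self_pow (by norm_num) _), ?_⟩
  have h1 := Nat.le_pow_clog (b := 2) (by norm_num) (n + q)
  have h2 := Nat.clog_pos (b := 2) (by norm_num) (show 2 ≤ n + q by omega)
  rw [← pow_mul]
  calc _ ≤ (2 ^ Nat.clog 2 (n + q)) ^ (6 * Code.main.size) := Nat.pow_le_pow_left h1 _
    _ = 2 ^ (6 * Code.main.size * Nat.clog 2 (n + q)) := by rw [← pow_mul, mul_comm]
    _ < _ := Nat.pow_lt_pow_right (by norm_num) (by rw [add_mul]; omega)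

end CutMatch

/-! ### The main theorem -/

theorem mainTheorem5 :
    -- one program; constants for the word length and for the polylogarithmic factors
    ∃ (prog : ParRAM.Prog) (κ K k : ℕ),
      ∀ (n : ℕ) (_hn : 0 < n) (G : SimpleGraph (Fin n)) [DecidableRel G.Adj]
        (_hdeg : ∀ v, G.degree v ≤ 16)
        (φ : ℝ) (_hφ0 : 0 < φ) (_hφ1 : φ < 1)
        (S T : Finset (Fin n)) (_hST : S.card ≤ T.card)
        (mem : ParRAM.Mem) (_hmem : CutMatch.IsInput G S T ⌈1 / φ⌉₊ mem),
      ∃ o : ParRAM.Outcome,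
        ParRAM.Exec (κ * Nat.clog 2 (n + ⌈1 / φ⌉₊)) prog (fun _ => 0) mem o ∧
        (o.work : ℝ) ≤ K * Real.log (n + 2) ^ k *
          ((CutMatch.numEdges G + CutMatch.numIsolated G : ℝ) / φ ^ 2) ∧
        (o.span : ℝ) ≤ K * Real.log (n + 2) ^ k * (1 / φ ^ 4) ∧
        ∃ (C : Finset (Fin n)) (P : List (CutMatch.RoutedPair G)),
          CutMatch.IsOutput C P o.mem ∧
          CutMatch.EmbedsMatching S T P ∧
          (∀ e ∈ G.edgeSet,
            (CutMatch.congestion P e : ℝ) ≤ K * Real.log (n + 2) ^ k * (1 / φ)) ∧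
          (∀ s ∈ S, (∀ p ∈ P, p.src ≠ s) → s ∈ C) ∧
          (∀ t ∈ T, (∀ p ∈ P, p.dst ≠ t) → t ∉ C) ∧
          (C = ∅ ∨
            (CutMatch.cutSize G C : ℝ) ≤
              φ * CutMatch.vol G C + 2 * φ * CutMatch.numEdges G) := by
  open CutMatch in
  -- The constant `300000` dominates `41600` for work, `230400` for span and `48` for congestion.
  -- The factor `size + 1` turns the relative bounds of `Tc` into absolute ones. One logarithm
  -- suffices.
  refine ⟨Code.main, 6 * Code.main.size + 1, 300000 * (Code.main.size + 1), 1, ?_⟩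
  intro n hn G _ hdeg φ hφ0 hφ1 S T _ mem hmem
  set q := ⌈1 / φ⌉₊ with hq
  set s := Code.main.size with hs
  have hφ : 1 < 1 / φ := by rwa [lt_div_iff₀ hφ0, one_mul]
  have hq1 : 1 / φ ≤ q := Nat.le_ceil _
  have hq2 : 2 ≤ q := by
    have : (1 : ℝ) < q := hφ.trans_le hq1
    exact_mod_cast this
  -- Rounding up at most doubles `1 / φ`, because `φ < 1`.
  have hq3 : (q : ℝ) ≤ 2 * (1 / φ) := by
    have := Nat.ceil_lt_add_one (zero_le_one.trans hφ.le)
    rw [← hq] at this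
    linarith
  have hN : 3 ≤ n + q := by omega
  -- The sixth power leaves factors `3 ^ 5` and `3 ^ 4` over linear and quadratic quantities, since
  -- `n + q ≥ 3`. This absorbs the constants `32` and `64`.
  have hB : 32 * n + 2 ≤ (n + q) ^ 6 :=
    calc 32 * n + 2 ≤ 3 ^ 5 * (n + q) := by omega
      _ ≤ (n + q) ^ 5 * (n + q) := by gcongr
      _ = _ := by ring
  have hB2 : 64 * (q * q) + 2 ≤ (n + q) ^ 6 :=
    calc 64 * (q * q) + 2 ≤ 3 ^ 4 * (q * q) := by nlinarith
      _ ≤ (n + q) ^ 4 * ((n + q) * (n + q)) := by gcongr <;> omega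
      _ = _ := by ring
  have hB3 : n * (2 * q + 1) ≤ (n + q) ^ 6 :=
    calc n * (2 * q + 1) ≤ (n + q) * (3 * (n + q)) := by gcongr <;> omega
      _ ≤ (n + q) * (3 ^ 4 * (n + q)) := by gcongr; norm_num
      _ ≤ (n + q) * ((n + q) ^ 4 * (n + q)) := by gcongr
      _ = _ := by ring
  obtain ⟨o, ho, hwork, hspan, P₀, mt₀, P, R, b, hfin⟩ :=
    Tc.main (fits_main hN) hmem hdeg hB hB2 (by omega) hB3 le_rfl le_rfl le_rfl
  obtain ⟨A, L, h1, h2, h3, h4, h5, h6⟩ := hfin.output (by omega)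
  have hlog := one_le_log hn
  have hL := clog_le_log hn
  have hs0 : (0 : ℝ) ≤ s := Nat.cast_nonneg s
  have hn2 := le_two_mul_numEdges_add G
  refine ⟨o, ho, ?_, ?_, A, L, h1, h2, fun e he => ?_, h4, h5, Or.inr ?_⟩
  · have hw := hwork.trans (Nat.mul_le_mul_left _ (work_le (s := numEdges G + numIsolated G)
      (by omega) (by omega) (by omega) (by omega) (by omega)))
    have hw : (o.work : ℝ) ≤ s * (1300 * ((q : ℝ) ^ 2 * (Nat.clog 2 (16 * n) + 2 : ℕ) *
      (numEdges G + numIsolated G))) := by exact_mod_cast hw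
    calc (o.work : ℝ) ≤ _ := hw
      _ ≤ (s + 1) * (1300 * ((2 * (1 / φ)) ^ 2 * (8 * Real.log (n + 2)) *
          (numEdges G + numIsolated G))) := by gcongr; linarith
      _ = 41600 * ((s + 1) * Real.log (n + 2) *
          ((numEdges G + numIsolated G) / φ ^ 2)) := by field_simp; ring
      _ ≤ 300000 * ((s + 1) * Real.log (n + 2) *
          ((numEdges G + numIsolated G) / φ ^ 2)) := by gcongr; norm_num
      _ = _ := by push_cast; ring
  · have hw := hspan.trans (Nat.mul_le_mul_left _ (span_le (by omega) (by omega)))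
    have hw : (o.span : ℝ) ≤ s * (1800 * ((q : ℝ) ^ 4 * (Nat.clog 2 (16 * n) + 2 : ℕ))) := by
      exact_mod_cast hw
    calc (o.span : ℝ) ≤ _ := hw
      _ ≤ (s + 1) * (1800 * ((2 * (1 / φ)) ^ 4 * (8 * Real.log (n + 2)))) := by gcongr; linarith
      _ = 230400 * ((s + 1) * Real.log (n + 2) * (1 / φ ^ 4)) := by field_simp; ring
      _ ≤ 300000 * ((s + 1) * Real.log (n + 2) * (1 / φ ^ 4)) := by gcongr; norm_num
      _ = _ := by push_cast; ring
  · obtain ⟨h7, j, h8, h9⟩ := h3 e he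
    calc (congestion L e : ℝ) ≤ 24 * q * Real.log (n + 2) := congestion_le hn h7 h8 h9
      _ ≤ 24 * (2 * (1 / φ)) * Real.log (n + 2) := by gcongr
      _ = 48 * (1 * Real.log (n + 2) * (1 / φ)) := by ring
      _ ≤ 300000 * ((s + 1) * Real.log (n + 2) * (1 / φ)) := by
          gcongr
          · norm_num
          · linarith
      _ = _ := by push_cast; ring
  -- As `q * φ ≥ 1`, the bound `cutSize * q ≤ 2m` already gives `cutSize ≤ 2 φ m`. The volume term
  -- is only added.
  · have h7 : (cutSize G A : ℝ) * q ≤ 2 * numEdges G := by exact_mod_cast h6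
    have h8 : 1 ≤ q * φ := by rwa [div_le_iff₀ hφ0] at hq1
    have h9 : (0 : ℝ) ≤ φ * vol G A := by positivity
    calc (cutSize G A : ℝ) ≤ cutSize G A * (q * φ) := le_mul_of_one_le_right (by positivity) h8
      _ = cutSize G A * q * φ := by ring
      _ ≤ 2 * numEdges G * φ := by gcongr
      _ ≤ _ := by linarith
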